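/- Let $V\in C^1([0,1])$ with $V>0$ on $[0,1]$. Consider the forced Burgers equation on $[0,1]$ $$\partial_t u+u\,\partial_x u=\partial_{xx}^2u+2\,\partial_xV,\qquad u(t,0)=u(t,1)=0,\qquad u(0,\cdot)=u_0\in L^2([0,1]),\tag{B}$$ where a solution is a function $u$ on $(0,\infty)\times[0,1]$ for which $u,\partial_tu,\partial_xu,\partial^2_{xx}u$ exist and are continuous there, which satisfies the equation and the boundary conditions for all $t>0$, and for which $\|u(t,\cdot)-u_0\|_{L^2}\to0$ as $t\to0^+$. *Notation.* Let $\mu_0\le\mu_1\le\dots$ be the eigenvalues of $-\partial_{xx}^2+V$ on $[0,1]$ with Neumann boundary conditions, and $(e_n)_{n\in\mathbb N}$ an associated complete orthonormal system of eigenfunctions in $L^2([0,1])$, with $e_0>0$ on $[0,1]$. Put $m_0=\inf_{[0,1]}e_0$, $c_n(v)=\int_0^1e_nv$, $\tilde f_0=e_0/\int_0^1e_0$, and $$H(u)(x)=\frac{e^{-\frac12\int_0^xu}}{\int_0^1e^{-\frac12\int_0^yu}\,dy},\qquad C(v)=-2\,\frac{\partial_xv}{v},\qquad s_0=C(\tilde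 f_0)=-2\,\frac{\partial_xe_0}{e_0}$$ ($s_0$ is called the sink). Let $C_1$ be any constant such that $\sup_{[0,1]}|f|\le C_1\|f\|_{H^1}$ for all $f\in H^1(]0,1[)$, where $\|f\|_{H^1}^2=\|f\|_{L^2}^2+\|\partial_xf\|_{L^2}^2$, and $$h_1(t)=C_1\Big(\sum_{n\ge1}(1+\mu_n)e^{-2(\mu_n-\mu_0)t}\Big)^{1/2}\quad(t>0),$$ $$\tau_{\mathcal B}(u_0)=h_1^{-1}\Big(\frac{m_0^2}{\|H(u_0)-\tilde f_0\|_{L^2}}\Big),\qquad \Omega_{\mathcal B}(\theta_0)=\Big\{u_0\in L^2([0,1]):\ \|H(u_0)-\tilde f_0\|_{L^2}<\frac{m_0^2}{h_1(\theta_0)}\Big\},$$ with $\tau_{\mathcal B}(u_0)=0$ if $H(u_0)=\tilde f_0$. For $m\in\mathbb N$ and $\nu=(q_0,q_1,\dots,q_m)$ with $q_0\in\mathbb N$ and $(q_1,\dots,q_m)\in(\mathbb N\setminus\{0\})^m$ let $$\lambda_\nu=\sum_{i=0}^m(\mu_{q_i}-\mu_0),\qquad \varphi_\nu(u_0)=\prod_{i=0}^m\frac{c_{q_i}(H(u_0))}{c_0(H(u_0))},\qquad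 a_\nu(x)=2(-1)^{m+1}\,\frac{\partial_xe_{q_0}(x)}{e_0(x)}\prod_{i=1}^m\frac{e_{q_i}(x)}{e_0(x)} .$$ *Statement.* For every $u_0\in L^2([0,1])$ problem (B) has exactly one solution $u$; systems $(\mu_n,e_n)$ and constants $C_1$ as above exist; and for every choice of them the following hold. 1. The series defining $h_1$ converges for every $t>0$, and $h_1$ is a strictly decreasing continuous bijection of $(0,\infty)$ onto itself (so $\tau_{\mathcal B}$ is well defined). 2. For every $u_0\in L^2([0,1])$ and every $t>\tau_{\mathcal B}(u_0)$, with $v_0=H(u_0)$, one has $$\frac{\|v_0-c_0(v_0)e_0\|_{L^2}}{c_0(v_0)\,m_0}\,h_1(t)<1,$$ and for every $x\in[0,1]$ $$u(t,x)=\sum_{q_0=0}^\infty\ \sum_{m=0}^\infty\ \sum_{(q_1,\dots,q_m)\in(\mathbb N\setminus\{0\})^m}e^{-\lambda_\nu t}\,\varphi_\nu(u_0)\,a_\nu(x),\tag{K}$$ where the sums are taken in the order written (first over $(q_1,\dots,q_m)$, then over $m$, then over $q_0$) and the series at each of the three levels converges unconditionally. No unconditional convergence of the full triple family is claimed. 3.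 For every $\theta_0>0$ the set $\Omega_{\mathcal B}(\theta_0)$ is a neighbourhood of $s_0$ in $L^2([0,1])$, and for every $u_0\in\Omega_{\mathcal B}(\theta_0)$ formula (K) holds for all $t>\theta_0$ and all $x\in[0,1]$. -/

import Mathlib

open Set Filter Topology MeasureTheory

noncomputable section

namespace KoopmanBurgers

/-- The closed unit interval `[0,1]` as a set of reals. -/
abbrev UI : Set ℝ := Icc (0 : ℝ) 1

/-- Lebesgue measure on `[0,1]`. -/
abbrev volUI : Measure ℝ := volume.restrict UI

/-- The space `L²([0,1])` of real functions. -/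
abbrev L2UI : Type := Lp ℝ 2 volUI

/-- Space derivative on `[0,1]` (one-sided at the end points). -/
def dx (f : ℝ → ℝ) (x : ℝ) : ℝ := derivWithin f UI x

/-- The `L²([0,1])` norm of a function (used for continuous functions only). -/
def l2norm (f : ℝ → ℝ) : ℝ := Real.sqrt (∫ x in (0 : ℝ)..1, f x ^ 2)

/-! ### The Burgers equation -/

/-- `u t x` solves `∂ₜu + u ∂ₓu = ∂ₓₓu + 2 ∂ₓV` on `(0,∞) × [0,1]`, with `u(t,0) = u(t,1) = 0`,
classically for `t > 0`, and takes the Cauchy data `u₀ ∈ L²([0,1])` in the `L²` sense. -/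
structure IsBurgersSolution (V : ℝ → ℝ) (u₀ : L2UI) (u : ℝ → ℝ → ℝ) : Prop where
  diff_time : ∀ t, 0 < t → ∀ x ∈ UI, DifferentiableAt ℝ (fun s => u s x) t
  contDiff_space : ∀ t, 0 < t → ContDiffOn ℝ 2 (u t) UI
  cont : ContinuousOn (fun p : ℝ × ℝ => u p.1 p.2) (Ioi 0 ×ˢ UI)
  cont_dt : ContinuousOn (fun p : ℝ × ℝ => deriv (fun s => u s p.2) p.1) (Ioi 0 ×ˢ UI)
  cont_dx : ContinuousOn (fun p : ℝ × ℝ => dx (u p.1) p.2) (Ioi 0 ×ˢ UI)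
  cont_dxx : ContinuousOn (fun p : ℝ × ℝ => dx (dx (u p.1)) p.2) (Ioi 0 ×ˢ UI)
  equation : ∀ t, 0 < t → ∀ x ∈ UI,
    deriv (fun s => u s x) t + u t x * dx (u t) x = dx (dx (u t)) x + 2 * dx V x
  boundary_zero : ∀ t, 0 < t → u t 0 = 0
  boundary_one : ∀ t, 0 < t → u t 1 = 0
  initial : Tendsto (fun t => eLpNorm (fun x => u t x - u₀ x) 2 volUI) (𝓝[>] 0) (𝓝 0)

/-! ### Cole-Hopf transforms -/

/-- `H(u)(x) = exp(-½ ∫₀ˣ u) / ∫₀¹ exp(-½ ∫₀ʸ u) dy`. -/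
def coleHopfH (u : L2UI) (x : ℝ) : ℝ :=
  Real.exp (-(1 / 2) * ∫ s in (0 : ℝ)..x, u s) /
    ∫ y in (0 : ℝ)..1, Real.exp (-(1 / 2) * ∫ s in (0 : ℝ)..y, u s)

/-- `C(v) = -2 ∂ₓv / v`. -/
def coleHopfC (v : ℝ → ℝ) (x : ℝ) : ℝ := -2 * (dx v x / v x)

/-! ### Spectral data of `-∂ₓₓ + V` with Neumann boundary conditions -/

/-- `μ` is the nondecreasing sequence of the Neumann eigenvalues of `-∂ₓₓ + V` on `[0,1]`, repeated
according to multiplicity, and `e` is an associated complete orthonormal sequence of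
eigenfunctions, with the sign of `e 0` chosen so that `e 0 > 0`. -/
structure IsNeumannEigensystem (V : ℝ → ℝ) (μ : ℕ → ℝ) (e : ℕ → ℝ → ℝ) : Prop where
  mono : Monotone μ
  contDiff : ∀ n, ContDiffOn ℝ 2 (e n) UI
  eigen : ∀ n, ∀ x ∈ UI, dx (dx (e n)) x - V x * e n x = -μ n * e n x
  neumann_zero : ∀ n, dx (e n) 0 = 0
  neumann_one : ∀ n, dx (e n) 1 = 0
  orthonormal : ∀ m n, (∫ x in (0 : ℝ)..1, e m x * e n x) = if m = n then 1 else 0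
  complete : ∀ f : L2UI, (∀ n, (∫ x in (0 : ℝ)..1, f x * e n x) = 0) → f = 0
  pos : ∀ x ∈ UI, 0 < e 0 x

/-- `c_n(v) = ∫₀¹ e_n v`. -/
def coeff (e : ℕ → ℝ → ℝ) (n : ℕ) (v : ℝ → ℝ) : ℝ := ∫ x in (0 : ℝ)..1, e n x * v x

/-- `m₀ = inf_{[0,1]} e₀`. -/
def m0 (e : ℕ → ℝ → ℝ) : ℝ := sInf (e 0 '' UI)

/-- `f̃₀ = e₀ / ∫₀¹ e₀`. -/
def fTilde (e : ℕ → ℝ → ℝ) (x : ℝ) : ℝ := e 0 x / ∫ y in (0 : ℝ)..1, e 0 y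

/-- The sink `s₀ = C(f̃₀)`. -/
def sink (e : ℕ → ℝ → ℝ) : ℝ → ℝ := coleHopfC (fTilde e)

/-! ### The function `h₁`, the time `τ_B` and the sets `Ω_B(θ₀)` -/

/-- `C₁` is a constant in the Sobolev inequality `sup |f| ≤ C₁ ‖f‖_{H¹}` on `[0,1]`. Here `f` is the
continuous representative of an element of `H¹`, with weak derivative `g ∈ L²`. -/
def IsSobolevConstant (C₁ : ℝ) : Prop :=
  ∀ (f : ℝ → ℝ) (g : L2UI), (∀ x ∈ UI, f x = f 0 + ∫ s in (0 : ℝ)..x, g s) →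
    ∀ x ∈ UI, |f x| ≤ C₁ * Real.sqrt ((∫ y in (0 : ℝ)..1, f y ^ 2) + ∫ y in (0 : ℝ)..1, g y ^ 2)

/-- The summand of `h₁(t)²`, the index `n` standing for the eigenvalue `μ_{n+1}`. -/
def h1Term (μ : ℕ → ℝ) (t : ℝ) (n : ℕ) : ℝ :=
  (1 + μ (n + 1)) * Real.exp (-2 * (μ (n + 1) - μ 0) * t)

/-- `h₁(t) = C₁ (∑_{n ≥ 1} (1 + μ_n) e^{-2(μ_n - μ_0)t})^{1/2}`. -/
def h1 (C₁ : ℝ) (μ : ℕ → ℝ) (t : ℝ) : ℝ := C₁ * Real.sqrt (∑' n, h1Term μ t n)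

/-- `‖H(u₀) - f̃₀‖_{L²}`. -/
def distToSink (e : ℕ → ℝ → ℝ) (u₀ : L2UI) : ℝ :=
  l2norm (fun x => coleHopfH u₀ x - fTilde e x)

open Classical in
/-- `τ_B(u₀) = h₁⁻¹(m₀² / ‖H(u₀) - f̃₀‖_{L²})`, where `h₁⁻¹` is the inverse of `h₁` on `(0,∞)`, and
`h₁⁻¹(∞) = 0` when the denominator vanishes. -/
def tauB (C₁ : ℝ) (μ : ℕ → ℝ) (e : ℕ → ℝ → ℝ) (u₀ : L2UI) : ℝ :=
  if distToSink e u₀ = 0 then 0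
  else Function.invFunOn (h1 C₁ μ) (Ioi 0) (m0 e ^ 2 / distToSink e u₀)

/-- `Ω_B(θ₀) = {u₀ ∈ L²([0,1]) ; ‖H(u₀) - f̃₀‖_{L²} < m₀² / h₁(θ₀)}`. -/
def OmegaB (C₁ : ℝ) (μ : ℕ → ℝ) (e : ℕ → ℝ → ℝ) (θ₀ : ℝ) : Set L2UI :=
  {u₀ | distToSink e u₀ < m0 e ^ 2 / h1 C₁ μ θ₀}

/-! ### The Koopman series -/

/-- The multi-index `ν = (q₀, q₁, …, q_m)` with `q₀ ∈ ℕ` and `(q₁, …, q_m) ∈ (ℕ \ {0})^m`. -/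
def multiIndex {m : ℕ} (q₀ : ℕ) (q : Fin m → ℕ+) : Fin (m + 1) → ℕ :=
  Fin.cons q₀ (fun i => (q i : ℕ))

/-- `λ_ν = ∑_{i=0}^m (μ_{q_i} - μ_0)`. -/
def lam (μ : ℕ → ℝ) {m : ℕ} (ν : Fin (m + 1) → ℕ) : ℝ := ∑ i, (μ (ν i) - μ 0)

/-- `φ_ν(u₀) = ∏_{i=0}^m c_{q_i}(H(u₀)) / c_0(H(u₀))`. -/
def phi (e : ℕ → ℝ → ℝ) {m : ℕ} (ν : Fin (m + 1) → ℕ) (u₀ : L2UI) : ℝ :=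
  ∏ i, coeff e (ν i) (coleHopfH u₀) / coeff e 0 (coleHopfH u₀)

/-- `a_ν(x) = 2 (-1)^{m+1} (∂ₓe_{q_0}(x) / e_0(x)) ∏_{i=1}^m e_{q_i}(x) / e_0(x)`. -/
def mode (e : ℕ → ℝ → ℝ) {m : ℕ} (ν : Fin (m + 1) → ℕ) (x : ℝ) : ℝ :=
  2 * (-1) ^ (m + 1) * (dx (e (ν 0)) x / e 0 x) * ∏ i : Fin m, e (ν i.succ) x / e 0 x

/-- The general term `e^{-λ_ν t} φ_ν(u₀) a_ν(x)`. -/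
def koopmanTerm (μ : ℕ → ℝ) (e : ℕ → ℝ → ℝ) (u₀ : L2UI) (t x : ℝ) {m : ℕ}
    (ν : Fin (m + 1) → ℕ) : ℝ :=
  Real.exp (-lam μ ν * t) * phi e ν u₀ * mode e ν x

/-- The iterated series
`∑_{q₀ ≥ 0} ∑_{m ≥ 0} ∑_{(q₁,…,q_m) ∈ (ℕ \ {0})^m} e^{-λ_ν t} φ_ν(u₀) a_ν(x)`, summed in this order
(the sum over `q₀` being the outermost one), converges at each of the three levels, and its value
is `y`. -/
def HasKoopmanSum (μ : ℕ → ℝ) (e : ℕ → ℝ → ℝ) (u₀ : L2UI) (t x y : ℝ) : Prop :=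
  ∃ (S : ℕ → ℕ → ℝ) (T : ℕ → ℝ),
    (∀ q₀ m, HasSum (fun q : Fin m → ℕ+ => koopmanTerm μ e u₀ t x (multiIndex q₀ q)) (S q₀ m)) ∧
    (∀ q₀, HasSum (fun m => S q₀ m) (T q₀)) ∧
    HasSum T y

end KoopmanBurgers

end

open KoopmanBurgers

noncomputable section

namespace KoopmanBurgers

open scoped RealInnerProductSpace

/-! ### Integration and differentiation on the unit interval -/

/-! The Cole-Hopf substitution makes the equation linear. If u solves (B), then w = exp(-½∫₀ˣu)
satisfies w_t = w_xx - Vw + k(t)w with Neumann conditions, where k(t) = ½u_x(t,0) + V(0) does not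
depend on x. The coefficients of w in the eigenbasis obey c_n' = (k(t) - μ_n)c_n, so k cancels in
the ratios c_n/c_0, which evolve exactly by e^{-(μ_n-μ_0)t} (`IsBurgersSolution.coeff_hasDerivAt`,
`IsBurgersSolution.coeff_ratio`). Hence u = -2 P_x/P with P = ∑ c_n e^{-μ_n t} e_n and c_n the
coefficients of the transformed data (`IsBurgersSolution.eq_heat`), which gives uniqueness.
Conversely this quotient is a solution (`IsNeumannEigensystem.burgers_of_heat`). Its denominator is
positive by a maximum principle (`IsNeumannEigensystem.heat_pos`), and the initial data are attained
because the transform of an L² function lies in H¹, where the heat series converges as t → 0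
(`IsNeumannEigensystem.heat_tendsto`).

For the Koopman series, divide P and P_x by c_0 e^{-μ_0 t} e_0. The denominator becomes 1 + R, where
R collects the modes n ≥ 1. When |R| < 1, expanding 1/(1+R) as a geometric series gives the sum over
m, expanding R^m gives the sum over (q_1,…,q_m), and the numerator gives the sum over q_0
(`hasKoopmanSum_of`). Smallness of R follows from |e_n| ≤ C₁√(1+μ_n) and Cauchy-Schwarz, which is
what h₁ records (`IsNeumannEigensystem.tsum_abs_le`). The conditions with τ_B and Ω_B imply it
because f̃₀ is a multiple of e_0 and c_0(H(u₀)) ≥ m₀ (`IsNeumannEigensystem.smallness_le`).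

The spectral data come from the Green function of -∂ₓₓ + V, a continuous, symmetric, positive kernel
whose operator is compact and injective (`exists_eigensystem`). Growth of the eigenvalues needs no
asymptotics: the Sobolev inequality applied to finite combinations of modes gives ∑ 1/(1+μ_n) ≤ C₁²
(`sum_inv_le`), and this yields every convergence used later. -/

lemma zero_mem_UI : (0 : ℝ) ∈ UI := ⟨le_rfl, zero_le_one⟩

lemma one_mem_UI : (1 : ℝ) ∈ UI := ⟨zero_le_one, le_rfl⟩

lemma uniqueDiffOn_UI : UniqueDiffOn ℝ UI := uniqueDiffOn_Icc zero_lt_one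

lemma uIcc_zero_one : uIcc (0 : ℝ) 1 = UI := uIcc_of_le zero_le_one

lemma uIcc_zero_subset {x : ℝ} (hx : x ∈ UI) : uIcc 0 x ⊆ UI := by
  rw [uIcc_of_le hx.1]; exact Icc_subset_Icc le_rfl hx.2

lemma integral_volUI (f : ℝ → ℝ) : ∫ x, f x ∂volUI = ∫ x in (0 : ℝ)..1, f x := by
  rw [intervalIntegral.integral_of_le zero_le_one, volUI, integral_Icc_eq_integral_Ioc]

lemma memLp_of_continuousOn {f : ℝ → ℝ} (hf : ContinuousOn f UI) (p : ENNReal) :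
    MemLp f p volUI := by
  obtain ⟨C, hC⟩ := isCompact_Icc.exists_bound_of_continuousOn hf
  refine MemLp.of_bound (hf.aestronglyMeasurable measurableSet_Icc) C ?_
  exact (ae_restrict_iff' measurableSet_Icc).2 (Eventually.of_forall hC)

lemma MemLp_integrable {f : ℝ → ℝ} (hf : MemLp f 2 volUI) : Integrable f volUI :=
  hf.integrable (by norm_num)

lemma integrable_volUI_iff {f : ℝ → ℝ} :
    Integrable f volUI ↔ IntervalIntegrable f volume 0 1 := by
  rw [intervalIntegrable_iff_integrableOn_Icc_of_le zero_le_one]; rfl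

lemma MemLp_intervalIntegrable {f : ℝ → ℝ} (hf : MemLp f 2 volUI) :
    IntervalIntegrable f volume 0 1 :=
  integrable_volUI_iff.1 (MemLp_integrable hf)

lemma intervalIntegrable_mono_UI {f : ℝ → ℝ} (hf : IntervalIntegrable f volume 0 1) {x y : ℝ}
    (hx : x ∈ UI) (hy : y ∈ UI) : IntervalIntegrable f volume x y := by
  refine hf.mono_set ?_
  rw [uIcc_zero_one]
  exact (convex_Icc (0 : ℝ) 1).ordConnected.uIcc_subset hx hy

lemma ContinuousOn_intervalIntegrable_UI {f : ℝ → ℝ} (hf : ContinuousOn f UI) {x y : ℝ}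
    (hx : x ∈ UI) (hy : y ∈ UI) : IntervalIntegrable f volume x y :=
  intervalIntegrable_mono_UI
    (ContinuousOn.intervalIntegrable (by rwa [uIcc_zero_one])) hx hy

lemma ae_volUI_of_ae {p : ℝ → Prop} (h : ∀ᵐ x, x ∈ UI → p x) : ∀ᵐ x ∂volUI, p x :=
  (ae_restrict_iff' measurableSet_Icc).2 h

lemma integral_congr_UI {f g : ℝ → ℝ} (h : ∀ x ∈ UI, f x = g x) :
    ∫ x in (0 : ℝ)..1, f x = ∫ x in (0 : ℝ)..1, g x :=
  intervalIntegral.integral_congr (by rw [uIcc_zero_one]; exact h)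

lemma integral_congr_ae_UI {f g : ℝ → ℝ} (h : f =ᵐ[volUI] g) :
    ∫ x in (0 : ℝ)..1, f x = ∫ x in (0 : ℝ)..1, g x := by
  rw [← integral_volUI, ← integral_volUI]; exact integral_congr_ae h

lemma integral_congr_ae_UI' {f g : ℝ → ℝ} (h : f =ᵐ[volUI] g) {x : ℝ} (hx : x ∈ UI) :
    ∫ s in (0 : ℝ)..x, f s = ∫ s in (0 : ℝ)..x, g s := by
  refine intervalIntegral.integral_congr_ae ?_
  filter_upwards [(ae_restrict_iff' measurableSet_Icc).1 h] with y hy hy'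
  exact hy (uIcc_zero_subset hx (uIoc_subset_uIcc hy'))

lemma inner_toLp {f g : ℝ → ℝ} (hf : MemLp f 2 volUI) (hg : MemLp g 2 volUI) :
    ⟪hf.toLp f, hg.toLp g⟫ = ∫ x in (0 : ℝ)..1, f x * g x := by
  rw [L2.inner_def, ← integral_volUI]
  refine integral_congr_ae ?_
  filter_upwards [hf.coeFn_toLp, hg.coeFn_toLp] with x h1 h2
  simp [h1, h2, mul_comm]

lemma l2norm_eq_norm_toLp {f : ℝ → ℝ} (hf : MemLp f 2 volUI) : l2norm f = ‖hf.toLp f‖ := by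
  rw [norm_eq_sqrt_real_inner, inner_toLp, l2norm]
  simp only [sq]

lemma abs_integral_mul_le {f g : ℝ → ℝ} (hf : MemLp f 2 volUI) (hg : MemLp g 2 volUI) :
    |∫ x in (0 : ℝ)..1, f x * g x| ≤ l2norm f * l2norm g := by
  rw [← inner_toLp hf hg, l2norm_eq_norm_toLp hf, l2norm_eq_norm_toLp hg]
  exact abs_real_inner_le_norm _ _

lemma l2norm_nonneg (f : ℝ → ℝ) : 0 ≤ l2norm f := Real.sqrt_nonneg _

lemma l2norm_congr_ae {f g : ℝ → ℝ} (h : f =ᵐ[volUI] g) : l2norm f = l2norm g := by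
  unfold l2norm
  rw [integral_congr_ae_UI (f := fun x => f x ^ 2) (g := fun x => g x ^ 2)]
  filter_upwards [h] with x hx
  rw [hx]

lemma l2norm_sq {f : ℝ → ℝ} : l2norm f ^ 2 = ∫ x in (0 : ℝ)..1, f x ^ 2 :=
  Real.sq_sqrt (intervalIntegral.integral_nonneg zero_le_one fun _ _ => sq_nonneg _)

lemma l2norm_abs (f : ℝ → ℝ) : l2norm (fun x => |f x|) = l2norm f := by
  simp [l2norm, sq_abs]

lemma l2norm_add_le {f g : ℝ → ℝ} (hf : MemLp f 2 volUI) (hg : MemLp g 2 volUI) :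
    l2norm (fun x => f x + g x) ≤ l2norm f + l2norm g := by
  have h : l2norm (fun x => f x + g x) = ‖(hf.add hg).toLp (f + g)‖ := l2norm_eq_norm_toLp _
  rw [h, l2norm_eq_norm_toLp hf, l2norm_eq_norm_toLp hg, MemLp.toLp_add]
  exact norm_add_le _ _

lemma l2norm_const_mul (c : ℝ) (f : ℝ → ℝ) : l2norm (fun x => c * f x) = |c| * l2norm f := by
  simp only [l2norm, mul_pow]
  rw [intervalIntegral.integral_const_mul, Real.sqrt_mul (sq_nonneg c), Real.sqrt_sq_eq_abs]

/-- A pointwise bound controls the `L²` norm. -/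
lemma l2norm_le_of_abs_le {f g : ℝ → ℝ} (hf : MemLp f 2 volUI) (hg : MemLp g 2 volUI)
    (h : ∀ᵐ x ∂volUI, |f x| ≤ |g x|) : l2norm f ≤ l2norm g := by
  refine Real.sqrt_le_sqrt ?_
  rw [← integral_volUI, ← integral_volUI]
  refine integral_mono_ae hf.integrable_sq hg.integrable_sq ?_
  filter_upwards [h] with x hx
  exact sq_le_sq.2 hx

lemma l2norm_le_of_bound {f : ℝ → ℝ} (hf : MemLp f 2 volUI) {C : ℝ} (hC : 0 ≤ C)
    (h : ∀ᵐ x ∂volUI, |f x| ≤ C) : l2norm f ≤ C := by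
  have h1 := l2norm_le_of_abs_le hf (memLp_of_continuousOn (f := fun _ => C) continuousOn_const 2)
    (h.mono fun x hx => by rwa [abs_of_nonneg hC])
  simpa [l2norm, Real.sqrt_sq hC] using h1

lemma integral_abs_le_l2norm {f : ℝ → ℝ} (hf : MemLp f 2 volUI) :
    ∫ x in (0 : ℝ)..1, |f x| ≤ l2norm f := by
  have h := abs_integral_mul_le (memLp_of_continuousOn (f := fun _ => 1) continuousOn_const 2)
    hf.abs
  have h1 : l2norm (fun _ => (1 : ℝ)) = 1 := by simp [l2norm]
  have h2 : l2norm |f| = l2norm f := l2norm_abs f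
  rw [h1, h2, one_mul] at h
  simp only [one_mul] at h
  exact (le_abs_self _).trans h

/-- The primitive of an `L²` function is controlled by its `L²` norm. -/
lemma abs_integral_le_l2norm {f : ℝ → ℝ} (hf : MemLp f 2 volUI) {x y : ℝ} (hx : x ∈ UI)
    (hy : y ∈ UI) : |∫ s in x..y, f s| ≤ l2norm f := by
  refine le_trans ?_ (integral_abs_le_l2norm hf)
  have hi := MemLp_intervalIntegrable hf
  rw [intervalIntegral.abs_intervalIntegral_eq, ← Real.norm_eq_abs]
  refine (norm_integral_le_integral_norm _).trans ?_
  rw [intervalIntegral.integral_of_le zero_le_one]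
  refine setIntegral_mono_set ?_ (Eventually.of_forall fun _ => norm_nonneg _) ?_
  · exact ((intervalIntegrable_iff_integrableOn_Ioc_of_le zero_le_one).1 hi).norm
  · refine (Eventually.of_forall ?_)
    intro s hs
    rw [← uIoc_of_le (zero_le_one (α := ℝ))]
    have h1 : uIoc x y ⊆ Ioc 0 1 := by
      intro z hz
      rw [mem_uIoc] at hz
      rcases hz with hz | hz
      · exact ⟨hx.1.trans_lt hz.1, hz.2.trans hy.2⟩
      · exact ⟨hy.1.trans_lt hz.1, hz.2.trans hx.2⟩
    rw [uIoc_of_le zero_le_one]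
    exact h1 hs

lemma eLpNorm_eq_l2norm {f : ℝ → ℝ} (hf : MemLp f 2 volUI) :
    eLpNorm f 2 volUI = ENNReal.ofReal (l2norm f) := by
  rw [l2norm_eq_norm_toLp hf, Lp.norm_toLp, ENNReal.ofReal_toReal hf.2.ne]

/-- Continuous functions on `[0,1]` that agree almost everywhere agree everywhere. -/
lemma eqOn_of_ae_eq {f g : ℝ → ℝ} (hf : ContinuousOn f UI) (hg : ContinuousOn g UI)
    (h : f =ᵐ[volUI] g) : EqOn f g UI :=
  Measure.eqOn_of_ae_eq h hf hg (by simp [interior_Icc, closure_Ioo])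

/-! #### The derivative `dx` -/

lemma dx_eq {f : ℝ → ℝ} {f' x : ℝ} (h : HasDerivWithinAt f f' UI x) (hx : x ∈ UI) : dx f x = f' :=
  h.derivWithin (uniqueDiffOn_UI x hx)

lemma dx_congr {f g : ℝ → ℝ} (h : EqOn f g UI) {x : ℝ} (hx : x ∈ UI) : dx f x = dx g x :=
  derivWithin_congr h (h hx)

lemma ContDiffOn_hasDerivWithinAt {f : ℝ → ℝ} {n : WithTop ℕ∞} (hf : ContDiffOn ℝ n f UI)
    (hn : n ≠ 0) {x : ℝ} (hx : x ∈ UI) : HasDerivWithinAt f (dx f x) UI x :=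
  ((hf.differentiableOn hn) x hx).hasDerivWithinAt

lemma contDiffOn_one_iff {f : ℝ → ℝ} :
    ContDiffOn ℝ 1 f UI ↔ DifferentiableOn ℝ f UI ∧ ContinuousOn (dx f) UI := by
  have h := contDiffOn_succ_iff_derivWithin (𝕜 := ℝ) (f := f) (n := 0) uniqueDiffOn_UI
  simp only [zero_add, contDiffOn_zero] at h
  rw [h]
  exact ⟨fun h => ⟨h.1, h.2.2⟩, fun h => ⟨h.1, by simp, h.2⟩⟩

lemma contDiffOn_two_iff {f : ℝ → ℝ} :
    ContDiffOn ℝ 2 f UI ↔ DifferentiableOn ℝ f UI ∧ ContDiffOn ℝ 1 (dx f) UI := by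
  have h := contDiffOn_succ_iff_derivWithin (𝕜 := ℝ) (f := f) (n := 1) uniqueDiffOn_UI
  rw [one_add_one_eq_two] at h
  rw [h]
  exact ⟨fun h => ⟨h.1, h.2.2⟩, fun h => ⟨h.1, by simp, h.2⟩⟩

lemma contDiffOn_two_of {f f' f'' : ℝ → ℝ} (h1 : ∀ x ∈ UI, HasDerivWithinAt f (f' x) UI x)
    (h2 : ∀ x ∈ UI, HasDerivWithinAt f' (f'' x) UI x) (h3 : ContinuousOn f'' UI) :
    ContDiffOn ℝ 2 f UI ∧ EqOn (dx f) f' UI ∧ EqOn (dx (dx f)) f'' UI := by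
  have e1 : EqOn (dx f) f' UI := fun x hx => dx_eq (h1 x hx) hx
  have e2 : EqOn (dx (dx f)) f'' UI := fun x hx => by
    rw [dx_congr e1 hx, dx_eq (h2 x hx) hx]
  refine ⟨contDiffOn_two_iff.2 ⟨fun x hx => (h1 x hx).differentiableWithinAt,
    contDiffOn_one_iff.2 ⟨fun x hx => ?_, h3.congr e2⟩⟩, e1, e2⟩
  exact ((h2 x hx).congr e1 (e1 hx)).differentiableWithinAt

lemma integral_eq_sub_of_hasDerivWithinAt {f f' : ℝ → ℝ}
    (hf : ∀ x ∈ UI, HasDerivWithinAt f (f' x) UI x) (hc : ContinuousOn f' UI) {x : ℝ}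
    (hx : x ∈ UI) : ∫ s in (0 : ℝ)..x, f' s = f x - f 0 := by
  refine intervalIntegral.integral_eq_sub_of_hasDerivAt_of_le hx.1 ?_ ?_
    (ContinuousOn_intervalIntegrable_UI hc zero_mem_UI hx)
  · exact fun y hy => ((hf y ⟨hy.1, hy.2.trans hx.2⟩).continuousWithinAt).mono
      (Icc_subset_Icc le_rfl hx.2)
  · exact fun y hy => (hf y ⟨hy.1.le, hy.2.le.trans hx.2⟩).hasDerivAt
      (Icc_mem_nhds hy.1 (hy.2.trans_le hx.2))

lemma hasDerivWithinAt_primitive {f : ℝ → ℝ} (hf : ContinuousOn f UI) {x : ℝ} (hx : x ∈ UI) :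
    HasDerivWithinAt (fun y => ∫ s in (0 : ℝ)..y, f s) (f x) UI x := by
  have : Fact (x ∈ Icc (0 : ℝ) 1) := ⟨hx⟩
  exact intervalIntegral.integral_hasDerivWithinAt_right
    (ContinuousOn_intervalIntegrable_UI hf zero_mem_UI hx)
    (hf.stronglyMeasurableAtFilter_nhdsWithin measurableSet_Icc x) (hf x hx)

lemma continuousOn_primitive_UI {g : ℝ → ℝ} (hg : IntervalIntegrable g volume 0 1) :
    ContinuousOn (fun x => ∫ s in (0 : ℝ)..x, g s) UI := by
  have := (hg.absolutelyContinuousOnInterval_intervalIntegral (c := 0) left_mem_uIcc).continuousOn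
  rwa [uIcc_zero_one] at this

/-! #### Absolutely continuous functions -/

/-- This makes the exponential of a primitive absolutely continuous when the integrand is merely
integrable, so that the chain rule, valid only almost everywhere, can be integrated. -/
lemma AbsolutelyContinuousOnInterval_comp {f φ : ℝ → ℝ} {a b : ℝ} {K : NNReal}
    (hf : AbsolutelyContinuousOnInterval f a b) (hφ : LipschitzOnWith K φ (f '' uIcc a b)) :
    AbsolutelyContinuousOnInterval (fun x => φ (f x)) a b := by
  rw [absolutelyContinuousOnInterval_iff] at hf ⊢
  intro ε hε
  obtain ⟨δ, hδ, h⟩ := hf (ε / (K + 1)) (by positivity)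
  refine ⟨δ, hδ, fun E hE hE' => ?_⟩
  have h1 := h E hE hE'
  have h2 : ∑ i ∈ Finset.range E.1, dist (φ (f (E.2 i).1)) (φ (f (E.2 i).2))
      ≤ K * ∑ i ∈ Finset.range E.1, dist (f (E.2 i).1) (f (E.2 i).2) := by
    rw [Finset.mul_sum]
    refine Finset.sum_le_sum fun i hi => ?_
    have := hE.1 i hi
    exact hφ.dist_le_mul _ (mem_image_of_mem f this.1) _ (mem_image_of_mem f this.2)
  have h3 : (K : ℝ) * ∑ i ∈ Finset.range E.1, dist (f (E.2 i).1) (f (E.2 i).2)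
      ≤ (K + 1) * ∑ i ∈ Finset.range E.1, dist (f (E.2 i).1) (f (E.2 i).2) := by
    refine mul_le_mul_of_nonneg_right (by linarith) (Finset.sum_nonneg fun i _ => dist_nonneg)
  have h4 : ((K : ℝ) + 1) * ∑ i ∈ Finset.range E.1, dist (f (E.2 i).1) (f (E.2 i).2) < ε := by
    rw [lt_div_iff₀ (by positivity)] at h1
    linarith
  linarith

/-- Chain rule for the exponential of a primitive. -/
lemma exp_primitive_eq {g : ℝ → ℝ} (hg : IntervalIntegrable g volume 0 1) {x : ℝ} (hx : x ∈ UI) :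
    Real.exp (∫ s in (0 : ℝ)..x, g s)
      = 1 + ∫ y in (0 : ℝ)..x, g y * Real.exp (∫ s in (0 : ℝ)..y, g s) := by
  have hg' := intervalIntegrable_mono_UI hg zero_mem_UI hx
  have hac := hg'.absolutelyContinuousOnInterval_intervalIntegral (c := 0) left_mem_uIcc
  obtain ⟨C, hC⟩ := hac.exists_bound
  have hlip : LipschitzOnWith (Real.exp C).toNNReal Real.exp
      ((fun x => ∫ s in (0 : ℝ)..x, g s) '' uIcc 0 x) := by
    -- The exponential is Lipschitz only on half-lines; C bounds the primitive on the interval.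
    have : LipschitzOnWith (Real.exp C).toNNReal Real.exp (Iic C) := by
      refine (convex_Iic C).lipschitzOnWith_of_nnnorm_deriv_le
        (fun y _ => Real.differentiableAt_exp) fun y hy => ?_
      rw [Real.deriv_exp, ← NNReal.coe_le_coe, coe_nnnorm, Real.norm_eq_abs,
        abs_of_pos (Real.exp_pos _), Real.coe_toNNReal _ (Real.exp_pos _).le]
      exact Real.exp_le_exp.2 hy
    refine this.mono ?_
    rintro _ ⟨y, hy, rfl⟩
    exact (le_abs_self _).trans (hC y hy)
  have hac2 := AbsolutelyContinuousOnInterval_comp hac hlip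
  have h := hac2.integral_deriv_eq_sub
  simp only [intervalIntegral.integral_same, Real.exp_zero] at h
  have h2 : ∫ y in (0 : ℝ)..x, deriv (fun x => Real.exp (∫ s in (0 : ℝ)..x, g s)) y
      = ∫ y in (0 : ℝ)..x, g y * Real.exp (∫ s in (0 : ℝ)..y, g s) := by
    refine intervalIntegral.integral_congr_ae ?_
    filter_upwards [hg'.ae_hasDerivAt_integral] with y hy hy'
    have := (hy (uIoc_subset_uIcc hy') 0 left_mem_uIcc).exp
    rw [this.deriv, mul_comm]
  linarith

/-- Integration by parts of a `C¹` function against a primitive. -/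
lemma integral_mul_eq_sub_of_primitive {p p' f g : ℝ → ℝ}
    (hp : ∀ x ∈ UI, HasDerivWithinAt p (p' x) UI x) (hp' : ContinuousOn p' UI)
    (hg : IntervalIntegrable g volume 0 1)
    (hf : ∀ x ∈ UI, f x = f 0 + ∫ s in (0 : ℝ)..x, g s) :
    ∫ x in (0 : ℝ)..1, p x * g x = p 1 * f 1 - p 0 * f 0 - ∫ x in (0 : ℝ)..1, p' x * f x := by
  have hpac : AbsolutelyContinuousOnInterval p 0 1 := by
    refine ContDiffOn.absolutelyContinuousOnInterval ?_
    rw [uIcc_zero_one, contDiffOn_one_iff]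
    exact ⟨fun x hx => (hp x hx).differentiableWithinAt,
      hp'.congr fun x hx => dx_eq (hp x hx) hx⟩
  have hfac0 := hg.absolutelyContinuousOnInterval_intervalIntegral (c := 0) left_mem_uIcc
  have hconst : AbsolutelyContinuousOnInterval (fun _ : ℝ => f 0) 0 1 :=
    ContDiffOn.absolutelyContinuousOnInterval contDiffOn_const
  have hfac := hconst.add hfac0
  have h := hpac.integral_mul_deriv_eq_deriv_mul hfac
  have e1 : ∫ x in (0 : ℝ)..1, p x * deriv ((fun _ : ℝ => f 0) + fun x => ∫ s in (0 : ℝ)..x, g s) x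
      = ∫ x in (0 : ℝ)..1, p x * g x := by
    refine intervalIntegral.integral_congr_ae ?_
    filter_upwards [hg.ae_hasDerivAt_integral] with y hy hy'
    have := (hy (uIoc_subset_uIcc hy') 0 left_mem_uIcc).const_add (f 0)
    have h2 : ((fun _ : ℝ => f 0) + fun x => ∫ s in (0 : ℝ)..x, g s)
      = fun x => f 0 + ∫ s in (0 : ℝ)..x, g s := rfl
    rw [h2, this.deriv]
  have e2 : ∫ x in (0 : ℝ)..1, deriv p x * ((fun _ : ℝ => f 0) + fun x => ∫ s in (0 : ℝ)..x, g s) x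
      = ∫ x in (0 : ℝ)..1, p' x * f x := by
    refine intervalIntegral.integral_congr_ae ?_
    -- `deriv` is two-sided while `hp` is one-sided at the end points: 0 is excluded by the
    -- half-open interval and 1 as a null set.
    have hne : ∀ᵐ x : ℝ, x ≠ 1 := by simp [ae_iff, measure_singleton]
    filter_upwards [hne] with y hy hy'
    rw [uIoc_of_le zero_le_one] at hy'
    have hyU : y ∈ UI := ⟨hy'.1.le, hy'.2⟩
    rw [((hp y hyU).hasDerivAt (Icc_mem_nhds hy'.1 (lt_of_le_of_ne hy'.2 hy))).deriv, hf y hyU]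
    rfl
  rw [e1, e2] at h
  rw [h]
  simp only [Pi.add_apply, intervalIntegral.integral_same, add_zero]
  rw [hf 1 one_mem_UI]

/-- An `L²` function is determined by its primitive. -/
lemma ae_eq_of_primitive_eq {f g : ℝ → ℝ} (hf : IntervalIntegrable f volume 0 1)
    (hg : IntervalIntegrable g volume 0 1)
    (h : ∀ x ∈ UI, ∫ s in (0 : ℝ)..x, f s = ∫ s in (0 : ℝ)..x, g s) : f =ᵐ[volUI] g := by
  have h0 : ∀ᵐ x : ℝ, x ≠ 0 := by simp [ae_iff, measure_singleton]
  have h1 : ∀ᵐ x : ℝ, x ≠ 1 := by simp [ae_iff, measure_singleton]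
  refine ae_volUI_of_ae ?_
  filter_upwards [hf.ae_hasDerivAt_integral, hg.ae_hasDerivAt_integral, h0, h1]
    with x hfx hgx hx0 hx1 hx
  have hx' : x ∈ uIcc (0 : ℝ) 1 := by rwa [uIcc_zero_one]
  have a := hfx hx' 0 left_mem_uIcc
  have b := hgx hx' 0 left_mem_uIcc
  refine a.unique (b.congr_of_eventuallyEq ?_)
  have : UI ∈ 𝓝 x := Icc_mem_nhds (lt_of_le_of_ne hx.1 (Ne.symm hx0)) (lt_of_le_of_ne hx.2 hx1)
  filter_upwards [this] with y hy using h y hy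

/-! ### Neumann eigenfunctions -/

/-- `e` is a classical solution of `-e'' + V e = μ e` with Neumann boundary conditions. -/
structure IsNeumannMode (V : ℝ → ℝ) (μ : ℝ) (e : ℝ → ℝ) : Prop where
  contDiff : ContDiffOn ℝ 2 e UI
  eigen : ∀ x ∈ UI, dx (dx e) x = (V x - μ) * e x
  neumann_zero : dx e 0 = 0
  neumann_one : dx e 1 = 0

lemma IsNeumannEigensystem.mode {V : ℝ → ℝ} {μ : ℕ → ℝ} {e : ℕ → ℝ → ℝ}
    (h : IsNeumannEigensystem V μ e) (n : ℕ) : IsNeumannMode V (μ n) (e n) :=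
  ⟨h.contDiff n, fun x hx => by linarith [h.eigen n x hx], h.neumann_zero n, h.neumann_one n⟩

section Mode

variable {V : ℝ → ℝ} {μ : ℝ} {e : ℝ → ℝ}

lemma IsNeumannMode.continuousOn (he : IsNeumannMode V μ e) : ContinuousOn e UI :=
  he.contDiff.continuousOn

lemma IsNeumannMode.memLp (he : IsNeumannMode V μ e) : MemLp e 2 volUI :=
  memLp_of_continuousOn he.continuousOn 2

lemma IsNeumannMode.hasDeriv (he : IsNeumannMode V μ e) :
    ∀ x ∈ UI, HasDerivWithinAt e (dx e x) UI x :=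
  fun _ hx => ContDiffOn_hasDerivWithinAt he.contDiff two_ne_zero hx

lemma IsNeumannMode.hasDeriv_dx (he : IsNeumannMode V μ e) :
    ∀ x ∈ UI, HasDerivWithinAt (dx e) ((V x - μ) * e x) UI x := fun x hx => by
  rw [← he.eigen x hx]
  exact ContDiffOn_hasDerivWithinAt (contDiffOn_two_iff.1 he.contDiff).2 one_ne_zero hx

lemma IsNeumannMode.continuousOn_dx (he : IsNeumannMode V μ e) : ContinuousOn (dx e) UI :=
  fun x hx => (he.hasDeriv_dx x hx).continuousWithinAt

/-- Weak form of the eigenvalue equation. -/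
lemma IsNeumannMode.weak_form (he : IsNeumannMode V μ e) (hV : ContinuousOn V UI) {f g : ℝ → ℝ}
    (hg : IntervalIntegrable g volume 0 1)
    (hf : ∀ x ∈ UI, f x = f 0 + ∫ s in (0 : ℝ)..x, g s) :
    (∫ x in (0 : ℝ)..1, dx e x * g x) + ∫ x in (0 : ℝ)..1, V x * (e x * f x)
      = μ * ∫ x in (0 : ℝ)..1, e x * f x := by
  have hfc : ContinuousOn f UI := (continuousOn_const.add (continuousOn_primitive_UI hg)).congr hf
  have h := integral_mul_eq_sub_of_primitive he.hasDeriv_dx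
    ((hV.sub continuousOn_const).mul he.continuousOn) hg hf
  rw [he.neumann_zero, he.neumann_one] at h
  have h2 : ∫ x in (0 : ℝ)..1, (V x - μ) * e x * f x
      = (∫ x in (0 : ℝ)..1, V x * (e x * f x)) - μ * ∫ x in (0 : ℝ)..1, e x * f x := by
    rw [← intervalIntegral.integral_const_mul, ← intervalIntegral.integral_sub]
    · exact integral_congr_UI fun x _ => by ring
    · exact ContinuousOn_intervalIntegrable_UI (hV.mul (he.continuousOn.mul hfc)) zero_mem_UI
        one_mem_UI
    · exact ContinuousOn_intervalIntegrable_UI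
        (continuousOn_const.mul (he.continuousOn.mul hfc)) zero_mem_UI one_mem_UI
  rw [h, h2]; ring

lemma primitive_of_hasDeriv {f f' : ℝ → ℝ} (hf : ∀ x ∈ UI, HasDerivWithinAt f (f' x) UI x)
    (hc : ContinuousOn f' UI) : ∀ x ∈ UI, f x = f 0 + ∫ s in (0 : ℝ)..x, f' s := fun x hx => by
  rw [integral_eq_sub_of_hasDerivWithinAt hf hc hx]; ring

/-- By the Neumann condition at 0, e' is the primitive of (V-μ)e, and a primitive is bounded by the
L² norm of its integrand. -/
lemma IsNeumannMode.abs_dx_le (he : IsNeumannMode V μ e) (hV : ContinuousOn V UI) {M : ℝ}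
    (hM : ∀ x ∈ UI, |V x| ≤ M) (hμ : 0 ≤ μ) (hn : ∫ x in (0 : ℝ)..1, e x * e x = 1) {x : ℝ}
    (hx : x ∈ UI) : |dx e x| ≤ M + μ := by
  have hM0 : 0 ≤ M := (abs_nonneg _).trans (hM 0 zero_mem_UI)
  have hc : ContinuousOn (fun y => (V y - μ) * e y) UI :=
    (hV.sub continuousOn_const).mul he.continuousOn
  have h := primitive_of_hasDeriv he.hasDeriv_dx hc x hx
  rw [he.neumann_zero, zero_add] at h
  rw [h]
  refine (abs_integral_le_l2norm (memLp_of_continuousOn hc 2) zero_mem_UI hx).trans ?_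
  have h1 : l2norm (fun y => (M + μ) * e y) = M + μ := by
    rw [l2norm_const_mul, l2norm]
    simp only [sq, hn, Real.sqrt_one, mul_one]
    exact abs_of_nonneg (by linarith)
  rw [← h1]
  refine l2norm_le_of_abs_le (memLp_of_continuousOn hc 2)
    (memLp_of_continuousOn (continuousOn_const.mul he.continuousOn) 2) ?_
  refine (ae_restrict_iff' measurableSet_Icc).2 (Eventually.of_forall fun y hy => ?_)
  rw [abs_mul, abs_mul, abs_of_nonneg (by linarith : 0 ≤ M + μ)]
  refine mul_le_mul_of_nonneg_right ?_ (abs_nonneg _)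
  exact (abs_sub _ _).trans (by rw [abs_of_nonneg hμ]; linarith [hM y hy])

end Mode

/-! ### The Sobolev inequality -/

/-- Averaging |f x| - ‖g‖ ≤ |f y| over y gives |f x| ≤ ‖f‖ + ‖g‖, and (a+b)² ≤ 2(a²+b²). -/
lemma isSobolevConstant_sqrt_two : IsSobolevConstant (Real.sqrt 2) := by
  intro f g hfg x hx
  have hg := Lp.memLp g
  have hgi := MemLp_intervalIntegrable hg
  have hfc : ContinuousOn f UI := (continuousOn_const.add (continuousOn_primitive_UI hgi)).congr hfg
  have hf := memLp_of_continuousOn hfc 2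
  have h1 : ∀ y ∈ Icc (0 : ℝ) 1, |f x| - l2norm g ≤ |f y| := by
    intro y hy
    have h2 : f x - f y = ∫ s in y..x, g s := by
      rw [hfg x hx, hfg y hy, ← intervalIntegral.integral_interval_sub_left
        (intervalIntegrable_mono_UI hgi zero_mem_UI hx)
        (intervalIntegrable_mono_UI hgi zero_mem_UI hy)]
      ring
    have h3 := abs_integral_le_l2norm hg hy hx
    rw [← h2] at h3
    linarith [abs_sub_abs_le_abs_sub (f x) (f y)]
  have h2 := intervalIntegral.integral_mono_on zero_le_one intervalIntegrable_const
    (ContinuousOn_intervalIntegrable_UI hfc.abs zero_mem_UI one_mem_UI) h1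
  simp only [intervalIntegral.integral_const, sub_zero, one_smul] at h2
  have h3 := integral_abs_le_l2norm hf
  have h4 : |f x| ≤ l2norm f + l2norm g := by linarith
  rw [← l2norm_sq, ← l2norm_sq, ← Real.sqrt_mul zero_le_two]
  refine h4.trans (Real.le_sqrt_of_sq_le ?_)
  nlinarith [sq_nonneg (l2norm f - l2norm g)]

lemma IsSobolevConstant.abs_le {C₁ : ℝ} (hC : IsSobolevConstant C₁) {f f' : ℝ → ℝ}
    (hf : ∀ x ∈ UI, HasDerivWithinAt f (f' x) UI x) (hc : ContinuousOn f' UI) {x : ℝ}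
    (hx : x ∈ UI) : |f x| ≤ C₁ * Real.sqrt
      ((∫ y in (0 : ℝ)..1, f y ^ 2) + ∫ y in (0 : ℝ)..1, f' y ^ 2) := by
  have hm := memLp_of_continuousOn hc 2
  have hae := hm.coeFn_toLp
  have h := hC f (hm.toLp f') (fun y hy => by
    rw [integral_congr_ae_UI' hae hy]; exact primitive_of_hasDeriv hf hc y hy) x hx
  have e := integral_congr_ae_UI (f := fun y => hm.toLp f' y ^ 2) (g := fun y => f' y ^ 2)
    (hae.mono fun y hy => by simp only [hy])
  rwa [e] at h

/-- The constant function 1 forces it. In particular C₁ > 0, which the definition does not demand.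
-/
lemma IsSobolevConstant.one_le {C₁ : ℝ} (hC : IsSobolevConstant C₁) : 1 ≤ C₁ := by
  have h := hC.abs_le (f := fun _ => 1) (f' := fun _ => 0)
    (fun x _ => hasDerivWithinAt_const _ _ _) continuousOn_const zero_mem_UI
  simpa using h

/-! ### Bessel inequalities for orthonormal families of Neumann modes -/

lemma integral_mul_sum {ι : Type*} (s : Finset ι) (a : ι → ℝ) {f : ℝ → ℝ} {k : ι → ℝ → ℝ}
    (hf : ContinuousOn f UI) (hk : ∀ i, ContinuousOn (k i) UI) :
    ∫ x in (0 : ℝ)..1, f x * ∑ i ∈ s, a i * k i x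
      = ∑ i ∈ s, a i * ∫ x in (0 : ℝ)..1, f x * k i x := by
  have h : ∀ x, f x * ∑ i ∈ s, a i * k i x = ∑ i ∈ s, a i * (f x * k i x) := fun x => by
    rw [Finset.mul_sum]; exact Finset.sum_congr rfl fun i _ => by ring
  simp only [h]
  rw [intervalIntegral.integral_finsetSum]
  · simp only [intervalIntegral.integral_const_mul]
  · exact fun i _ => ContinuousOn_intervalIntegrable_UI
      (continuousOn_const.mul (hf.mul (hk i))) zero_mem_UI one_mem_UI

section Family

variable {ι : Type*} [DecidableEq ι] {V : ℝ → ℝ} {μ : ι → ℝ} {e : ι → ℝ → ℝ}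

/-- Testing the weak form with the mode itself bounds μ below by min V. The index type is arbitrary
because these estimates already serve for the eigenvectors of the Green operator, before they are
arranged in a sequence. -/
lemma eigenvalue_pos (hm : ∀ i, IsNeumannMode V (μ i) (e i)) (hV : ContinuousOn V UI)
    (hpos : ∀ x ∈ UI, 0 < V x)
    (ho : ∀ i j, (∫ x in (0 : ℝ)..1, e i x * e j x) = if i = j then 1 else 0) (i : ι) :
    0 < μ i := by
  have h := (hm i).weak_form hV (f := e i) (g := dx (e i))
    (ContinuousOn_intervalIntegrable_UI (hm i).continuousOn_dx zero_mem_UI one_mem_UI)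
    (primitive_of_hasDeriv (hm i).hasDeriv (hm i).continuousOn_dx)
  rw [ho i i, if_pos rfl, mul_one] at h
  obtain ⟨x₀, hx₀, hmin⟩ := isCompact_Icc.exists_isMinOn (nonempty_Icc.2 zero_le_one) hV
  have h1 : 0 ≤ ∫ x in (0 : ℝ)..1, dx (e i) x * dx (e i) x :=
    intervalIntegral.integral_nonneg zero_le_one fun x _ => mul_self_nonneg _
  have h2 : ∫ x in (0 : ℝ)..1, V x₀ * (e i x * e i x) ≤ ∫ x in (0 : ℝ)..1, V x * (e i x * e i x) := by
    have hc := (hm i).continuousOn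
    refine intervalIntegral.integral_mono_on zero_le_one
      (ContinuousOn_intervalIntegrable_UI (continuousOn_const.mul (hc.mul hc)) zero_mem_UI one_mem_UI)
      (ContinuousOn_intervalIntegrable_UI (hV.mul (hc.mul hc)) zero_mem_UI one_mem_UI)
      fun x hx => mul_le_mul_of_nonneg_right (hmin hx) (mul_self_nonneg _)
  rw [intervalIntegral.integral_const_mul, ho i i, if_pos rfl, mul_one] at h2
  linarith [hpos x₀ hx₀]

lemma integral_sum_sq (hm : ∀ i, IsNeumannMode V (μ i) (e i))
    (ho : ∀ i j, (∫ x in (0 : ℝ)..1, e i x * e j x) = if i = j then 1 else 0)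
    (s : Finset ι) (a : ι → ℝ) :
    ∫ x in (0 : ℝ)..1, (∑ i ∈ s, a i * e i x) ^ 2 = ∑ i ∈ s, a i ^ 2 := by
  have hc : ContinuousOn (fun x => ∑ i ∈ s, a i * e i x) UI :=
    continuousOn_finsetSum _ fun i _ => continuousOn_const.mul (hm i).continuousOn
  simp only [sq]
  rw [integral_mul_sum s a hc fun i => (hm i).continuousOn]
  refine Finset.sum_congr rfl fun i hi => ?_
  have : ∀ x, (∑ j ∈ s, a j * e j x) * e i x = e i x * ∑ j ∈ s, a j * e j x := fun x => mul_comm _ _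
  simp only [this]
  rw [integral_mul_sum s a (hm i).continuousOn fun i => (hm i).continuousOn]
  simp [ho, hi]

/-- Energy of a finite combination of orthonormal modes. -/
lemma integral_sum_dx_sq_le (hm : ∀ i, IsNeumannMode V (μ i) (e i)) (hV : ContinuousOn V UI)
    (hpos : ∀ x ∈ UI, 0 < V x)
    (ho : ∀ i j, (∫ x in (0 : ℝ)..1, e i x * e j x) = if i = j then 1 else 0)
    (s : Finset ι) (a : ι → ℝ) :
    ∫ x in (0 : ℝ)..1, (∑ i ∈ s, a i * dx (e i) x) ^ 2 ≤ ∑ i ∈ s, μ i * a i ^ 2 := by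
  have hc : ContinuousOn (fun x => ∑ i ∈ s, a i * e i x) UI :=
    continuousOn_finsetSum _ fun i _ => continuousOn_const.mul (hm i).continuousOn
  have hc' : ContinuousOn (fun x => ∑ i ∈ s, a i * dx (e i) x) UI :=
    continuousOn_finsetSum _ fun i _ => continuousOn_const.mul (hm i).continuousOn_dx
  have hd : ∀ x ∈ UI, HasDerivWithinAt (fun x => ∑ i ∈ s, a i * e i x)
      (∑ i ∈ s, a i * dx (e i) x) UI x := fun x hx =>
    HasDerivWithinAt.fun_sum fun i _ => ((hm i).hasDeriv x hx).const_mul (a i)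
  have h1 : ∀ i, (∫ x in (0 : ℝ)..1, (∑ j ∈ s, a j * dx (e j) x) * dx (e i) x)
      + ∫ x in (0 : ℝ)..1, (V x * ∑ j ∈ s, a j * e j x) * e i x
      = μ i * ∫ x in (0 : ℝ)..1, e i x * ∑ j ∈ s, a j * e j x := fun i => by
    rw [← (hm i).weak_form hV (ContinuousOn_intervalIntegrable_UI hc' zero_mem_UI one_mem_UI)
      (primitive_of_hasDeriv hd hc')]
    congr 1
    · exact integral_congr_UI fun x _ => mul_comm _ _
    · exact integral_congr_UI fun x _ => by ring
  have h2 : ∀ i ∈ s, ∫ x in (0 : ℝ)..1, e i x * ∑ j ∈ s, a j * e j x = a i := fun i hi => by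
    rw [integral_mul_sum s a (hm i).continuousOn fun i => (hm i).continuousOn]
    simp [ho, hi]
  have h3 : (∫ x in (0 : ℝ)..1, (∑ i ∈ s, a i * dx (e i) x) ^ 2)
      + ∫ x in (0 : ℝ)..1, (V x * ∑ j ∈ s, a j * e j x) * ∑ j ∈ s, a j * e j x
      = ∑ i ∈ s, μ i * a i ^ 2 := by
    simp only [sq]
    rw [integral_mul_sum s a hc' fun i => (hm i).continuousOn_dx,
      integral_mul_sum s a (f := fun x => V x * ∑ j ∈ s, a j * e j x) (hV.mul hc) fun i => (hm i).continuousOn, ← Finset.sum_add_distrib]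
    refine Finset.sum_congr rfl fun i hi => ?_
    rw [← mul_add, h1, h2 i hi]; ring
  have h4 : 0 ≤ ∫ x in (0 : ℝ)..1, (V x * ∑ j ∈ s, a j * e j x) * ∑ j ∈ s, a j * e j x := by
    refine intervalIntegral.integral_nonneg zero_le_one fun x hx => ?_
    rw [mul_assoc]
    exact mul_nonneg (hpos x hx).le (mul_self_nonneg _)
  linarith

/-- Pointwise bound of a finite combination of orthonormal modes by its energy. -/
lemma sum_sq_le (hm : ∀ i, IsNeumannMode V (μ i) (e i)) (hV : ContinuousOn V UI)
    (hpos : ∀ x ∈ UI, 0 < V x)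
    (ho : ∀ i j, (∫ x in (0 : ℝ)..1, e i x * e j x) = if i = j then 1 else 0)
    {C₁ : ℝ} (hC : IsSobolevConstant C₁) (s : Finset ι) (a : ι → ℝ) {x : ℝ} (hx : x ∈ UI) :
    (∑ i ∈ s, a i * e i x) ^ 2 ≤ C₁ ^ 2 * ∑ i ∈ s, (1 + μ i) * a i ^ 2 := by
  have hc' : ContinuousOn (fun x => ∑ i ∈ s, a i * dx (e i) x) UI :=
    continuousOn_finsetSum _ fun i _ => continuousOn_const.mul (hm i).continuousOn_dx
  have hd : ∀ x ∈ UI, HasDerivWithinAt (fun x => ∑ i ∈ s, a i * e i x)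
      (∑ i ∈ s, a i * dx (e i) x) UI x := fun x hx =>
    HasDerivWithinAt.fun_sum fun i _ => ((hm i).hasDeriv x hx).const_mul (a i)
  have h := hC.abs_le hd hc' hx
  have h2 := integral_sum_dx_sq_le hm hV hpos ho s a
  have h3 := integral_sum_sq hm ho s a
  have h4 : 0 ≤ ∫ x in (0 : ℝ)..1, (∑ i ∈ s, a i * dx (e i) x) ^ 2 :=
    intervalIntegral.integral_nonneg zero_le_one fun x _ => sq_nonneg _
  have h5 : 0 ≤ ∑ i ∈ s, a i ^ 2 := Finset.sum_nonneg fun i _ => sq_nonneg _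
  have hC1 := hC.one_le
  calc (∑ i ∈ s, a i * e i x) ^ 2 = |∑ i ∈ s, a i * e i x| ^ 2 := (sq_abs _).symm
    _ ≤ _ := pow_le_pow_left₀ (abs_nonneg _) h 2
    _ = C₁ ^ 2 * ((∫ y in (0 : ℝ)..1, (∑ i ∈ s, a i * e i y) ^ 2)
        + ∫ y in (0 : ℝ)..1, (∑ i ∈ s, a i * dx (e i) y) ^ 2) := by
      rw [mul_pow, Real.sq_sqrt (by rw [h3]; positivity)]
    _ ≤ C₁ ^ 2 * ∑ i ∈ s, (1 + μ i) * a i ^ 2 := by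
      refine mul_le_mul_of_nonneg_left ?_ (sq_nonneg _)
      simp only [add_mul, one_mul, Finset.sum_add_distrib]
      linarith

/-- With coefficients a_i = e_i(x)/(1+μ_i) both sides of the pointwise bound involve the same sum S,
which becomes S² ≤ C₁² S. -/
lemma sum_sq_div_le (hm : ∀ i, IsNeumannMode V (μ i) (e i)) (hV : ContinuousOn V UI)
    (hpos : ∀ x ∈ UI, 0 < V x)
    (ho : ∀ i j, (∫ x in (0 : ℝ)..1, e i x * e j x) = if i = j then 1 else 0)
    {C₁ : ℝ} (hC : IsSobolevConstant C₁) (s : Finset ι) {x : ℝ} (hx : x ∈ UI) :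
    ∑ i ∈ s, e i x ^ 2 / (1 + μ i) ≤ C₁ ^ 2 := by
  have hμ := eigenvalue_pos hm hV hpos ho
  have h := sum_sq_le hm hV hpos ho hC s (fun i => e i x / (1 + μ i)) hx
  have e1 : ∑ i ∈ s, e i x / (1 + μ i) * e i x = ∑ i ∈ s, e i x ^ 2 / (1 + μ i) :=
    Finset.sum_congr rfl fun i _ => by ring
  have e2 : ∑ i ∈ s, (1 + μ i) * (e i x / (1 + μ i)) ^ 2 = ∑ i ∈ s, e i x ^ 2 / (1 + μ i) :=
    Finset.sum_congr rfl fun i _ => by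
      have : 1 + μ i ≠ 0 := by linarith [hμ i]
      field_simp
  rw [e1, e2] at h
  have h0 : 0 ≤ ∑ i ∈ s, e i x ^ 2 / (1 + μ i) :=
    Finset.sum_nonneg fun i _ => div_nonneg (sq_nonneg _) (by linarith [hμ i])
  rcases h0.eq_or_lt with h1 | h1
  · rw [← h1]; positivity
  · rw [sq] at h; exact le_of_mul_le_mul_right h h1

/-- Integrating the previous bound in x turns each e_i² into 1. This replaces any asymptotics of the
eigenvalues. -/
lemma sum_inv_le (hm : ∀ i, IsNeumannMode V (μ i) (e i)) (hV : ContinuousOn V UI)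
    (hpos : ∀ x ∈ UI, 0 < V x)
    (ho : ∀ i j, (∫ x in (0 : ℝ)..1, e i x * e j x) = if i = j then 1 else 0)
    {C₁ : ℝ} (hC : IsSobolevConstant C₁) (s : Finset ι) :
    ∑ i ∈ s, 1 / (1 + μ i) ≤ C₁ ^ 2 := by
  have hci : ∀ i ∈ s, IntervalIntegrable (fun x => e i x ^ 2 / (1 + μ i)) volume 0 1 := fun i _ =>
    ContinuousOn_intervalIntegrable_UI (((hm i).continuousOn.pow 2).div_const _) zero_mem_UI
      one_mem_UI
  have h : ∫ x in (0 : ℝ)..1, ∑ i ∈ s, e i x ^ 2 / (1 + μ i) ≤ ∫ _ in (0 : ℝ)..1, C₁ ^ 2 := by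
    refine intervalIntegral.integral_mono_on zero_le_one
      (ContinuousOn_intervalIntegrable_UI (continuousOn_finsetSum _ fun i _ =>
        ((hm i).continuousOn.pow 2).div_const _) zero_mem_UI one_mem_UI)
      intervalIntegrable_const fun x hx => sum_sq_div_le hm hV hpos ho hC s hx
  rw [intervalIntegral.integral_finsetSum hci] at h
  simpa [sq, ho] using h

lemma summable_inv (hm : ∀ i, IsNeumannMode V (μ i) (e i)) (hV : ContinuousOn V UI)
    (hpos : ∀ x ∈ UI, 0 < V x)
    (ho : ∀ i j, (∫ x in (0 : ℝ)..1, e i x * e j x) = if i = j then 1 else 0) :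
    Summable fun i => 1 / (1 + μ i) :=
  summable_of_sum_le (fun i => by
    have := eigenvalue_pos hm hV hpos ho i
    positivity) (sum_inv_le hm hV hpos ho isSobolevConstant_sqrt_two)

/-- The energy bound for a single mode. It is the origin of the weight 1 + μ_n in h₁. -/
lemma abs_mode_le (hm : ∀ i, IsNeumannMode V (μ i) (e i)) (hV : ContinuousOn V UI)
    (hpos : ∀ x ∈ UI, 0 < V x)
    (ho : ∀ i j, (∫ x in (0 : ℝ)..1, e i x * e j x) = if i = j then 1 else 0)
    {C₁ : ℝ} (hC : IsSobolevConstant C₁) (i : ι) {x : ℝ} (hx : x ∈ UI) :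
    |e i x| ≤ C₁ * Real.sqrt (1 + μ i) := by
  have h := sum_sq_le hm hV hpos ho hC {i} (fun _ => 1) hx
  have hC1 := hC.one_le
  have hμ := eigenvalue_pos hm hV hpos ho i
  simp only [Finset.sum_singleton, one_mul, one_pow, mul_one] at h
  refine abs_le_of_sq_le_sq ?_ (by positivity)
  rwa [mul_pow, Real.sq_sqrt (by linarith)]

end Family

/-! ### Consequences for a complete system -/

section System

variable {V : ℝ → ℝ} {μ : ℕ → ℝ} {e : ℕ → ℝ → ℝ}

lemma IsNeumannEigensystem.mu_pos (h : IsNeumannEigensystem V μ e) (hV : ContinuousOn V UI)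
    (hpos : ∀ x ∈ UI, 0 < V x) (n : ℕ) : 0 < μ n :=
  eigenvalue_pos h.mode hV hpos h.orthonormal n

/-- One term of the exponential series of (1+m)t is at most e^{(1+m)t}. -/
lemma pow_mul_exp_le {m : ℝ} (hm : 0 ≤ m) {t : ℝ} (ht : 0 < t) (k : ℕ) :
    (1 + m) ^ k * Real.exp (-m * t) ≤ k.factorial * Real.exp t / t ^ k := by
  have h := Real.pow_div_factorial_le_exp ((1 + m) * t) (by positivity) k
  rw [div_le_iff₀ (by positivity), mul_pow] at h
  rw [le_div_iff₀ (by positivity)]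
  have h2 : Real.exp ((1 + m) * t) * Real.exp (-m * t) = Real.exp t := by
    rw [← Real.exp_add]; ring_nf
  nlinarith [mul_le_mul_of_nonneg_right h (Real.exp_pos (-m * t)).le]

/-- The exponential absorbs k + 1 powers of 1 + μ_n, one more than needed, which leaves the
convergent series ∑ 1/(1+μ_n). -/
lemma IsNeumannEigensystem.summable_pow_mul_exp (h : IsNeumannEigensystem V μ e)
    (hV : ContinuousOn V UI) (hpos : ∀ x ∈ UI, 0 < V x) {t : ℝ} (ht : 0 < t) (k : ℕ) :
    Summable fun n => (1 + μ n) ^ k * Real.exp (-μ n * t) := by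
  have hμ := h.mu_pos hV hpos
  refine Summable.of_nonneg_of_le (fun n => by have := hμ n; positivity) (fun n => ?_)
    ((summable_inv h.mode hV hpos h.orthonormal).mul_left
      ((k + 1).factorial * Real.exp t / t ^ (k + 1)))
  have := hμ n
  have h1 := pow_mul_exp_le (hμ n).le ht (k + 1)
  rw [mul_one_div, le_div_iff₀ (by positivity)]
  calc _ = (1 + μ n) ^ (k + 1) * Real.exp (-μ n * t) := by ring
    _ ≤ _ := h1

/-- The lowest eigenvalue is simple. -/
lemma IsNeumannEigensystem.mu_zero_lt (h : IsNeumannEigensystem V μ e) {n : ℕ} (hn : n ≠ 0) : μ 0 < μ n := by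
  refine lt_of_le_of_ne (h.mono (Nat.zero_le n)) fun heq => ?_
  have m0 := h.mode 0
  have mn := h.mode n
  -- For equal eigenvalues the Wronskian of e_0 and e_n is constant, and it vanishes at 0 by the
  -- Neumann conditions. Since e_0 > 0, the quotient e_n/e_0 is then constant, against
  -- orthonormality.
  have hW : ∀ x ∈ UI, HasDerivWithinAt (fun y => e 0 y * dx (e n) y - dx (e 0) y * e n y) 0 UI x := by
    intro x hx
    have := ((m0.hasDeriv x hx).mul (mn.hasDeriv_dx x hx)).sub
      ((m0.hasDeriv_dx x hx).mul (mn.hasDeriv x hx))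
    convert! this using 1
    rw [heq]; ring
  have hW0 : ∀ x ∈ UI, e 0 x * dx (e n) x - dx (e 0) x * e n x = 0 := fun x hx => by
    have := integral_eq_sub_of_hasDerivWithinAt hW continuousOn_const hx
    simp only [m0.neumann_zero, mn.neumann_zero] at this
    simpa using this.symm
  have hQ : ∀ x ∈ UI, HasDerivWithinAt (fun y => e n y / e 0 y) 0 UI x := by
    intro x hx
    have := (mn.hasDeriv x hx).div (m0.hasDeriv x hx) (h.pos x hx).ne'
    convert! this using 1
    rw [eq_comm, div_eq_zero_iff]
    left; linarith [hW0 x hx]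
  have hq : ∀ x ∈ UI, e n x = e n 0 / e 0 0 * e 0 x := fun x hx => by
    have := integral_eq_sub_of_hasDerivWithinAt hQ continuousOn_const hx
    simp only [intervalIntegral.integral_zero] at this
    have h0 := (h.pos x hx).ne'
    rw [eq_comm, sub_eq_zero, div_eq_iff h0] at this
    exact this
  have h1 := h.orthonormal 0 n
  rw [if_neg hn.symm, integral_congr_UI (g := fun x => e n 0 / e 0 0 * (e 0 x * e 0 x))
    fun x hx => by rw [hq x hx]; ring, intervalIntegral.integral_const_mul, h.orthonormal 0 0,
    if_pos rfl, mul_one] at h1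
  have h2 := h.orthonormal n n
  rw [if_pos rfl, integral_congr_UI (g := fun _ => 0) fun x hx => by rw [hq x hx, h1]; ring] at h2
  simp at h2

/-- A continuous function is determined by its coefficients. -/
lemma IsNeumannEigensystem.eqOn_of_coeff_eq (h : IsNeumannEigensystem V μ e) {f g : ℝ → ℝ}
    (hf : ContinuousOn f UI) (hg : ContinuousOn g UI) (hfg : ∀ n, coeff e n f = coeff e n g) :
    EqOn f g UI := by
  have hm := memLp_of_continuousOn (hf.sub hg) 2
  have h0 := h.complete (hm.toLp _) fun n => by
    rw [integral_congr_ae_UI (g := fun x => e n x * f x - e n x * g x)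
      (hm.coeFn_toLp.mono fun x hx => by simp only [hx]; simp; ring)]
    rw [intervalIntegral.integral_sub]
    · exact sub_eq_zero.2 (hfg n)
    · exact ContinuousOn_intervalIntegrable_UI ((h.mode n).continuousOn.mul hf) zero_mem_UI one_mem_UI
    · exact ContinuousOn_intervalIntegrable_UI ((h.mode n).continuousOn.mul hg) zero_mem_UI one_mem_UI
  refine eqOn_of_ae_eq hf hg ?_
  have h1 := hm.coeFn_toLp
  rw [h0] at h1
  filter_upwards [h1, Lp.coeFn_zero ℝ 2 volUI] with x hx hx'
  rw [hx'] at hx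
  simp at hx
  linarith

/-! ### The function `h₁` -/

lemma h1Term_pos (hμ : ∀ n, 0 < μ n) (t : ℝ) (n : ℕ) : 0 < h1Term μ t n := by
  have := hμ (n + 1)
  unfold h1Term; positivity

lemma IsNeumannEigensystem.summable_h1Term (h : IsNeumannEigensystem V μ e)
    (hV : ContinuousOn V UI) (hpos : ∀ x ∈ UI, 0 < V x) {t : ℝ} (ht : 0 < t) :
    Summable (h1Term μ t) := by
  have h1 := ((summable_nat_add_iff 1).2 (h.summable_pow_mul_exp hV hpos
    (mul_pos two_pos ht) 1)).mul_right (Real.exp (2 * μ 0 * t))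
  refine h1.congr fun n => ?_
  rw [h1Term, pow_one, mul_assoc, ← Real.exp_add]
  ring_nf

lemma IsNeumannEigensystem.h1_strictAnti (h : IsNeumannEigensystem V μ e)
    (hV : ContinuousOn V UI) (hpos : ∀ x ∈ UI, 0 < V x) {C₁ : ℝ} (hC : 0 < C₁) :
    StrictAntiOn (h1 C₁ μ) (Ioi 0) := by
  intro s hs t ht hst
  have hμ := h.mu_pos hV hpos
  refine mul_lt_mul_of_pos_left (Real.sqrt_lt_sqrt (tsum_nonneg fun n => (h1Term_pos hμ t n).le) ?_)
    hC
  have hlt : ∀ n, h1Term μ t n < h1Term μ s n := fun n => by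
    refine mul_lt_mul_of_pos_left (Real.exp_lt_exp.2 ?_) (by linarith [hμ (n + 1)])
    have := h.mu_zero_lt (Nat.succ_ne_zero n)
    simp only [Nat.succ_eq_add_one] at this
    nlinarith
  exact Summable.tsum_lt_tsum (i := 0) (fun n => (hlt n).le) (hlt 0) (h.summable_h1Term hV hpos ht)
    (h.summable_h1Term hV hpos hs)

lemma IsNeumannEigensystem.h1_continuousOn (h : IsNeumannEigensystem V μ e)
    (hV : ContinuousOn V UI) (hpos : ∀ x ∈ UI, 0 < V x) (C₁ : ℝ) :
    ContinuousOn (h1 C₁ μ) (Ioi 0) := by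
  intro t ht
  have ht : 0 < t := ht
  have hμ := h.mu_pos hV hpos
  have hc : ContinuousOn (fun s => ∑' n, h1Term μ s n) (Ioi (t / 2)) := by
    refine continuousOn_tsum (fun n => ?_) (h.summable_h1Term hV hpos (half_pos ht)) ?_
    · unfold h1Term; fun_prop
    · intro n s hs
      rw [Real.norm_eq_abs, abs_of_pos (h1Term_pos hμ s n)]
      refine mul_le_mul_of_nonneg_left (Real.exp_le_exp.2 ?_) (by linarith [hμ (n + 1)])
      have := h.mono (Nat.zero_le (n + 1))
      have hs : t / 2 < s := hs
      nlinarith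
  have := (hc.continuousAt (Ioi_mem_nhds (half_lt_self ht)))
  exact (continuousAt_const.mul this.sqrt).continuousWithinAt

lemma IsNeumannEigensystem.h1_bijOn (h : IsNeumannEigensystem V μ e)
    (hV : ContinuousOn V UI) (hpos : ∀ x ∈ UI, 0 < V x) {C₁ : ℝ} (hC : 0 < C₁) :
    BijOn (h1 C₁ μ) (Ioi 0) (Ioi 0) := by
  have hμ := h.mu_pos hV hpos
  have hS : ∀ {t}, 0 < t → Summable (h1Term μ t) := fun ht => h.summable_h1Term hV hpos ht
  have hpos1 : ∀ t, 0 < t → 0 < ∑' n, h1Term μ t n := fun t ht =>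
    (hS ht).tsum_pos (fun n => (h1Term_pos hμ t n).le) 0 (h1Term_pos hμ t 0)
  refine ⟨fun t ht => mul_pos hC (Real.sqrt_pos.2 (hpos1 t ht)),
    (h.h1_strictAnti hV hpos hC).injOn, fun y hy => ?_⟩
  have hy : 0 < y := hy
  have hsmall : ∃ t, 0 < t ∧ h1 C₁ μ t ≤ y := by
    have hd : 0 < 2 * (μ 1 - μ 0) := by linarith [h.mu_zero_lt one_ne_zero]
    -- From time 1 on every summand decays at least like e^{-2(μ₁-μ₀)(t-1)}, because μ_{n+1} ≥ μ₁ >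
    -- μ₀.
    have hb : ∀ t, 1 ≤ t → ∑' n, h1Term μ t n
        ≤ Real.exp (-(2 * (μ 1 - μ 0)) * (t - 1)) * ∑' n, h1Term μ 1 n := by
      intro t ht
      rw [← tsum_mul_left]
      refine (hS (by linarith)).tsum_le_tsum (fun n => ?_) ((hS one_pos).mul_left _)
      rw [h1Term, h1Term, mul_left_comm, ← Real.exp_add]
      refine mul_le_mul_of_nonneg_left (Real.exp_le_exp.2 ?_) (by linarith [hμ (n + 1)])
      have := h.mono (Nat.le_add_left 1 n)
      nlinarith
    have hlim : Tendsto (fun t => C₁ * Real.sqrt (Real.exp (-(2 * (μ 1 - μ 0)) * (t - 1))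
        * ∑' n, h1Term μ 1 n)) atTop (𝓝 (C₁ * Real.sqrt (0 * ∑' n, h1Term μ 1 n))) := by
      refine ((Tendsto.mul_const _ ?_).sqrt).const_mul _
      refine Real.tendsto_exp_atBot.comp ?_
      exact (tendsto_atTop_add_const_right _ (-1) tendsto_id).const_mul_atTop_of_neg
        (by linarith)
    rw [zero_mul, Real.sqrt_zero, mul_zero] at hlim
    obtain ⟨t, ht1, ht2⟩ := ((hlim.eventually (gt_mem_nhds hy)).and (eventually_ge_atTop 1)).exists
    exact ⟨t, by linarith, (mul_le_mul_of_nonneg_left (Real.sqrt_le_sqrt (hb t ht2)) hC.le).trans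
      ht1.le⟩
  have hlarge : ∃ t, 0 < t ∧ y ≤ h1 C₁ μ t := by
    -- At t = 0 each summand equals 1 + μ_{n+1} ≥ 1, so N of them exceed (y/C₁)²; continuity of the
    -- finite sum carries this to small t > 0.
    obtain ⟨N, hN⟩ := exists_nat_gt ((y / C₁) ^ 2)
    have hlim : Tendsto (fun t => ∑ n ∈ Finset.range N, h1Term μ t n) (𝓝[>] 0)
        (𝓝 (∑ n ∈ Finset.range N, h1Term μ 0 n)) := by
      refine Tendsto.mono_left ?_ nhdsWithin_le_nhds
      refine Continuous.tendsto (f := fun t => ∑ n ∈ Finset.range N, h1Term μ t n) ?_ 0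
      unfold h1Term; fun_prop
    have hgt : (y / C₁) ^ 2 < ∑ n ∈ Finset.range N, h1Term μ 0 n := by
      refine hN.trans_le ?_
      have : ∑ n ∈ Finset.range N, (1 : ℝ) ≤ ∑ n ∈ Finset.range N, h1Term μ 0 n :=
        Finset.sum_le_sum fun n _ => by simp [h1Term, (hμ (n + 1)).le]
      simpa using this
    obtain ⟨t, ht1, ht2⟩ := ((hlim.eventually (lt_mem_nhds hgt)).and self_mem_nhdsWithin).exists
    refine ⟨t, ht2, ?_⟩
    have h1 := ht1.le.trans ((hS ht2).sum_le_tsum _ fun n _ => (h1Term_pos hμ t n).le)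
    rw [KoopmanBurgers.h1, ← div_le_iff₀' hC]
    exact Real.le_sqrt_of_sq_le h1
  obtain ⟨t₁, ht₁, hy₁⟩ := hsmall
  obtain ⟨t₂, ht₂, hy₂⟩ := hlarge
  exact isPreconnected_Ioi.intermediate_value (s := Ioi (0 : ℝ)) ht₁ ht₂
    (h.h1_continuousOn hV hpos C₁) ⟨hy₁, hy₂⟩

end System

/-! ### Series of functions on the unit interval -/

lemma continuousOn_tsum_UI {ι : Type*} {f : ι → ℝ → ℝ} {b : ι → ℝ}
    (hf : ∀ n, ContinuousOn (f n) UI) (hb : ∀ n, ∀ x ∈ UI, |f n x| ≤ b n) (hs : Summable b) :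
    ContinuousOn (fun x => ∑' n, f n x) UI :=
  continuousOn_tsum hf hs hb

lemma hasSum_integral_UI {ι : Type*} [Countable ι] {f : ι → ℝ → ℝ} {b : ι → ℝ}
    (hf : ∀ n, ContinuousOn (f n) UI) (hb : ∀ n, ∀ x ∈ UI, |f n x| ≤ b n) (hs : Summable b)
    {x : ℝ} (hx : x ∈ UI) :
    HasSum (fun n => ∫ s in (0 : ℝ)..x, f n s) (∫ s in (0 : ℝ)..x, ∑' n, f n s) := by
  have hsub : uIoc 0 x ⊆ UI := uIoc_subset_uIcc.trans (uIcc_zero_subset hx)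
  refine intervalIntegral.hasSum_integral_of_dominated_convergence (fun n _ => b n)
    (fun n => ?_) (fun n => ?_) ?_ ?_ ?_
  · exact ((hf n).mono hsub).aestronglyMeasurable measurableSet_uIoc
  · exact Eventually.of_forall fun y hy => hb n y (hsub hy)
  · exact Eventually.of_forall fun _ _ => hs
  · exact intervalIntegrable_const
  · exact Eventually.of_forall fun y hy =>
      (Summable.of_norm_bounded hs fun n => hb n y (hsub hy)).hasSum

/-- Termwise differentiation on `[0,1]`, one-sided at the end points. -/
lemma hasDerivWithinAt_tsum_UI {ι : Type*} [Countable ι] {f f' : ι → ℝ → ℝ} {b b' : ι → ℝ}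
    (hf : ∀ n, ∀ x ∈ UI, HasDerivWithinAt (f n) (f' n x) UI x)
    (hf' : ∀ n, ContinuousOn (f' n) UI)
    (hb : ∀ n, ∀ x ∈ UI, |f n x| ≤ b n) (hs : Summable b)
    (hb' : ∀ n, ∀ x ∈ UI, |f' n x| ≤ b' n) (hs' : Summable b') {x : ℝ} (hx : x ∈ UI) :
    HasDerivWithinAt (fun y => ∑' n, f n y) (∑' n, f' n x) UI x := by
  have hS : ∀ y ∈ UI, Summable fun n => f n y := fun y hy =>
    Summable.of_norm_bounded hs fun n => hb n y hy
  -- Writing the sum as a primitive of the differentiated series handles the one-sided derivatives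
  -- at 0 and 1 together with the interior ones.
  have h1 : ∀ y ∈ UI, ∑' n, f n y = (∑' n, f n 0) + ∫ s in (0 : ℝ)..y, ∑' n, f' n s := by
    intro y hy
    rw [← (hasSum_integral_UI hf' hb' hs' hy).tsum_eq, ← (hS 0 zero_mem_UI).tsum_add
      (hasSum_integral_UI hf' hb' hs' hy).summable]
    exact tsum_congr fun n => primitive_of_hasDeriv (hf n) (hf' n) y hy
  have h2 := (hasDerivWithinAt_primitive (continuousOn_tsum_UI hf' hb' hs') hx).const_add
    (∑' n, f n 0)
  exact h2.congr h1 (h1 x hx)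

/-! ### Solutions of `φ'' = Vφ` and the Green function -/

/-- Successive approximations of the solution of `φ'' = Wφ`, `φ 0 = 1`, `φ' 0 = 0`. -/
def phiSeq (W : ℝ → ℝ) : ℕ → ℝ → ℝ
  | 0 => fun _ => 1
  | n + 1 => fun x => ∫ s in (0 : ℝ)..x, ∫ r in (0 : ℝ)..s, W r * phiSeq W n r

/-- The derivative of `phiSeq`. -/
def dphiSeq (W : ℝ → ℝ) : ℕ → ℝ → ℝ
  | 0 => fun _ => 0
  | n + 1 => fun x => ∫ r in (0 : ℝ)..x, W r * phiSeq W n r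

/-- The second derivative of `phiSeq`. -/
def ddphiSeq (W : ℝ → ℝ) : ℕ → ℝ → ℝ
  | 0 => fun _ => 0
  | n + 1 => fun x => W x * phiSeq W n x

section Fundamental

variable {W : ℝ → ℝ}

lemma phiSeq_continuousOn (hW : ContinuousOn W UI) : ∀ n, ContinuousOn (phiSeq W n) UI
  | 0 => continuousOn_const
  | n + 1 => by
    have h1 := ContinuousOn_intervalIntegrable_UI (hW.mul (phiSeq_continuousOn hW n)) zero_mem_UI
      one_mem_UI
    exact continuousOn_primitive_UI (ContinuousOn_intervalIntegrable_UI
      (continuousOn_primitive_UI h1) zero_mem_UI one_mem_UI)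

lemma ddphiSeq_continuousOn (hW : ContinuousOn W UI) : ∀ n, ContinuousOn (ddphiSeq W n) UI
  | 0 => continuousOn_const
  | n + 1 => hW.mul (phiSeq_continuousOn hW n)

lemma dphiSeq_hasDeriv (hW : ContinuousOn W UI) :
    ∀ n, ∀ x ∈ UI, HasDerivWithinAt (dphiSeq W n) (ddphiSeq W n x) UI x
  | 0 => fun _ _ => hasDerivWithinAt_const _ _ _
  | n + 1 => fun _ hx => hasDerivWithinAt_primitive (hW.mul (phiSeq_continuousOn hW n)) hx

lemma dphiSeq_continuousOn (hW : ContinuousOn W UI) (n : ℕ) : ContinuousOn (dphiSeq W n) UI :=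
  fun x hx => (dphiSeq_hasDeriv hW n x hx).continuousWithinAt

lemma phiSeq_hasDeriv (hW : ContinuousOn W UI) :
    ∀ n, ∀ x ∈ UI, HasDerivWithinAt (phiSeq W n) (dphiSeq W n x) UI x
  | 0 => fun _ _ => hasDerivWithinAt_const _ _ _
  | n + 1 => fun _ hx => hasDerivWithinAt_primitive (dphiSeq_continuousOn hW (n + 1)) hx

/-- One quadrature of the Picard iteration raises the power and the factorial by one. -/
lemma integral_le_pow {f : ℝ → ℝ} (hf : ContinuousOn f UI) {c : ℝ} (n : ℕ)
    (h : ∀ x ∈ UI, 0 ≤ f x ∧ f x ≤ c * (x ^ n / n.factorial)) {x : ℝ} (hx : x ∈ UI) :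
    0 ≤ ∫ s in (0 : ℝ)..x, f s ∧
      ∫ s in (0 : ℝ)..x, f s ≤ c * (x ^ (n + 1) / (n + 1).factorial) := by
  have hsub : ∀ s ∈ Icc 0 x, s ∈ UI := fun s hs => ⟨hs.1, hs.2.trans hx.2⟩
  refine ⟨intervalIntegral.integral_nonneg hx.1 fun s hs => (h s (hsub s hs)).1, ?_⟩
  have h1 := intervalIntegral.integral_mono_on hx.1
    (ContinuousOn_intervalIntegrable_UI hf zero_mem_UI hx)
    (Continuous.intervalIntegrable (by fun_prop) 0 x) fun s hs => (h s (hsub s hs)).2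
  refine h1.trans_eq ?_
  rw [intervalIntegral.integral_const_mul, intervalIntegral.integral_div, integral_pow,
    Nat.factorial_succ]
  have : (n.factorial : ℝ) ≠ 0 := by positivity
  push_cast
  field_simp
  ring

lemma phiSeq_bounds (hW : ContinuousOn W UI) {M : ℝ} (hM : ∀ x ∈ UI, 0 ≤ W x ∧ W x ≤ M) :
    ∀ n, ∀ x ∈ UI, (0 ≤ phiSeq W n x ∧ phiSeq W n x ≤ M ^ n * (x ^ n / n.factorial)) ∧
      (0 ≤ dphiSeq W (n + 1) x ∧
        dphiSeq W (n + 1) x ≤ M ^ (n + 1) * (x ^ (n + 1) / (n + 1).factorial)) := by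
  have hM0 : 0 ≤ M := (hM 0 zero_mem_UI).1.trans (hM 0 zero_mem_UI).2
  have step : ∀ n, (∀ x ∈ UI, 0 ≤ phiSeq W n x ∧ phiSeq W n x ≤ M ^ n * (x ^ n / n.factorial)) →
      ∀ x ∈ UI, 0 ≤ dphiSeq W (n + 1) x ∧
        dphiSeq W (n + 1) x ≤ M ^ (n + 1) * (x ^ (n + 1) / (n + 1).factorial) := by
    intro n hn x hx
    refine integral_le_pow (hW.mul (phiSeq_continuousOn hW n)) n (fun y hy => ?_) hx
    refine ⟨mul_nonneg (hM y hy).1 (hn y hy).1, ?_⟩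
    rw [pow_succ', mul_assoc]
    exact mul_le_mul (hM y hy).2 (hn y hy).2 (hn y hy).1 hM0
  intro n
  induction n with
  | zero =>
    have h0 : ∀ x ∈ UI, 0 ≤ phiSeq W 0 x ∧ phiSeq W 0 x ≤ M ^ 0 * (x ^ 0 / (Nat.factorial 0)) :=
      fun x _ => by simp [phiSeq]
    exact fun x hx => ⟨h0 x hx, step 0 h0 x hx⟩
  | succ n ih =>
    have h1 : ∀ x ∈ UI, 0 ≤ phiSeq W (n + 1) x ∧
        phiSeq W (n + 1) x ≤ M ^ (n + 1) * (x ^ (n + 1) / (n + 1).factorial) := by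
      intro x hx
      have h2 := integral_le_pow (dphiSeq_continuousOn hW (n + 1)) (n + 1)
        (fun y hy => (ih y hy).2) hx
      -- Two quadratures yield x^{n+2}/(n+2)!. As x ≤ 1 this is weakened to index n+1, so that one
      -- bound serves both the iterate and its derivative.
      refine ⟨h2.1, h2.2.trans (mul_le_mul_of_nonneg_left ?_ (pow_nonneg hM0 _))⟩
      refine div_le_div₀ (pow_nonneg hx.1 _) (pow_le_pow_of_le_one hx.1 hx.2 (Nat.le_succ _))
        (by positivity) ?_
      exact_mod_cast Nat.factorial_le (Nat.le_succ _)
    exact fun x hx => ⟨h1 x hx, step (n + 1) h1 x hx⟩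

/-- The solution of `φ'' = Wφ`, `φ(0) = 1`, `φ'(0) = 0` on `[0,1]` for `W ≥ 0`. -/
lemma exists_fundamental (hW : ContinuousOn W UI) (hpos : ∀ x ∈ UI, 0 < W x) :
    ∃ φ φ' : ℝ → ℝ, (∀ x ∈ UI, HasDerivWithinAt φ (φ' x) UI x) ∧
      (∀ x ∈ UI, HasDerivWithinAt φ' (W x * φ x) UI x) ∧ φ 0 = 1 ∧ φ' 0 = 0 ∧
      (∀ x ∈ UI, 1 ≤ φ x) ∧ 0 < φ' 1 := by
  obtain ⟨M, hM⟩ := isCompact_Icc.exists_bound_of_continuousOn hW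
  have hM' : ∀ x ∈ UI, 0 ≤ W x ∧ W x ≤ M := fun x hx => ⟨(hpos x hx).le, (le_abs_self _).trans (hM x hx)⟩
  have hM0 : 0 ≤ M := (hM' 0 zero_mem_UI).1.trans (hM' 0 zero_mem_UI).2
  have hB := phiSeq_bounds hW hM'
  have hle : ∀ n, ∀ x ∈ UI, M ^ n * (x ^ n / n.factorial) ≤ M ^ n / n.factorial := fun n x hx => by
    rw [← mul_div_assoc]
    exact div_le_div_of_nonneg_right
      (mul_le_of_le_one_right (pow_nonneg hM0 _) (pow_le_one₀ hx.1 hx.2)) (by positivity)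
  have hs : Summable fun n : ℕ => M ^ n / n.factorial := Real.summable_pow_div_factorial M
  have b0 : ∀ n, ∀ x ∈ UI, |phiSeq W n x| ≤ M ^ n / n.factorial := fun n x hx => by
    rw [abs_of_nonneg (hB n x hx).1.1]
    exact (hB n x hx).1.2.trans (hle n x hx)
  have b1 : ∀ n, ∀ x ∈ UI, |dphiSeq W n x| ≤ M ^ n / n.factorial
    | 0 => fun x _ => by simp [dphiSeq]
    | n + 1 => fun x hx => by
      rw [abs_of_nonneg (hB n x hx).2.1]
      exact (hB n x hx).2.2.trans (hle (n + 1) x hx)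
  -- The second derivative of an iterate is W times the previous iterate, hence the shift n - 1. At
  -- n = 0 the truncated subtraction is harmless because the left side vanishes.
  have b2 : ∀ n, ∀ x ∈ UI, |ddphiSeq W n x| ≤ M * (M ^ (n - 1) / (n - 1).factorial)
    | 0 => fun x _ => by simp [ddphiSeq, hM0]
    | n + 1 => fun x hx => by
      rw [ddphiSeq, abs_mul]
      exact mul_le_mul (hM x hx) (b0 n x hx) (abs_nonneg _) hM0
  have hs2 : Summable fun n : ℕ => M * (M ^ (n - 1) / (n - 1).factorial) := by
    refine (summable_nat_add_iff 1).1 ?_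
    simpa using hs.mul_left M
  have hd1 : ∀ x ∈ UI, HasDerivWithinAt (fun y => ∑' n, phiSeq W n y) (∑' n, dphiSeq W n x) UI x :=
    fun x hx => hasDerivWithinAt_tsum_UI (phiSeq_hasDeriv hW) (dphiSeq_continuousOn hW) b0 hs b1 hs hx
  have hS0 : ∀ x ∈ UI, Summable fun n => phiSeq W n x := fun x hx =>
    Summable.of_norm_bounded hs fun n => b0 n x hx
  have hge : ∀ x ∈ UI, 1 ≤ ∑' n, phiSeq W n x := fun x hx => by
    have := (hS0 x hx).le_tsum 0 fun n _ => (hB n x hx).1.1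
    simpa [phiSeq] using this
  have hd2 : ∀ x ∈ UI, HasDerivWithinAt (fun y => ∑' n, dphiSeq W n y)
      (W x * ∑' n, phiSeq W n x) UI x := fun x hx => by
    have h := hasDerivWithinAt_tsum_UI (dphiSeq_hasDeriv hW) (ddphiSeq_continuousOn hW) b1 hs b2 hs2 hx
    have h2 : ∑' n, ddphiSeq W n x = W x * ∑' n, phiSeq W n x := by
      have hs3 : Summable fun n => ddphiSeq W n x :=
        Summable.of_norm_bounded hs2 fun n => b2 n x hx
      rw [hs3.tsum_eq_zero_add, ← tsum_mul_left]
      simp [ddphiSeq]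
    rwa [h2] at h
  have hz : ∀ n, dphiSeq W n 0 = 0
    | 0 => rfl
    | n + 1 => by simp [dphiSeq]
  refine ⟨fun y => ∑' n, phiSeq W n y, fun y => ∑' n, dphiSeq W n y, hd1, hd2, ?_, ?_, hge, ?_⟩
  · simp only
    rw [(hS0 0 zero_mem_UI).tsum_eq_zero_add]
    simp [phiSeq]
  · simp [hz]
  · have hc : ContinuousOn (fun x => W x * ∑' n, phiSeq W n x) UI :=
      hW.mul fun x hx => (hd1 x hx).continuousWithinAt
    -- φ'(1) is the integral of Wφ, which is positive since φ ≥ 1.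
    have h := primitive_of_hasDeriv hd2 hc 1 one_mem_UI
    simp only [hz, tsum_zero, zero_add] at h
    simp only [h]
    refine intervalIntegral.intervalIntegral_pos_of_pos_on
      (ContinuousOn_intervalIntegrable_UI hc zero_mem_UI one_mem_UI) (fun x hx => ?_) one_pos
    have hx' : x ∈ UI := ⟨hx.1.le, hx.2.le⟩
    exact mul_pos (hpos x hx') (one_pos.trans_le (hge x hx'))

end Fundamental

/-! ### The Green function built from two adapted solutions. -/

lemma mem_UI_reflect {x : ℝ} (hx : x ∈ UI) : 1 - x ∈ UI := ⟨by linarith [hx.2], by linarith [hx.1]⟩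

lemma hasDerivWithinAt_reflect {f : ℝ → ℝ} {f' x : ℝ} (h : HasDerivWithinAt f f' UI (1 - x)) :
    HasDerivWithinAt (fun y => f (1 - y)) (-f') UI x := by
  have h2 : HasDerivWithinAt (fun y : ℝ => 1 - y) (-1) UI x :=
    (hasDerivWithinAt_id x UI).const_sub 1
  have := h.comp x h2 fun y hy => mem_UI_reflect hy
  simpa using! this

/-- A pair of solutions of `φ'' = Vφ` adapted to the two Neumann conditions, with Wronskian `w`. -/
structure IsGreenPair (V φ φ' ψ ψ' : ℝ → ℝ) (w : ℝ) : Prop where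
  left : ∀ x ∈ UI, HasDerivWithinAt φ (φ' x) UI x
  left' : ∀ x ∈ UI, HasDerivWithinAt φ' (V x * φ x) UI x
  right : ∀ x ∈ UI, HasDerivWithinAt ψ (ψ' x) UI x
  right' : ∀ x ∈ UI, HasDerivWithinAt ψ' (V x * ψ x) UI x
  left_zero : φ' 0 = 0
  right_one : ψ' 1 = 0
  left_pos : ∀ x ∈ UI, 0 < φ x
  right_pos : ∀ x ∈ UI, 0 < ψ x
  wronskian : ∀ x ∈ UI, φ' x * ψ x - φ x * ψ' x = w
  wronskian_pos : 0 < w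

/-- The solution adapted to the right end point is the reflection of the fundamental solution χ for
V(1-x). The Wronskian is constant, and its value at 0 is χ'(1) > 0. -/
lemma exists_greenPair {V : ℝ → ℝ} (hV : ContinuousOn V UI) (hpos : ∀ x ∈ UI, 0 < V x) :
    ∃ φ φ' ψ ψ' w, IsGreenPair V φ φ' ψ ψ' w := by
  obtain ⟨φ, φ', h1, h2, h3, h4, h5, h6⟩ := exists_fundamental hV hpos
  have hVr : ContinuousOn (fun x => V (1 - x)) UI :=
    hV.comp (by fun_prop) fun x hx => mem_UI_reflect hx
  obtain ⟨χ, χ', k1, k2, k3, k4, k5, k6⟩ := exists_fundamental hVr fun x hx => hpos _ (mem_UI_reflect hx)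
  have r1 : ∀ x ∈ UI, HasDerivWithinAt (fun y => χ (1 - y)) (-χ' (1 - x)) UI x :=
    fun x hx => hasDerivWithinAt_reflect (k1 _ (mem_UI_reflect hx))
  have r2 : ∀ x ∈ UI, HasDerivWithinAt (fun y => -χ' (1 - y)) (V x * χ (1 - x)) UI x := fun x hx => by
    have := (hasDerivWithinAt_reflect (k2 _ (mem_UI_reflect hx))).neg
    simpa using! this
  have hw : ∀ x ∈ UI, HasDerivWithinAt (fun y => φ' y * χ (1 - y) - φ y * -χ' (1 - y)) 0 UI x := by
    intro x hx
    have := ((h2 x hx).mul (r1 x hx)).sub ((h1 x hx).mul (r2 x hx))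
    convert! this using 1
    ring
  have hwc : ∀ x ∈ UI, φ' x * χ (1 - x) - φ x * -χ' (1 - x) = χ' 1 := fun x hx => by
    have := primitive_of_hasDeriv hw continuousOn_const x hx
    simpa [h3, h4] using this
  exact ⟨φ, φ', fun y => χ (1 - y), fun y => -χ' (1 - y), χ' 1, h1, h2, r1, r2, h4, by simp [k4],
    fun x hx => one_pos.trans_le (h5 x hx), fun x hx => one_pos.trans_le (k5 _ (mem_UI_reflect hx)),
    hwc, k6⟩

/-- The Green function of a pair of solutions. -/
def green (φ ψ : ℝ → ℝ) (w x y : ℝ) : ℝ := φ (min x y) * ψ (max x y) / w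

section Green

variable {V φ φ' ψ ψ' : ℝ → ℝ} {w : ℝ}

lemma IsGreenPair.continuousOn_left (h : IsGreenPair V φ φ' ψ ψ' w) : ContinuousOn φ UI :=
  fun x hx => (h.left x hx).continuousWithinAt

lemma IsGreenPair.continuousOn_right (h : IsGreenPair V φ φ' ψ ψ' w) : ContinuousOn ψ UI :=
  fun x hx => (h.right x hx).continuousWithinAt

lemma IsGreenPair.continuousOn_green (h : IsGreenPair V φ φ' ψ ψ' w) :
    ContinuousOn (fun p : ℝ × ℝ => green φ ψ w p.1 p.2) (UI ×ˢ UI) := by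
  refine ContinuousOn.div_const (ContinuousOn.mul ?_ ?_) _
  · refine h.continuousOn_left.comp (f := fun p : ℝ × ℝ => min p.1 p.2) (by fun_prop) fun p hp => ?_
    exact ⟨le_min hp.1.1 hp.2.1, (min_le_left _ _).trans hp.1.2⟩
  · refine h.continuousOn_right.comp (f := fun p : ℝ × ℝ => max p.1 p.2) (by fun_prop) fun p hp => ?_
    exact ⟨hp.1.1.trans (le_max_left _ _), max_le hp.1.2 hp.2.2⟩

lemma green_symm (φ ψ : ℝ → ℝ) (w x y : ℝ) : green φ ψ w x y = green φ ψ w y x := by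
  simp only [green, min_comm, max_comm]

lemma IsGreenPair.green_pos (h : IsGreenPair V φ φ' ψ ψ' w) {x y : ℝ} (hx : x ∈ UI) (hy : y ∈ UI) :
    0 < green φ ψ w x y :=
  div_pos (mul_pos (h.left_pos _ ⟨le_min hx.1 hy.1, (min_le_left _ _).trans hx.2⟩)
    (h.right_pos _ ⟨hx.1.trans (le_max_left _ _), max_le hx.2 hy.2⟩)) h.wronskian_pos

/-- Splitting the integral at y = x leaves only primitives of φg and ψg. Integrability of g is
enough, so the formula also applies to L² functions. -/
lemma IsGreenPair.integral_green (h : IsGreenPair V φ φ' ψ ψ' w) {g : ℝ → ℝ}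
    (hg : IntervalIntegrable g volume 0 1) {x : ℝ} (hx : x ∈ UI) :
    ∫ y in (0 : ℝ)..1, green φ ψ w x y * g y = (ψ x * (∫ y in (0 : ℝ)..x, φ y * g y)
      + φ x * ((∫ y in (0 : ℝ)..1, ψ y * g y) - ∫ y in (0 : ℝ)..x, ψ y * g y)) / w := by
  have hφ : IntervalIntegrable (fun y => φ y * g y) volume 0 1 :=
    hg.continuousOn_mul (by rw [uIcc_zero_one]; exact h.continuousOn_left)
  have hψ : IntervalIntegrable (fun y => ψ y * g y) volume 0 1 :=
    hg.continuousOn_mul (by rw [uIcc_zero_one]; exact h.continuousOn_right)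
  have hG : IntervalIntegrable (fun y => green φ ψ w x y * g y) volume 0 1 := by
    refine hg.continuousOn_mul ?_
    rw [uIcc_zero_one]
    exact h.continuousOn_green.comp (f := fun y => (x, y)) (by fun_prop) fun y hy => ⟨hx, hy⟩
  rw [intervalIntegral.integral_interval_sub_left hψ (intervalIntegrable_mono_UI hψ zero_mem_UI hx),
    ← intervalIntegral.integral_add_adjacent_intervals
      (intervalIntegrable_mono_UI hG zero_mem_UI hx) (intervalIntegrable_mono_UI hG hx one_mem_UI),
    add_div, mul_div_right_comm, mul_div_right_comm, ← intervalIntegral.integral_const_mul,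
    ← intervalIntegral.integral_const_mul]
  congr 1
  · refine intervalIntegral.integral_congr fun y hy => ?_
    rw [uIcc_of_le hx.1] at hy
    simp only [green, min_eq_right hy.2, max_eq_left hy.2]
    ring
  · refine intervalIntegral.integral_congr fun y hy => ?_
    rw [uIcc_of_le hx.2] at hy
    simp only [green, min_eq_left hy.1, max_eq_right hy.1]
    ring

/-- The Green function inverts `-∂ₓₓ + V` on continuous functions. -/
lemma IsGreenPair.solves (h : IsGreenPair V φ φ' ψ ψ' w) {g : ℝ → ℝ}
    (hg : ContinuousOn g UI) :
    ∃ k : ℝ → ℝ, (∀ x ∈ UI, HasDerivWithinAt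
        (fun x => ∫ y in (0 : ℝ)..1, green φ ψ w x y * g y) (k x) UI x) ∧
      (∀ x ∈ UI, HasDerivWithinAt k
        (V x * (∫ y in (0 : ℝ)..1, green φ ψ w x y * g y) - g x) UI x) ∧ k 0 = 0 ∧ k 1 = 0 := by
  have hgi := ContinuousOn_intervalIntegrable_UI hg zero_mem_UI one_mem_UI
  have hw := h.wronskian_pos.ne'
  have hA : ∀ x ∈ UI, HasDerivWithinAt (fun x => ∫ y in (0 : ℝ)..x, φ y * g y) (φ x * g x) UI x :=
    fun x hx => hasDerivWithinAt_primitive (h.continuousOn_left.mul hg) hx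
  have hB : ∀ x ∈ UI, HasDerivWithinAt
      (fun x => (∫ y in (0 : ℝ)..1, ψ y * g y) - ∫ y in (0 : ℝ)..x, ψ y * g y) (-(ψ x * g x)) UI x :=
    fun x hx => (hasDerivWithinAt_primitive (h.continuousOn_right.mul hg) hx).const_sub _
  -- In the first derivative the contributions ψφg and -φψg of the differentiated integrals cancel;
  -- in the second they combine into -g through the Wronskian.
  refine ⟨fun x => (ψ' x * (∫ y in (0 : ℝ)..x, φ y * g y)
      + φ' x * ((∫ y in (0 : ℝ)..1, ψ y * g y) - ∫ y in (0 : ℝ)..x, ψ y * g y)) / w,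
    fun x hx => ?_, fun x hx => ?_, ?_, ?_⟩
  · have := (((h.right x hx).mul (hA x hx)).add ((h.left x hx).mul (hB x hx))).div_const w
    refine HasDerivWithinAt.congr (f := fun x => (ψ x * (∫ y in (0 : ℝ)..x, φ y * g y)
      + φ x * ((∫ y in (0 : ℝ)..1, ψ y * g y) - ∫ y in (0 : ℝ)..x, ψ y * g y)) / w) ?_
      (fun y hy => h.integral_green hgi hy) (h.integral_green hgi hx)
    convert! this using 1
    ring
  · have := (((h.right' x hx).mul (hA x hx)).add ((h.left' x hx).mul (hB x hx))).div_const w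
    convert! this using 1
    rw [h.integral_green hgi hx]
    have hW := h.wronskian x hx
    field_simp
    rw [← hW]
    ring
  · simp [h.left_zero]
  · simp [h.right_one]

/-- The Green operator is injective. -/
lemma IsGreenPair.ae_eq_zero (h : IsGreenPair V φ φ' ψ ψ' w) {g : ℝ → ℝ}
    (hg : IntervalIntegrable g volume 0 1)
    (h0 : ∀ x ∈ UI, ∫ y in (0 : ℝ)..1, green φ ψ w x y * g y = 0) : g =ᵐ[volUI] 0 := by
  have hw := h.wronskian_pos
  have hφ : IntervalIntegrable (fun y => φ y * g y) volume 0 1 :=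
    hg.continuousOn_mul (by rw [uIcc_zero_one]; exact h.continuousOn_left)
  have hψ : IntervalIntegrable (fun y => ψ y * g y) volume 0 1 :=
    hg.continuousOn_mul (by rw [uIcc_zero_one]; exact h.continuousOn_right)
  set A := fun x => ∫ y in (0 : ℝ)..x, φ y * g y
  set B := fun x => (∫ y in (0 : ℝ)..1, ψ y * g y) - ∫ y in (0 : ℝ)..x, ψ y * g y
  have hAc : ContinuousOn A UI := continuousOn_primitive_UI hφ
  have hBc : ContinuousOn B UI := continuousOn_const.sub (continuousOn_primitive_UI hψ)
  have e1 : ∀ x ∈ UI, ψ x * A x + φ x * B x = 0 := fun x hx => by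
    have := h0 x hx
    rw [h.integral_green hg hx, div_eq_zero_iff] at this
    exact this.resolve_right hw.ne'
  have hφ'c : ContinuousOn φ' UI := fun x hx => (h.left' x hx).continuousWithinAt
  have hψ'c : ContinuousOn ψ' UI := fun x hx => (h.right' x hx).continuousWithinAt
  -- Differentiating `e1` almost everywhere, the terms with g cancel; continuity extends the
  -- identity to all of [0,1].
  have e2 : ∀ x ∈ UI, ψ' x * A x + φ' x * B x = 0 := by
    refine eqOn_of_ae_eq (g := fun _ => 0) ((hψ'c.mul hAc).add (hφ'c.mul hBc)) continuousOn_const ?_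
    have h00 : ∀ᵐ x : ℝ, x ≠ 0 := by simp [ae_iff, measure_singleton]
    have h11 : ∀ᵐ x : ℝ, x ≠ 1 := by simp [ae_iff, measure_singleton]
    refine ae_volUI_of_ae ?_
    filter_upwards [hφ.ae_hasDerivAt_integral, hψ.ae_hasDerivAt_integral, h00, h11]
      with x hx1 hx2 hx0 hx3 hx
    have hx' : x ∈ uIcc (0 : ℝ) 1 := by rwa [uIcc_zero_one]
    have hA := hx1 hx' 0 left_mem_uIcc
    have hB := (hx2 hx' 0 left_mem_uIcc).const_sub (∫ y in (0 : ℝ)..1, ψ y * g y)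
    have hn : UI ∈ 𝓝 x := Icc_mem_nhds (lt_of_le_of_ne hx.1 (Ne.symm hx0)) (lt_of_le_of_ne hx.2 hx3)
    have hd := (((h.right x hx).hasDerivAt hn).mul hA).add (((h.left x hx).hasDerivAt hn).mul hB)
    have hz : HasDerivAt (fun _ : ℝ => (0 : ℝ))
        (ψ' x * A x + ψ x * (φ x * g x) + (φ' x * B x + φ x * -(ψ x * g x))) x := by
      refine hd.congr_of_eventuallyEq ?_
      filter_upwards [hn] with y hy using (e1 y hy).symm
    have := hz.unique (hasDerivAt_const x (0 : ℝ))
    linarith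
  -- `e1` and `e2` form a linear system for A and B whose determinant is, up to sign, the Wronskian.
  have hA0 : ∀ x ∈ UI, A x = 0 := fun x hx => by
    have : w * A x = 0 := by
      rw [← h.wronskian x hx]
      linear_combination φ' x * e1 x hx - φ x * e2 x hx
    exact (mul_eq_zero.1 this).resolve_left hw.ne'
  have h3 := ae_eq_of_primitive_eq hφ (g := fun _ => 0) intervalIntegrable_const fun x hx => by
    rw [intervalIntegral.integral_zero]; exact hA0 x hx
  filter_upwards [h3, ae_restrict_mem measurableSet_Icc] with x hx hxU
  exact (mul_eq_zero.1 hx).resolve_left (h.left_pos x hxU).ne'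

end Green

/-! ### Integral operators with continuous kernels -/

lemma norm_L2UI_eq (f : L2UI) : ‖f‖ = l2norm f := by
  rw [l2norm_eq_norm_toLp (Lp.memLp f), Lp.toLp_coeFn]

lemma inner_L2UI_eq (f g : L2UI) : ⟪f, g⟫ = ∫ x in (0 : ℝ)..1, f x * g x := by
  rw [← inner_toLp (Lp.memLp f) (Lp.memLp g), Lp.toLp_coeFn, Lp.toLp_coeFn]

lemma norm_L2UI_le_of_bound (f : L2UI) {C : ℝ} (hC : 0 ≤ C) (h : ∀ᵐ x ∂volUI, |f x| ≤ C) :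
    ‖f‖ ≤ C := by
  rw [norm_L2UI_eq]; exact l2norm_le_of_bound (Lp.memLp f) hC h

/-- The integral transform with kernel `G`. -/
def kerFun (G : ℝ → ℝ → ℝ) (g : ℝ → ℝ) (x : ℝ) : ℝ := ∫ y in (0 : ℝ)..1, G x y * g y

section Kernel

variable {G : ℝ → ℝ → ℝ}

lemma continuousOn_kernel_right (hG : ContinuousOn (fun p : ℝ × ℝ => G p.1 p.2) (UI ×ˢ UI)) {x : ℝ}
    (hx : x ∈ UI) : ContinuousOn (G x) UI :=
  hG.comp (f := fun y => (x, y)) (by fun_prop) fun _ hy => ⟨hx, hy⟩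

lemma kernel_unif (hG : ContinuousOn (fun p : ℝ × ℝ => G p.1 p.2) (UI ×ˢ UI)) {ε : ℝ}
    (hε : 0 < ε) : ∃ δ > 0, ∀ x ∈ UI, ∀ x' ∈ UI, |x - x'| < δ → ∀ y ∈ UI, |G x y - G x' y| ≤ ε := by
  have h := (isCompact_Icc.prod isCompact_Icc).uniformContinuousOn_of_continuous hG
  obtain ⟨δ, hδ, h⟩ := Metric.uniformContinuousOn_iff.1 h ε hε
  refine ⟨δ, hδ, fun x hx x' hx' hd y hy => ?_⟩
  refine (h (x, y) ⟨hx, hy⟩ (x', y) ⟨hx', hy⟩ ?_).le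
  rw [Prod.dist_eq, dist_self, max_eq_left dist_nonneg]
  exact hd

lemma abs_kerFun_sub_le (hG : ContinuousOn (fun p : ℝ × ℝ => G p.1 p.2) (UI ×ˢ UI)) {x x' c : ℝ}
    (hx : x ∈ UI) (hx' : x' ∈ UI) (hc : ∀ y ∈ UI, |G x y - G x' y| ≤ c) {g : ℝ → ℝ}
    (hg : MemLp g 2 volUI) : |kerFun G g x - kerFun G g x'| ≤ c * l2norm g := by
  have hc0 : 0 ≤ c := (abs_nonneg _).trans (hc 0 zero_mem_UI)
  have h1 := continuousOn_kernel_right hG hx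
  have h2 := continuousOn_kernel_right hG hx'
  have hgi := MemLp_intervalIntegrable hg
  have e : kerFun G g x - kerFun G g x' = ∫ y in (0 : ℝ)..1, (G x y - G x' y) * g y := by
    rw [kerFun, kerFun, ← intervalIntegral.integral_sub]
    · simp only [sub_mul]
    · exact hgi.continuousOn_mul (by rwa [uIcc_zero_one])
    · exact hgi.continuousOn_mul (by rwa [uIcc_zero_one])
  rw [e]
  refine (abs_integral_mul_le (memLp_of_continuousOn (h1.sub h2) 2) hg).trans ?_
  refine mul_le_mul_of_nonneg_right ?_ (l2norm_nonneg _)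
  exact l2norm_le_of_bound (memLp_of_continuousOn (h1.sub h2) 2) hc0
    ((ae_restrict_iff' measurableSet_Icc).2 (Eventually.of_forall hc))

lemma abs_kerFun_le (hG : ContinuousOn (fun p : ℝ × ℝ => G p.1 p.2) (UI ×ˢ UI)) {x c : ℝ}
    (hx : x ∈ UI) (hc : ∀ y ∈ UI, |G x y| ≤ c) {g : ℝ → ℝ}
    (hg : MemLp g 2 volUI) : |kerFun G g x| ≤ c * l2norm g := by
  have hc0 : 0 ≤ c := (abs_nonneg _).trans (hc 0 zero_mem_UI)
  have h1 := memLp_of_continuousOn (continuousOn_kernel_right hG hx) 2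
  refine (abs_integral_mul_le h1 hg).trans (mul_le_mul_of_nonneg_right ?_ (l2norm_nonneg _))
  exact l2norm_le_of_bound h1 hc0
    ((ae_restrict_iff' measurableSet_Icc).2 (Eventually.of_forall hc))

lemma continuousOn_kerFun (hG : ContinuousOn (fun p : ℝ × ℝ => G p.1 p.2) (UI ×ˢ UI)) {g : ℝ → ℝ}
    (hg : MemLp g 2 volUI) : ContinuousOn (kerFun G g) UI := by
  rw [Metric.continuousOn_iff]
  intro x hx ε hε
  have hp : 0 < l2norm g + 1 := by linarith [l2norm_nonneg g]
  obtain ⟨δ, hδ, h⟩ := kernel_unif hG (div_pos (half_pos hε) hp)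
  refine ⟨δ, hδ, fun x' hx' hd => ?_⟩
  have h1 := abs_kerFun_sub_le hG hx' hx (h x' hx' x hx hd) hg
  have h2 : ε / 2 / (l2norm g + 1) * l2norm g ≤ ε / 2 := by
    rw [div_mul_eq_mul_div, div_le_iff₀ hp]
    nlinarith [l2norm_nonneg g]
  rw [Real.dist_eq]
  linarith

lemma kerFun_congr_ae {g h : ℝ → ℝ} (H : g =ᵐ[volUI] h) (x : ℝ) : kerFun G g x = kerFun G h x :=
  integral_congr_ae_UI (H.mono fun y hy => by simp only [hy])

lemma kerFun_add (hG : ContinuousOn (fun p : ℝ × ℝ => G p.1 p.2) (UI ×ˢ UI)) {g h : ℝ → ℝ}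
    (hg : MemLp g 2 volUI) (hh : MemLp h 2 volUI) {x : ℝ} (hx : x ∈ UI) :
    kerFun G (g + h) x = kerFun G g x + kerFun G h x := by
  have h1 := continuousOn_kernel_right hG hx
  rw [← uIcc_zero_one] at h1
  rw [kerFun, kerFun, kerFun, ← intervalIntegral.integral_add
    ((MemLp_intervalIntegrable hg).continuousOn_mul h1)
    ((MemLp_intervalIntegrable hh).continuousOn_mul h1)]
  simp only [Pi.add_apply, mul_add]

lemma kerFun_smul (c : ℝ) (g : ℝ → ℝ) (x : ℝ) : kerFun G (c • g) x = c * kerFun G g x := by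
  rw [kerFun, kerFun, ← intervalIntegral.integral_const_mul]
  refine intervalIntegral.integral_congr fun y _ => ?_
  simp only [Pi.smul_apply, smul_eq_mul]; ring

/-- The bounded operator of `L²([0,1])` with kernel `G`. -/
lemma exists_kernel_operator (hG : ContinuousOn (fun p : ℝ × ℝ => G p.1 p.2) (UI ×ˢ UI)) :
    ∃ T : L2UI →L[ℝ] L2UI, ∀ g : L2UI, T g =ᵐ[volUI] kerFun G g := by
  obtain ⟨M, hM⟩ := (isCompact_Icc.prod isCompact_Icc).exists_bound_of_continuousOn hG
  have hm : ∀ g : L2UI, MemLp (kerFun G g) 2 volUI := fun g =>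
    memLp_of_continuousOn (continuousOn_kerFun hG (Lp.memLp g)) 2
  have hM0 : 0 ≤ M := (norm_nonneg _).trans (hM (0, 0) ⟨zero_mem_UI, zero_mem_UI⟩)
  let T : L2UI →ₗ[ℝ] L2UI :=
    { toFun := fun g => (hm g).toLp _
      map_add' := fun g h => by
        rw [← MemLp.toLp_add]
        refine (MemLp.toLp_eq_toLp_iff _ _).2 ?_
        filter_upwards [ae_restrict_mem measurableSet_Icc] with x hx
        rw [kerFun_congr_ae (Lp.coeFn_add g h), kerFun_add hG (Lp.memLp g) (Lp.memLp h) hx]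
        rfl
      map_smul' := fun c g => by
        rw [← MemLp.toLp_const_smul]
        refine (MemLp.toLp_eq_toLp_iff _ _).2 (Eventually.of_forall fun x => ?_)
        rw [kerFun_congr_ae (Lp.coeFn_smul c g), kerFun_smul]
        rfl }
  refine ⟨T.mkContinuous M fun g => ?_, fun g => (hm g).coeFn_toLp⟩
  refine norm_L2UI_le_of_bound _ (by positivity) ?_
  filter_upwards [(hm g).coeFn_toLp, ae_restrict_mem measurableSet_Icc] with x hx hxU
  have : (T g : ℝ → ℝ) x = kerFun G g x := hx
  rw [this, norm_L2UI_eq]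
  exact abs_kerFun_le hG hxU (fun y hy => hM (x, y) ⟨hxU, hy⟩) (Lp.memLp g)

/-- Step functions with prescribed values, as a linear map. -/
lemma exists_step_map {ι : Type*} [Fintype ι] [MeasurableSpace ι] [MeasurableSingletonClass ι]
    {κ : ℝ → ι} (hκ : Measurable κ) :
    ∃ S : (ι → ℝ) →ₗ[ℝ] L2UI, ∀ a, S a =ᵐ[volUI] fun x => a (κ x) := by
  have hm : ∀ a : ι → ℝ, MemLp (fun x => a (κ x)) 2 volUI := fun a => by
    refine MemLp.of_bound ((measurable_of_finite a).comp hκ).aestronglyMeasurable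
      (∑ i, |a i|) (Eventually.of_forall fun x => ?_)
    exact Finset.single_le_sum (f := fun i => |a i|) (fun i _ => abs_nonneg _) (Finset.mem_univ _)
  refine ⟨{ toFun := fun a => (hm a).toLp _, map_add' := fun a b => ?_, map_smul' := fun c a => ?_ },
    fun a => (hm a).coeFn_toLp⟩
  · rw [← MemLp.toLp_add]; rfl
  · rw [RingHom.id_apply, ← MemLp.toLp_const_smul]; rfl

/-- Freezing the first variable of the kernel on a fine grid gives operators of finite rank that
converge in operator norm, and compact operators are closed for that norm. -/
lemma kernel_operator_isCompact (hG : ContinuousOn (fun p : ℝ × ℝ => G p.1 p.2) (UI ×ˢ UI))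
    {T : L2UI →L[ℝ] L2UI} (hT : ∀ g : L2UI, T g =ᵐ[volUI] kerFun G g) : IsCompactOperator T := by
  have hcl := isClosed_setOfPred_isCompactOperator (𝕜₁ := ℝ) (𝕜₂ := ℝ) (σ₁₂ := RingHom.id ℝ)
    (M₁ := L2UI) (M₂ := L2UI)
  refine hcl.closure_subset (Metric.mem_closure_iff.2 fun ε hε => ?_)
  obtain ⟨δ, hδ, h⟩ := kernel_unif hG (half_pos hε)
  obtain ⟨N, hN⟩ := exists_nat_gt (1 / δ)
  have hNpos : (0 : ℝ) < N := (one_div_pos.2 hδ).trans hN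
  -- Index of the grid point just left of x. The cap at N takes effect only outside [0,1]; the value
  -- N itself is needed at x = 1.
  let κ : ℝ → Fin (N + 1) := fun x => ⟨min ⌊N * x⌋₊ N, by omega⟩
  have hκ : Measurable κ :=
    (measurable_of_countable fun n : ℕ => (⟨min n N, by omega⟩ : Fin (N + 1))).comp
      (Nat.measurable_floor.comp (measurable_const.mul measurable_id))
  let pt : Fin (N + 1) → ℝ := fun i => i / N
  have hpt : ∀ i, pt i ∈ UI := fun i => by
    refine ⟨by positivity, (div_le_one hNpos).2 ?_⟩
    exact_mod_cast Nat.lt_succ_iff.1 i.2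
  have hclose : ∀ x ∈ UI, |x - pt (κ x)| < δ := fun x hx => by
    have h0 : (0 : ℝ) ≤ N * x := mul_nonneg hNpos.le hx.1
    have h1 : ⌊N * x⌋₊ ≤ N := Nat.floor_le_of_le (by nlinarith [hx.2])
    have h2 : ((κ x : ℕ) : ℝ) = ⌊N * x⌋₊ := by simp [κ, h1]
    have h3 := Nat.floor_le h0
    have h4 := Nat.lt_floor_add_one (N * x)
    have h5 : N * (x - pt (κ x)) = N * x - ⌊N * x⌋₊ := by
      simp only [pt, h2]; field_simp
    have h6 : 1 / N < δ := by rw [one_div_lt hNpos hδ]; exact hN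
    have h7 : x - pt (κ x) < 1 / N := by rw [lt_div_iff₀ hNpos]; nlinarith
    have h8 : 0 ≤ x - pt (κ x) := by
      by_contra hneg
      push Not at hneg
      nlinarith
    rw [abs_of_nonneg h8]; linarith
  obtain ⟨S, hS⟩ := exists_step_map hκ
  have hrow : ∀ i, MemLp (G (pt i)) 2 volUI := fun i =>
    memLp_of_continuousOn (continuousOn_kernel_right hG (hpt i)) 2
  -- Values of the integral transform at the grid points, written as inner products with the rows of
  -- the kernel.
  let P : L2UI →L[ℝ] (Fin (N + 1) → ℝ) :=
    ContinuousLinearMap.pi fun i => innerSL ℝ ((hrow i).toLp _)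
  have hP : ∀ g i, P g i = kerFun G g (pt i) := fun g i => by
    simp only [P, ContinuousLinearMap.pi_apply, innerSL_apply_apply]
    rw [inner_L2UI_eq]
    exact integral_congr_ae_UI ((hrow i).coeFn_toLp.mono fun y hy => by simp only [hy])
  refine ⟨(LinearMap.toContinuousLinearMap S).comp P, ?_, ?_⟩
  · exact (isCompactOperator_of_locallyCompactSpace_dom P).clm_comp _
  · rw [dist_eq_norm]
    refine lt_of_le_of_lt (ContinuousLinearMap.opNorm_le_bound _ (half_pos hε).le fun g => ?_)
      (half_lt_self hε)
    refine norm_L2UI_le_of_bound _ (by positivity) ?_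
    have e : (T - (LinearMap.toContinuousLinearMap S).comp P) g = T g - S (P g) := rfl
    rw [e]
    filter_upwards [Lp.coeFn_sub (T g) (S (P g)), hT g, hS (P g), ae_restrict_mem measurableSet_Icc]
      with x h1 h2 h3 hx
    rw [h1, Pi.sub_apply, h2, h3, hP, norm_L2UI_eq]
    exact abs_kerFun_sub_le hG hx (hpt _) (h x hx _ (hpt _) (hclose x hx)) (Lp.memLp g)

/-- Fubini's theorem, justified by the boundedness of the kernel and the integrability of f and g.
-/
lemma kernel_operator_symm (hG : ContinuousOn (fun p : ℝ × ℝ => G p.1 p.2) (UI ×ˢ UI))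
    (hs : ∀ x y, G x y = G y x) {T : L2UI →L[ℝ] L2UI}
    (hT : ∀ g : L2UI, T g =ᵐ[volUI] kerFun G g) : T.IsSymmetric := by
  intro f g
  change ⟪T f, g⟫ = ⟪f, T g⟫
  rw [inner_L2UI_eq, inner_L2UI_eq,
    integral_congr_ae_UI (g := fun x => ∫ y, G x y * (f y * g x) ∂volUI)
      ((hT f).mono fun x hx => by
        simp only [hx, kerFun]
        rw [integral_volUI, ← intervalIntegral.integral_mul_const]
        exact intervalIntegral.integral_congr fun y _ => by ring),
    integral_congr_ae_UI (f := fun x => f x * T g x)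
      (g := fun y => ∫ x, G x y * (f y * g x) ∂volUI)
      ((hT g).mono fun x hx => by
        simp only [hx, kerFun]
        rw [integral_volUI, ← intervalIntegral.integral_const_mul]
        exact intervalIntegral.integral_congr fun y _ => by simp only [hs x y]; ring),
    ← integral_volUI, ← integral_volUI]
  refine integral_integral_swap ?_
  obtain ⟨M, hM⟩ := (isCompact_Icc.prod isCompact_Icc).exists_bound_of_continuousOn hG
  have hfg : Integrable (fun p : ℝ × ℝ => f p.2 * g p.1) (volUI.prod volUI) := by
    have := (MemLp_integrable (Lp.memLp g)).mul_prod (MemLp_integrable (Lp.memLp f))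
    exact this.congr (Eventually.of_forall fun p => mul_comm _ _)
  refine hfg.bdd_mul (c := M) ?_ ?_
  · rw [Measure.prod_restrict]
    exact hG.aestronglyMeasurable (measurableSet_Icc.prod measurableSet_Icc)
  · rw [Measure.prod_restrict]
    exact (ae_restrict_iff' (measurableSet_Icc.prod measurableSet_Icc)).2
      (Eventually.of_forall hM)

end Kernel

/-! ### Existence of the eigensystem -/

/-- Ordering the indices by μ, with ties broken by an injective code into ℕ, gives an infinite
linear order with finite initial segments, hence of order type ω. -/
lemma exists_monotone_enumeration {ι : Type*} [Infinite ι] (μ : ι → ℝ)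
    (hfin : ∀ M, {i | μ i ≤ M}.Finite) : ∃ σ : ℕ ≃ ι, Monotone (μ ∘ σ) := by
  have hc : Countable ι := by
    rw [← Set.countable_univ_iff]
    refine (Set.countable_iUnion fun n : ℕ => (hfin n).countable).mono fun i _ => ?_
    obtain ⟨n, hn⟩ := exists_nat_ge (μ i)
    exact mem_iUnion.2 ⟨n, hn⟩
  obtain ⟨c, hcinj⟩ := hc.exists_injective_nat
  let f : ι → ℝ ×ₗ ℕ := fun i => toLex (μ i, c i)
  have hf : Function.Injective f := fun i j hij => hcinj (congrArg Prod.snd (toLex.injective hij))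
  let : LinearOrder ι := LinearOrder.lift' f hf
  have hle : ∀ {i j : ι}, i ≤ j → μ i ≤ μ j := fun {i j} hij => by
    have h : f i ≤ f j := hij
    rcases (Prod.Lex.le_iff).1 h with h | h
    · exact h.le
    · exact h.1.le
  have hIic : ∀ j : ι, (Iic j).Finite := fun j => (hfin (μ j)).subset fun i hi => hle hi
  let : LocallyFiniteOrder ι := LocallyFiniteOrder.ofFiniteIcc fun a b =>
    (hIic b).subset Icc_subset_Iic_self
  let := LinearLocallyFiniteOrder.succOrder ι
  let := LinearLocallyFiniteOrder.predOrder ι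
  have : NoMaxOrder ι := ⟨fun a => by
    by_contra! h
    exact Set.infinite_univ ((hIic a).subset fun i _ => h i)⟩
  obtain ⟨i₀⟩ := (inferInstance : Nonempty ι)
  obtain ⟨b, hb, hbmin⟩ := (hIic i₀).exists_minimal ⟨i₀, mem_Iic.2 le_rfl⟩
  let : OrderBot ι :=
    { bot := b
      bot_le := fun i => by
        rcases le_total i i₀ with h | h
        · rcases le_total b i with h' | h'
          · exact h'
          · exact hbmin h h'
        · exact le_trans hb h }
  refine ⟨(orderIsoNatOfLinearSuccPredArch (ι := ι)).symm.toEquiv, fun m n hmn => hle ?_⟩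
  exact (orderIsoNatOfLinearSuccPredArch (ι := ι)).symm.monotone hmn

lemma eqOn_zero_of_integral_eq_zero {f : ℝ → ℝ} (hf : ContinuousOn f UI) (h0 : ∀ x ∈ UI, 0 ≤ f x)
    (hi : ∫ x in (0 : ℝ)..1, f x = 0) : ∀ x ∈ UI, f x = 0 := by
  rw [← integral_volUI] at hi
  have h := (integral_eq_zero_iff_of_nonneg_ae
    ((ae_restrict_iff' measurableSet_Icc).2 (Eventually.of_forall h0))
    (integrable_volUI_iff.2 (ContinuousOn_intervalIntegrable_UI hf zero_mem_UI one_mem_UI))).1 hi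
  exact eqOn_of_ae_eq hf continuousOn_const h

lemma IsNeumannMode.of_hasDeriv {V e k : ℝ → ℝ} {μ : ℝ} (hV : ContinuousOn V UI)
    (h1 : ∀ x ∈ UI, HasDerivWithinAt e (k x) UI x)
    (h2 : ∀ x ∈ UI, HasDerivWithinAt k ((V x - μ) * e x) UI x) (h3 : k 0 = 0) (h4 : k 1 = 0) :
    IsNeumannMode V μ e := by
  have hc : ContinuousOn e UI := fun x hx => (h1 x hx).continuousWithinAt
  obtain ⟨a, b, c⟩ := contDiffOn_two_of h1 h2 ((hV.sub continuousOn_const).mul hc)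
  exact ⟨a, c, (b zero_mem_UI).trans h3, (b one_mem_UI).trans h4⟩

lemma IsNeumannMode.const_mul {V e : ℝ → ℝ} {μ : ℝ} (he : IsNeumannMode V μ e)
    (hV : ContinuousOn V UI) (c : ℝ) : IsNeumannMode V μ fun x => c * e x := by
  refine .of_hasDeriv hV (fun x hx => (he.hasDeriv x hx).const_mul c) (fun x hx => ?_)
    (by simp [he.neumann_zero]) (by simp [he.neumann_one])
  convert! (he.hasDeriv_dx x hx).const_mul c using 1
  ring

/-- Eigenfunctions of the Green operator are Neumann modes. -/
lemma IsGreenPair.isNeumannMode {V φ φ' ψ ψ' : ℝ → ℝ} {w : ℝ} (h : IsGreenPair V φ φ' ψ ψ' w)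
    (hV : ContinuousOn V UI) {lam : ℝ} (hl : lam ≠ 0) {e : ℝ → ℝ} (he : ContinuousOn e UI)
    (hK : ∀ x ∈ UI, kerFun (green φ ψ w) e x = lam * e x) : IsNeumannMode V lam⁻¹ e := by
  obtain ⟨k, k1, k2, k3, k4⟩ := h.solves he
  have heq : ∀ x ∈ UI, e x = lam⁻¹ * kerFun (green φ ψ w) e x := fun x hx => by
    rw [hK x hx]; field_simp
  refine .of_hasDeriv hV (k := fun x => lam⁻¹ * k x) (fun x hx => ?_) (fun x hx => ?_)
    (by simp [k3]) (by simp [k4])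
  · exact ((k1 x hx).const_mul lam⁻¹).congr heq (heq x hx)
  · convert! (k2 x hx).const_mul lam⁻¹ using 1
    have := hK x hx
    rw [kerFun] at this
    rw [this]
    field_simp

/-- A finite family of continuous functions is not complete in `L²([0,1])`. -/
lemma infinite_of_complete {ι : Type*} {e : ι → ℝ → ℝ} (he : ∀ i, ContinuousOn (e i) UI)
    (hcomp : ∀ f : L2UI, (∀ i, ∫ x in (0 : ℝ)..1, f x * e i x = 0) → f = 0) : Infinite ι := by
  by_contra hfin
  rw [not_infinite_iff_finite] at hfin
  have hint : ∀ (p : Polynomial ℝ) i, IntervalIntegrable (fun x => p.eval x * e i x) volume 0 1 :=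
    fun p i => ContinuousOn_intervalIntegrable_UI (p.continuous.continuousOn.mul (he i))
      zero_mem_UI one_mem_UI
  -- Moments of polynomials against the family. Completeness makes this map injective, which is
  -- impossible when the target has finite dimension.
  let Φ : Polynomial ℝ →ₗ[ℝ] (ι → ℝ) :=
    { toFun := fun p i => ∫ x in (0 : ℝ)..1, p.eval x * e i x
      map_add' := fun p q => by
        ext i
        rw [Pi.add_apply, ← intervalIntegral.integral_add (hint p i) (hint q i)]
        simp only [Polynomial.eval_add, add_mul]
      map_smul' := fun c p => by
        ext i
        simp only [RingHom.id_apply, Pi.smul_apply, smul_eq_mul, Polynomial.eval_smul]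
        rw [← intervalIntegral.integral_const_mul]
        simp only [mul_assoc] }
  have hinj : Function.Injective Φ := by
    rw [← LinearMap.ker_eq_bot, LinearMap.ker_eq_bot']
    intro p hp
    have hm : MemLp (fun x => p.eval x) 2 volUI := memLp_of_continuousOn p.continuous.continuousOn 2
    have h0 := hcomp (hm.toLp _) fun i => by
      rw [integral_congr_ae_UI (g := fun x => p.eval x * e i x)
        (hm.coeFn_toLp.mono fun x hx => by simp only [hx])]
      exact congrFun hp i
    have h1 : (fun x => p.eval x) =ᵐ[volUI] fun _ => 0 := by
      have h2 := hm.coeFn_toLp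
      rw [h0] at h2
      exact h2.symm.trans (Lp.coeFn_zero ℝ 2 volUI)
    have h2 := eqOn_of_ae_eq p.continuous.continuousOn continuousOn_const h1
    refine Polynomial.eq_zero_of_infinite_isRoot p ((Icc_infinite zero_lt_one).mono fun x hx => ?_)
    exact h2 hx
  exact Polynomial.not_finite (R := ℝ) (Module.Finite.of_injective Φ hinj)

/-- The ground state of a positive symmetric kernel has constant sign. -/
lemma sign_of_ground_state {G : ℝ → ℝ → ℝ}
    (hG : ContinuousOn (fun p : ℝ × ℝ => G p.1 p.2) (UI ×ˢ UI))
    (hpos : ∀ x ∈ UI, ∀ y ∈ UI, 0 < G x y) {lam : ℝ} (hl : 0 < lam) {e : ℝ → ℝ}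
    (he : ContinuousOn e UI) (hK : ∀ x ∈ UI, kerFun G e x = lam * e x)
    (hn : ∫ x in (0 : ℝ)..1, e x * e x = 1)
    (hmax : ∫ x in (0 : ℝ)..1, kerFun G (fun y => |e y|) x * |e x| ≤ lam) :
    ∃ s : ℝ, s * s = 1 ∧ ∀ x ∈ UI, 0 < s * e x := by
  have hec := memLp_of_continuousOn he 2
  have hac := memLp_of_continuousOn he.abs 2
  have hGx : ∀ x ∈ UI, ContinuousOn (G x) UI := fun x hx => continuousOn_kernel_right hG hx
  have hKle : ∀ x ∈ UI, |kerFun G e x| ≤ kerFun G (fun y => |e y|) x := fun x hx => by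
    refine (intervalIntegral.abs_integral_le_integral_abs zero_le_one).trans_eq ?_
    refine integral_congr_UI fun y hy => ?_
    rw [abs_mul, abs_of_pos (hpos x hx y hy)]
  -- Since the kernel is positive, passing from e to |e| cannot lower the quadratic form. `hmax`
  -- says it is already maximal, so the pointwise inequality is an equality.
  have h1 : ∀ x ∈ UI, kerFun G (fun y => |e y|) x * |e x| - lam * (e x * e x) = 0 := by
    have hc1 : ContinuousOn (fun x => kerFun G (fun y => |e y|) x * |e x|) UI :=
      (continuousOn_kerFun hG hac).mul he.abs
    have hc2 : ContinuousOn (fun x => lam * (e x * e x)) UI := continuousOn_const.mul (he.mul he)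
    have hnn : ∀ x ∈ UI, 0 ≤ kerFun G (fun y => |e y|) x * |e x| - lam * (e x * e x) := by
      intro x hx
      have := mul_le_mul_of_nonneg_right (hKle x hx) (abs_nonneg (e x))
      rw [hK x hx, ← abs_mul, mul_assoc, abs_of_nonneg (mul_nonneg hl.le (mul_self_nonneg _))] at this
      linarith
    refine eqOn_zero_of_integral_eq_zero (hc1.sub hc2) hnn (le_antisymm ?_
      (intervalIntegral.integral_nonneg zero_le_one hnn))
    rw [intervalIntegral.integral_sub
      (ContinuousOn_intervalIntegrable_UI hc1 zero_mem_UI one_mem_UI)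
      (ContinuousOn_intervalIntegrable_UI hc2 zero_mem_UI one_mem_UI),
      intervalIntegral.integral_const_mul, hn]
    linarith
  obtain ⟨x₀, hx₀, hne⟩ : ∃ x ∈ UI, e x ≠ 0 := by
    by_contra! h0
    rw [integral_congr_UI (g := fun _ => 0) fun x hx => by rw [h0 x hx, mul_zero]] at hn
    simp at hn
  obtain ⟨s, hs, hse⟩ : ∃ s : ℝ, s * s = 1 ∧ |e x₀| = s * e x₀ := by
    rcases le_total 0 (e x₀) with h | h
    · exact ⟨1, by norm_num, by rw [abs_of_nonneg h, one_mul]⟩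
    · exact ⟨-1, by norm_num, by rw [abs_of_nonpos h, neg_one_mul]⟩
  have hsle : ∀ y, s * e y ≤ |e y| := fun y => by
    have : |s| = 1 := by
      rw [← sq_eq_sq₀ (abs_nonneg _) zero_le_one, sq_abs, one_pow, sq, hs]
    calc s * e y ≤ |s * e y| := le_abs_self _
      _ = |e y| := by rw [abs_mul, this, one_mul]
  -- At a point x₀ with e(x₀) ≠ 0, equality in the triangle inequality for ∫ G(x₀,y)e(y) dy forces a
  -- constant sign, because G(x₀,·) > 0.
  have h2 : ∀ y ∈ UI, |e y| = s * e y := by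
    have hint : ∫ y in (0 : ℝ)..1, G x₀ y * (|e y| - s * e y) = 0 := by
      have e1 : ∫ y in (0 : ℝ)..1, G x₀ y * (|e y| - s * e y)
          = kerFun G (fun y => |e y|) x₀ - s * kerFun G e x₀ := by
        rw [kerFun, kerFun, ← intervalIntegral.integral_const_mul, ← intervalIntegral.integral_sub]
        · exact intervalIntegral.integral_congr fun y _ => by ring
        · exact ContinuousOn_intervalIntegrable_UI ((hGx x₀ hx₀).mul he.abs) zero_mem_UI one_mem_UI
        · exact ContinuousOn_intervalIntegrable_UI
            (continuousOn_const.mul ((hGx x₀ hx₀).mul he)) zero_mem_UI one_mem_UI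
      have e2 := h1 x₀ hx₀
      have hne' : |e x₀| ≠ 0 := abs_ne_zero.2 hne
      have e3 : (kerFun G (fun y => |e y|) x₀ - lam * |e x₀|) * |e x₀| = 0 := by
        rw [← e2, sub_mul, mul_assoc lam, abs_mul_abs_self]
      have e4 := (mul_eq_zero.1 e3).resolve_right hne'
      rw [e1, hK x₀ hx₀]
      linear_combination e4 + lam * hse
    intro y hy
    have := eqOn_zero_of_integral_eq_zero ((hGx x₀ hx₀).mul (he.abs.sub (continuousOn_const.mul he)))
      (fun y hy => mul_nonneg (hpos x₀ hx₀ y hy).le (sub_nonneg.2 (hsle y))) hint y hy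
    exact sub_eq_zero.1 ((mul_eq_zero.1 this).resolve_left (hpos x₀ hx₀ y hy).ne')
  refine ⟨s, hs, fun x hx => ?_⟩
  -- Strict positivity: s·e is 1/lam times the transform of |e|, and |e| is not identically zero.
  have h3 : lam * (s * e x) = ∫ y in (0 : ℝ)..1, G x y * |e y| := by
    rw [mul_left_comm, ← hK x hx, kerFun, ← intervalIntegral.integral_const_mul]
    exact integral_congr_UI fun y hy => by rw [h2 y hy]; ring
  have hnn : ∀ y ∈ UI, 0 ≤ G x y * |e y| := fun y hy => mul_nonneg (hpos x hx y hy).le (abs_nonneg _)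
  have h4 : 0 ≤ ∫ y in (0 : ℝ)..1, G x y * |e y| := intervalIntegral.integral_nonneg zero_le_one hnn
  rcases h4.eq_or_lt with h5 | h5
  · have := eqOn_zero_of_integral_eq_zero ((hGx x hx).mul he.abs) hnn h5.symm x₀ hx₀
    exact absurd ((mul_eq_zero.1 this).resolve_left (hpos x hx x₀ hx₀).ne') (abs_ne_zero.2 hne)
  · rw [← h3] at h5
    exact pos_of_mul_pos_right h5 hl.le

/-- The spectral theorem for the compact symmetric Green operator T gives a complete orthonormal
system, and the μ_n are the inverses of the eigenvalues of T. The ground state belongs to the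
largest eigenvalue of T, which the variational characterisation and the positivity of the kernel
make of constant sign. -/
theorem exists_eigensystem {V : ℝ → ℝ} (hV : ContinuousOn V UI) (hpos : ∀ x ∈ UI, 0 < V x) :
    ∃ μ e, IsNeumannEigensystem V μ e := by
  classical
  obtain ⟨φ, φ', ψ, ψ', w, hgp⟩ := exists_greenPair hV hpos
  have hG := hgp.continuousOn_green
  obtain ⟨T, hT⟩ := exists_kernel_operator hG
  have hTc := kernel_operator_isCompact hG hT
  have hTs := kernel_operator_symm hG (green_symm φ ψ w) hT
  have hTs' : ∀ f g : L2UI, ⟪T f, g⟫ = ⟪f, T g⟫ := hTs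
  have hinj : ∀ g : L2UI, T g = 0 → g = 0 := by
    intro g hg
    have h1 : kerFun (green φ ψ w) g =ᵐ[volUI] fun _ => 0 := by
      have := hT g
      rw [hg] at this
      exact this.symm.trans (Lp.coeFn_zero ℝ 2 volUI)
    have h2 := eqOn_of_ae_eq (continuousOn_kerFun hG (Lp.memLp g)) continuousOn_const h1
    have h3 := hgp.ae_eq_zero (MemLp_intervalIntegrable (Lp.memLp g)) h2
    exact Lp.ext (h3.trans (Lp.coeFn_zero ℝ 2 volUI).symm)
  have hfd : ∀ l : ℝ, FiniteDimensional ℝ (Module.End.eigenspace (T : L2UI →ₗ[ℝ] L2UI) l) := by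
    intro l
    by_cases hl : l = 0
    · have : Module.End.eigenspace (T : L2UI →ₗ[ℝ] L2UI) l = ⊥ := by
        rw [eq_bot_iff]
        intro g hg
        rw [Module.End.mem_eigenspace_iff, hl, zero_smul] at hg
        exact hinj g hg
      rw [this]; infer_instance
    · exact ContinuousLinearMap.finite_dimensional_eigenspace hTc l hl
  -- Pairs of a real number and an index in an orthonormal basis of its eigenspace; numbers that are
  -- not eigenvalues contribute the empty `Fin 0`. Finite dimension at l = 0 comes from injectivity,
  -- elsewhere from compactness.
  let ι := Σ l : ℝ, Fin (Module.finrank ℝ (Module.End.eigenspace (T : L2UI →ₗ[ℝ] L2UI) l))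
  let v : ι → L2UI := fun a => (stdOrthonormalBasis ℝ _ a.2 :
    Module.End.eigenspace (T : L2UI →ₗ[ℝ] L2UI) a.1)
  have hv : Orthonormal ℝ v := by
    have := (LinearMap.IsSymmetric.orthogonalFamily_eigenspaces hTs).orthonormal_sigma_orthonormal
      (v_family := fun l => stdOrthonormalBasis ℝ (Module.End.eigenspace (T : L2UI →ₗ[ℝ] L2UI) l))
      fun l => (stdOrthonormalBasis ℝ _).orthonormal
    exact this
  have hTv : ∀ a, T (v a) = a.1 • v a := fun a =>
    Module.End.mem_eigenspace_iff.1 (stdOrthonormalBasis ℝ _ a.2 :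
      Module.End.eigenspace (T : L2UI →ₗ[ℝ] L2UI) a.1).2
  have hcomp : ∀ g : L2UI, (∀ a, ⟪g, v a⟫ = 0) → g = 0 := by
    intro g hg
    have h1 : g ∈ (⨆ l, Module.End.eigenspace (T : L2UI →ₗ[ℝ] L2UI) l)ᗮ := by
      rw [← Submodule.iInf_orthogonal, Submodule.mem_iInf]
      intro l
      rw [Submodule.mem_orthogonal']
      intro u hu
      have h2 := (stdOrthonormalBasis ℝ (Module.End.eigenspace (T : L2UI →ₗ[ℝ] L2UI) l)).sum_repr
        ⟨u, hu⟩
      have h3 := congrArg (Submodule.subtype _) h2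
      rw [map_sum] at h3
      simp only [map_smul, Submodule.subtype_apply] at h3
      rw [← h3, inner_sum]
      refine Finset.sum_eq_zero fun i _ => ?_
      rw [inner_smul_right]
      exact mul_eq_zero_of_right _ (hg ⟨l, i⟩)
    rw [ContinuousLinearMap.orthogonalComplement_iSup_eigenspaces_eq_bot hTc hTs] at h1
    exact h1
  have hl0 : ∀ a : ι, a.1 ≠ 0 := fun a ha => by
    have h1 := hTv a
    rw [ha, zero_smul] at h1
    exact hv.ne_zero a (hinj _ h1)
  -- Applying T and dividing by the eigenvalue selects the continuous representative of the
  -- eigenvector.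
  let e : ι → ℝ → ℝ := fun a x => a.1⁻¹ * kerFun (green φ ψ w) (v a) x
  have hec : ∀ a, ContinuousOn (e a) UI := fun a =>
    continuousOn_const.mul (continuousOn_kerFun hG (Lp.memLp _))
  have hve : ∀ a, v a =ᵐ[volUI] e a := fun a => by
    have h1 := hT (v a)
    rw [hTv a] at h1
    filter_upwards [h1, Lp.coeFn_smul a.1 (v a)] with x hx hx'
    rw [hx', Pi.smul_apply, smul_eq_mul] at hx
    simp only [e]
    rw [← hx]
    have := hl0 a
    field_simp
  have hK : ∀ a, ∀ x ∈ UI, kerFun (green φ ψ w) (e a) x = a.1 * e a x := fun a x _ => by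
    rw [← kerFun_congr_ae (hve a)]
    have := hl0 a
    simp only [e]
    field_simp
  have hmode : ∀ a, IsNeumannMode V a.1⁻¹ (e a) := fun a =>
    hgp.isNeumannMode hV (hl0 a) (hec a) (hK a)
  have hinner : ∀ (g : L2UI) a, ⟪g, v a⟫ = ∫ x in (0 : ℝ)..1, g x * e a x := fun g a => by
    rw [inner_L2UI_eq]
    exact integral_congr_ae_UI ((hve a).mono fun x hx => by simp only [hx])
  have ho : ∀ a b, (∫ x in (0 : ℝ)..1, e a x * e b x) = if a = b then 1 else 0 := fun a b => by
    rw [← orthonormal_iff_ite.1 hv a b, hinner]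
    exact integral_congr_ae_UI ((hve a).mono fun x hx => by simp only [hx])
  have hlpos : ∀ a : ι, 0 < a.1 := fun a => inv_pos.1 (eigenvalue_pos hmode hV hpos ho a)
  have hInf : Infinite ι := infinite_of_complete hec fun f hf =>
    hcomp f fun a => by rw [hinner]; exact hf a
  -- The series ∑ 1/(1+μ_a) converges, so only finitely many of its terms are at least 1/(1 + max M
  -- 0); the maximum with 0 keeps that threshold positive.
  have hfin : ∀ M : ℝ, {a : ι | a.1⁻¹ ≤ M}.Finite := by
    intro M
    have hs := summable_inv hmode hV hpos ho
    have h1 := hs.tendsto_cofinite_zero.eventually_lt_const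
      (u := 1 / (1 + max M 0)) (by positivity)
    rw [Filter.eventually_cofinite] at h1
    refine h1.subset fun a ha => ?_
    have ha : a.1⁻¹ ≤ M := ha
    have hp : 0 < a.1⁻¹ := inv_pos.2 (hlpos a)
    simp only [mem_ofPred_eq, not_lt]
    exact one_div_le_one_div_of_le (by linarith) (by linarith [le_max_left M 0])
  obtain ⟨σ, hσ⟩ := exists_monotone_enumeration (fun a : ι => a.1⁻¹) hfin
  have hspan : (Submodule.span ℝ (Set.range v))ᗮ = ⊥ := by
    rw [eq_bot_iff]
    intro g hg
    refine hcomp g fun a => ?_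
    exact (Submodule.mem_orthogonal' _ _).1 hg _ (Submodule.subset_span ⟨a, rfl⟩)
  let b := HilbertBasis.mkOfOrthogonalEqBot hv hspan
  have hb : ∀ a, b a = v a := fun a =>
    congrFun (HilbertBasis.coe_mkOfOrthogonalEqBot hv hspan) a
  -- Parseval in the eigenbasis. The ordering by increasing inverses puts the largest eigenvalue of
  -- T at σ 0.
  have hquad : ∀ g : L2UI, ⟪T g, g⟫ ≤ (σ 0).1 * ⟪g, g⟫ := by
    intro g
    refine hasSum_le (fun a => ?_) (b.hasSum_inner_mul_inner (T g) g)
      ((b.hasSum_inner_mul_inner g g).mul_left (σ 0).1)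
    rw [hb, hTs', hTv, inner_smul_right, real_inner_comm g (v a), mul_assoc]
    refine mul_le_mul_of_nonneg_right ?_ (mul_self_nonneg _)
    have h1 := hσ (Nat.zero_le (σ.symm a))
    simp only [Function.comp_apply, Equiv.apply_symm_apply] at h1
    exact (inv_le_inv₀ (hlpos _) (hlpos _)).1 h1
  have hmax : ∫ x in (0 : ℝ)..1, kerFun (green φ ψ w) (fun y => |e (σ 0) y|) x * |e (σ 0) x|
      ≤ (σ 0).1 := by
    have hm := memLp_of_continuousOn (hec (σ 0)).abs 2
    have h1 := hquad (hm.toLp _)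
    rw [inner_toLp, inner_L2UI_eq] at h1
    have h2 : ∫ x in (0 : ℝ)..1, |e (σ 0) x| * |e (σ 0) x| = 1 := by
      simp only [abs_mul_abs_self]
      rw [ho, if_pos rfl]
    rw [h2, mul_one] at h1
    refine le_trans (le_of_eq ?_) h1
    refine integral_congr_ae_UI ?_
    filter_upwards [hT (hm.toLp _), hm.coeFn_toLp] with x hx hx'
    rw [hx, hx', kerFun_congr_ae hm.coeFn_toLp]
  obtain ⟨s, hs, hse⟩ := sign_of_ground_state hG (fun x hx y hy => hgp.green_pos hx hy) (hlpos (σ 0))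
    (hec (σ 0)) (hK (σ 0)) (by rw [ho, if_pos rfl]) hmax
  -- Only the ground state may need a change of sign.
  let ε : ℕ → ℝ := fun n => if n = 0 then s else 1
  have hε : ∀ n, ε n * ε n = 1 := fun n => by
    by_cases hn : n = 0
    · simp [ε, hn, hs]
    · simp [ε, hn]
  have hm' : ∀ n, IsNeumannMode V (σ n).1⁻¹ fun x => ε n * e (σ n) x := fun n =>
    (hmode (σ n)).const_mul hV _
  refine ⟨fun n => (σ n).1⁻¹, fun n x => ε n * e (σ n) x, hσ, fun n => (hm' n).contDiff,
    fun n x hx => ?_, fun n => (hm' n).neumann_zero, fun n => (hm' n).neumann_one, fun m n => ?_,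
    fun f hf => ?_, fun x hx => ?_⟩
  · rw [(hm' n).eigen x hx]; ring
  · have h1 : ∀ x, ε m * e (σ m) x * (ε n * e (σ n) x) = ε m * ε n * (e (σ m) x * e (σ n) x) :=
      fun x => by ring
    simp only [h1]
    rw [intervalIntegral.integral_const_mul, ho]
    by_cases hmn : m = n
    · subst hmn; simp [hε]
    · simp [hmn]
  · refine hcomp f fun a => ?_
    have h1 := hf (σ.symm a)
    rw [hinner]
    simp only [Equiv.apply_symm_apply] at h1
    have h2 : ∀ x, f x * (ε (σ.symm a) * e a x) = ε (σ.symm a) * (f x * e a x) := fun x => by ring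
    simp only [h2] at h1
    rw [intervalIntegral.integral_const_mul] at h1
    refine (mul_eq_zero.1 h1).resolve_left fun h0 => ?_
    have := hε (σ.symm a)
    rw [h0] at this
    simp at this
  · simpa [ε] using hse x hx

/-! ### Eigenfunction series -/

/-- The series `∑ bₙ gₙ(x)`. -/
def modeSum (g : ℕ → ℝ → ℝ) (b : ℕ → ℝ) (x : ℝ) : ℝ := ∑' n, b n * g n x

section ModeSum

variable {V : ℝ → ℝ} {μ : ℕ → ℝ} {e : ℕ → ℝ → ℝ}

/-- One constant for the potential, the modes and their derivatives. The weight 1 + μ_n is cruder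
than the square root available for e_n, but it also covers e_n', so both kinds of series are treated
alike. -/
lemma IsNeumannEigensystem.exists_bound (h : IsNeumannEigensystem V μ e)
    (hV : ContinuousOn V UI) (hpos : ∀ x ∈ UI, 0 < V x) :
    ∃ K, 0 ≤ K ∧ (∀ x ∈ UI, |V x| ≤ K) ∧ ∀ n, ∀ x ∈ UI,
      |e n x| ≤ K * (1 + μ n) ∧ |dx (e n) x| ≤ K * (1 + μ n) := by
  have hμ := h.mu_pos hV hpos
  obtain ⟨M, hM⟩ := isCompact_Icc.exists_bound_of_continuousOn hV
  have hM0 : 0 ≤ M := (norm_nonneg _).trans (hM 0 zero_mem_UI)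
  refine ⟨M + 2, by linarith, fun x hx => (hM x hx).trans (by linarith), fun n x hx => ⟨?_, ?_⟩⟩
  · refine (abs_mode_le h.mode hV hpos h.orthonormal isSobolevConstant_sqrt_two n hx).trans ?_
    have h1 : Real.sqrt 2 ≤ M + 2 := by
      have : Real.sqrt 2 ≤ 2 := Real.sqrt_le_iff.2 (by norm_num)
      linarith
    refine mul_le_mul h1 ?_ (Real.sqrt_nonneg _) (by linarith)
    refine Real.sqrt_le_iff.2 ⟨by linarith [hμ n], ?_⟩
    nlinarith [hμ n]
  · refine ((h.mode n).abs_dx_le hV hM (hμ n).le (by rw [h.orthonormal, if_pos rfl]) hx).trans ?_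
    nlinarith [hμ n]

variable {b : ℕ → ℝ}

lemma summable_modeSum_bound {K : ℝ} (hb : Summable fun n => |b n| * (1 + μ n)) :
    Summable fun n => |b n| * (K * (1 + μ n)) :=
  (hb.mul_left K).congr fun n => by ring

lemma abs_mul_mode_le {K : ℝ} {g : ℕ → ℝ → ℝ} (hg : ∀ n, ∀ x ∈ UI, |g n x| ≤ K * (1 + μ n)) :
    ∀ n, ∀ x ∈ UI, |b n * g n x| ≤ |b n| * (K * (1 + μ n)) := fun n x hx => by
  rw [abs_mul]; exact mul_le_mul_of_nonneg_left (hg n x hx) (abs_nonneg _)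

lemma IsNeumannEigensystem.hasSum_modeSum (h : IsNeumannEigensystem V μ e)
    (hV : ContinuousOn V UI) (hpos : ∀ x ∈ UI, 0 < V x)
    (hb : Summable fun n => |b n| * (1 + μ n)) {x : ℝ} (hx : x ∈ UI) :
    HasSum (fun n => b n * e n x) (modeSum e b x) := by
  obtain ⟨K, -, -, hK⟩ := h.exists_bound hV hpos
  exact (Summable.of_norm_bounded (summable_modeSum_bound hb) fun n =>
    abs_mul_mode_le (fun n x hx => (hK n x hx).1) n x hx).hasSum

lemma IsNeumannEigensystem.hasSum_modeSum_dx (h : IsNeumannEigensystem V μ e)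
    (hV : ContinuousOn V UI) (hpos : ∀ x ∈ UI, 0 < V x)
    (hb : Summable fun n => |b n| * (1 + μ n)) {x : ℝ} (hx : x ∈ UI) :
    HasSum (fun n => b n * dx (e n) x) (modeSum (fun n => dx (e n)) b x) := by
  obtain ⟨K, -, -, hK⟩ := h.exists_bound hV hpos
  exact (Summable.of_norm_bounded (summable_modeSum_bound hb) fun n =>
    abs_mul_mode_le (g := fun n => dx (e n)) (fun n x hx => (hK n x hx).2) n x hx).hasSum

lemma IsNeumannEigensystem.hasDeriv_modeSum (h : IsNeumannEigensystem V μ e)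
    (hV : ContinuousOn V UI) (hpos : ∀ x ∈ UI, 0 < V x)
    (hb : Summable fun n => |b n| * (1 + μ n)) {x : ℝ} (hx : x ∈ UI) :
    HasDerivWithinAt (modeSum e b) (modeSum (fun n => dx (e n)) b x) UI x := by
  obtain ⟨K, -, -, hK⟩ := h.exists_bound hV hpos
  have hs := summable_modeSum_bound (K := K) hb
  exact hasDerivWithinAt_tsum_UI (fun n x hx => ((h.mode n).hasDeriv x hx).const_mul (b n))
    (fun n => continuousOn_const.mul (h.mode n).continuousOn_dx)
    (abs_mul_mode_le (fun n x hx => (hK n x hx).1)) hs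
    (abs_mul_mode_le (g := fun n => dx (e n)) (fun n x hx => (hK n x hx).2)) hs hx

lemma IsNeumannEigensystem.continuousOn_modeSum (h : IsNeumannEigensystem V μ e)
    (hV : ContinuousOn V UI) (hpos : ∀ x ∈ UI, 0 < V x)
    (hb : Summable fun n => |b n| * (1 + μ n)) : ContinuousOn (modeSum e b) UI :=
  fun _ hx => (h.hasDeriv_modeSum hV hpos hb hx).continuousWithinAt

lemma IsNeumannEigensystem.continuousOn_modeSum_dx (h : IsNeumannEigensystem V μ e)
    (hV : ContinuousOn V UI) (hpos : ∀ x ∈ UI, 0 < V x)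
    (hb : Summable fun n => |b n| * (1 + μ n)) :
    ContinuousOn (modeSum (fun n => dx (e n)) b) UI := by
  obtain ⟨K, -, -, hK⟩ := h.exists_bound hV hpos
  exact continuousOn_tsum_UI (fun n => continuousOn_const.mul (h.mode n).continuousOn_dx)
    (abs_mul_mode_le (g := fun n => dx (e n)) (fun n x hx => (hK n x hx).2))
    (summable_modeSum_bound hb)

lemma summable_of_summable_sq (hμ : ∀ n, 0 < μ n) (hb : Summable fun n => |b n| * (1 + μ n) ^ 2) :
    Summable fun n => |b n| * (1 + μ n) :=
  Summable.of_nonneg_of_le (fun n => mul_nonneg (abs_nonneg _) (by linarith [hμ n]))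
    (fun n => mul_le_mul_of_nonneg_left (by nlinarith [hμ n]) (abs_nonneg _)) hb

lemma summable_mul_mu (hμ : ∀ n, 0 < μ n) (hb : Summable fun n => |b n| * (1 + μ n) ^ 2) :
    Summable fun n => |b n * -μ n| * (1 + μ n) :=
  Summable.of_nonneg_of_le (fun n => mul_nonneg (abs_nonneg _) (by linarith [hμ n]))
    (fun n => by
      rw [abs_mul, abs_neg, abs_of_pos (hμ n), mul_assoc]
      exact mul_le_mul_of_nonneg_left (by nlinarith [hμ n]) (abs_nonneg _)) hb

/-- The eigenvalue equation replaces e_n'' by (V-μ_n)e_n; the factor -μ_n is moved into the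
coefficients, where for heat series it becomes a time derivative. -/
lemma IsNeumannEigensystem.hasDeriv_modeSum_dx (h : IsNeumannEigensystem V μ e)
    (hV : ContinuousOn V UI) (hpos : ∀ x ∈ UI, 0 < V x)
    (hb : Summable fun n => |b n| * (1 + μ n) ^ 2) {x : ℝ} (hx : x ∈ UI) :
    HasDerivWithinAt (modeSum (fun n => dx (e n)) b)
      (V x * modeSum e b x + modeSum e (fun n => b n * -μ n) x) UI x := by
  obtain ⟨K, hK0, hVK, hK⟩ := h.exists_bound hV hpos
  have hμ := h.mu_pos hV hpos
  have hb1 := summable_of_summable_sq hμ hb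
  have hs := summable_modeSum_bound (K := K) hb1
  have hd := hasDerivWithinAt_tsum_UI (f := fun n x => b n * dx (e n) x)
    (f' := fun n x => b n * ((V x - μ n) * e n x))
    (b' := fun n => (K + 1) * K * (|b n| * (1 + μ n) ^ 2))
    (fun n x hx => ((h.mode n).hasDeriv_dx x hx).const_mul (b n))
    (fun n => continuousOn_const.mul ((hV.sub continuousOn_const).mul (h.mode n).continuousOn))
    (abs_mul_mode_le (g := fun n => dx (e n)) (fun n x hx => (hK n x hx).2)) hs
    (fun n x hx => by
      rw [abs_mul, abs_mul]
      have h1 : |V x - μ n| ≤ (K + 1) * (1 + μ n) := by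
        refine (abs_sub (V x) (μ n)).trans ?_
        rw [abs_of_pos (hμ n)]
        nlinarith [hVK x hx, hμ n]
      calc _ ≤ |b n| * ((K + 1) * (1 + μ n) * (K * (1 + μ n))) :=
            mul_le_mul_of_nonneg_left (mul_le_mul h1 (hK n x hx).1 (abs_nonneg _)
              (mul_nonneg (by linarith) (by linarith [hμ n]))) (abs_nonneg _)
        _ = _ := by ring) (hb.mul_left _) hx
  have e1 : ∑' n, b n * ((V x - μ n) * e n x)
      = V x * modeSum e b x + modeSum e (fun n => b n * -μ n) x := by
    have s1 := (h.hasSum_modeSum hV hpos hb1 hx).mul_left (V x)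
    have s2 := h.hasSum_modeSum hV hpos (summable_mul_mu hμ hb) hx
    rw [← (s1.add s2).tsum_eq]
    exact tsum_congr fun n => by ring
  rw [e1] at hd
  exact hd

/-- Uniform absolute convergence permits integrating term by term against e_m. -/
lemma IsNeumannEigensystem.coeff_modeSum (h : IsNeumannEigensystem V μ e)
    (hV : ContinuousOn V UI) (hpos : ∀ x ∈ UI, 0 < V x)
    (hb : Summable fun n => |b n| * (1 + μ n)) (m : ℕ) : coeff e m (modeSum e b) = b m := by
  obtain ⟨K, -, -, hK⟩ := h.exists_bound hV hpos
  obtain ⟨B, hB⟩ := isCompact_Icc.exists_bound_of_continuousOn (h.mode m).continuousOn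
  have h1 := hasSum_integral_UI (f := fun n x => e m x * (b n * e n x))
    (b := fun n => B * (|b n| * (K * (1 + μ n))))
    (fun n => (h.mode m).continuousOn.mul (continuousOn_const.mul (h.mode n).continuousOn))
    (fun n x hx => by
      rw [abs_mul]
      exact mul_le_mul (hB x hx) (abs_mul_mode_le (fun n x hx => (hK n x hx).1) n x hx)
        (abs_nonneg _) ((norm_nonneg _).trans (hB x hx)))
    ((summable_modeSum_bound hb).mul_left B) one_mem_UI
  have h2 : ∀ n, ∫ x in (0 : ℝ)..1, e m x * (b n * e n x) = if n = m then b m else 0 := fun n => by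
    have : ∀ x, e m x * (b n * e n x) = b n * (e m x * e n x) := fun x => by ring
    simp only [this]
    rw [intervalIntegral.integral_const_mul, h.orthonormal]
    by_cases hmn : m = n
    · simp [hmn]
    · simp [hmn, Ne.symm hmn]
  simp only [h2] at h1
  have h3 := h1.unique (hasSum_ite_eq m (b m))
  rw [← h3, coeff]
  exact intervalIntegral.integral_congr fun x _ => by simp only [modeSum, tsum_mul_left]

/-! ### Heat series -/

/-- Coefficients of the `k`-th time derivative of `∑ cₙ e^{-μₙ t} eₙ`. -/
def heatCoef (μ c : ℕ → ℝ) (k : ℕ) (t : ℝ) (n : ℕ) : ℝ := c n * (-μ n) ^ k * Real.exp (-μ n * t)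

variable {c : ℕ → ℝ} {B : ℝ}

/-- The heat equation at the level of coefficients: multiplication by -μ_n raises the order of the
time derivative. -/
lemma heatCoef_succ (k : ℕ) (t : ℝ) :
    (fun n => heatCoef μ c k t n * -μ n) = heatCoef μ c (k + 1) t := by
  ext n; simp only [heatCoef]; ring

lemma abs_heatCoef_le (hμ : ∀ n, 0 < μ n) (hc : ∀ n, |c n| ≤ B) (k : ℕ) {s t : ℝ} (hst : s ≤ t)
    (n : ℕ) : |heatCoef μ c k t n| ≤ B * ((1 + μ n) ^ k * Real.exp (-μ n * s)) := by
  have := hμ n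
  rw [heatCoef, abs_mul, abs_mul, abs_pow, abs_neg, abs_of_pos this, Real.abs_exp, mul_assoc]
  have hB : 0 ≤ B := (abs_nonneg _).trans (hc n)
  refine mul_le_mul (hc n) (mul_le_mul ?_ (Real.exp_le_exp.2 (by nlinarith)) (Real.exp_pos _).le
    (by positivity)) (by positivity) hB
  exact pow_le_pow_left₀ this.le (by linarith) k

lemma IsNeumannEigensystem.summable_heat (h : IsNeumannEigensystem V μ e)
    (hV : ContinuousOn V UI) (hpos : ∀ x ∈ UI, 0 < V x) (hc : ∀ n, |c n| ≤ B) (k j : ℕ) {t : ℝ}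
    (ht : 0 < t) : Summable fun n => |heatCoef μ c k t n| * (1 + μ n) ^ j := by
  have hμ := h.mu_pos hV hpos
  have hp : ∀ n, 0 < 1 + μ n := fun n => by linarith [hμ n]
  refine Summable.of_nonneg_of_le (fun n => mul_nonneg (abs_nonneg _) (pow_nonneg (hp n).le _))
    (fun n => mul_le_mul_of_nonneg_right (abs_heatCoef_le hμ hc k le_rfl n)
      (pow_nonneg (hp n).le _)) ?_
  refine ((h.summable_pow_mul_exp hV hpos ht (k + j)).mul_left B).congr fun n => ?_
  rw [pow_add]; ring

lemma IsNeumannEigensystem.summable_heat_one (h : IsNeumannEigensystem V μ e)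
    (hV : ContinuousOn V UI) (hpos : ∀ x ∈ UI, 0 < V x) (hc : ∀ n, |c n| ≤ B) (k : ℕ) {t : ℝ}
    (ht : 0 < t) : Summable fun n => |heatCoef μ c k t n| * (1 + μ n) := by
  simpa using h.summable_heat hV hpos hc k 1 ht

lemma abs_heat_term_le (hμ : ∀ n, 0 < μ n) (hc : ∀ n, |c n| ≤ B) {g : ℕ → ℝ → ℝ} {K : ℝ}
    (hg : ∀ n, ∀ x ∈ UI, |g n x| ≤ K * (1 + μ n)) (k : ℕ) {s t : ℝ} (hst : s ≤ t) (n : ℕ)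
    {x : ℝ} (hx : x ∈ UI) : |heatCoef μ c k t n * g n x|
      ≤ B * K * ((1 + μ n) ^ (k + 1) * Real.exp (-μ n * s)) := by
  have := hμ n
  have hB : 0 ≤ B := (abs_nonneg _).trans (hc n)
  rw [abs_mul]
  calc _ ≤ B * ((1 + μ n) ^ k * Real.exp (-μ n * s)) * (K * (1 + μ n)) :=
        mul_le_mul (abs_heatCoef_le hμ hc k hst n) (hg n x hx) (abs_nonneg _) (by positivity)
    _ = _ := by ring

/-- The family g is left free because the lemma is applied both to the modes and to their
derivatives. The series are dominated for times above t/2. -/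
lemma IsNeumannEigensystem.hasDerivAt_heat (h : IsNeumannEigensystem V μ e)
    (hV : ContinuousOn V UI) (hpos : ∀ x ∈ UI, 0 < V x) (hc : ∀ n, |c n| ≤ B) {g : ℕ → ℝ → ℝ}
    {K : ℝ} (hg : ∀ n, ∀ x ∈ UI, |g n x| ≤ K * (1 + μ n)) (k : ℕ) {t : ℝ} (ht : 0 < t) {x : ℝ}
    (hx : x ∈ UI) : HasDerivAt (fun s => modeSum g (heatCoef μ c k s) x)
      (modeSum g (heatCoef μ c (k + 1) t) x) t := by
  have hμ := h.mu_pos hV hpos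
  have hmem : t ∈ Ioi (t / 2) := half_lt_self ht
  refine hasDerivAt_tsum_of_isPreconnected
    ((h.summable_pow_mul_exp hV hpos (half_pos ht) (k + 1 + 1)).mul_left (B * K)) isOpen_Ioi
    isPreconnected_Ioi (g := fun n s => heatCoef μ c k s n * g n x)
    (g' := fun n s => heatCoef μ c (k + 1) s n * g n x) (fun n s _ => ?_)
    (fun n s hs => abs_heat_term_le hμ hc hg (k + 1) (le_of_lt hs) n hx) hmem ?_ hmem
  · have h1 : HasDerivAt (fun s => Real.exp (-μ n * s)) (Real.exp (-μ n * s) * -μ n) s := by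
      simpa using ((hasDerivAt_id s).const_mul (-μ n)).exp
    have h2 := (h1.const_mul (c n * (-μ n) ^ k)).mul_const (g n x)
    convert! h2 using 1
    simp only [heatCoef]; ring
  · exact Summable.of_norm_bounded ((h.summable_pow_mul_exp hV hpos ht (k + 1)).mul_left (B * K))
      fun n => abs_heat_term_le hμ hc hg k le_rfl n hx

lemma IsNeumannEigensystem.continuousOn_heat (h : IsNeumannEigensystem V μ e)
    (hV : ContinuousOn V UI) (hpos : ∀ x ∈ UI, 0 < V x) (hc : ∀ n, |c n| ≤ B) {g : ℕ → ℝ → ℝ}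
    {K : ℝ} (hg : ∀ n, ∀ x ∈ UI, |g n x| ≤ K * (1 + μ n)) (hgc : ∀ n, ContinuousOn (g n) UI)
    (k : ℕ) : ContinuousOn (fun p : ℝ × ℝ => modeSum g (heatCoef μ c k p.1) p.2)
      (Ioi 0 ×ˢ UI) := by
  have hμ := h.mu_pos hV hpos
  rintro ⟨t, x⟩ ⟨ht, hx⟩
  have ht : 0 < t := ht
  have h1 : ContinuousOn (fun p : ℝ × ℝ => modeSum g (heatCoef μ c k p.1) p.2)
      (Ioi (t / 2) ×ˢ UI) := by
    refine continuousOn_tsum (fun n => ?_)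
      ((h.summable_pow_mul_exp hV hpos (half_pos ht) (k + 1)).mul_left (B * K))
      fun n p hp => abs_heat_term_le hμ hc hg k (le_of_lt hp.1) n hp.2
    refine ContinuousOn.mul ?_ ((hgc n).comp continuousOn_snd fun p hp => hp.2)
    unfold heatCoef; fun_prop
  refine (h1 (t, x) ⟨half_lt_self ht, hx⟩).mono_of_mem_nhdsWithin ?_
  refine mem_nhdsWithin.2 ⟨Ioi (t / 2) ×ˢ univ, isOpen_Ioi.prod isOpen_univ,
    ⟨half_lt_self ht, mem_univ _⟩, fun p hp => ⟨hp.1.1, hp.2.2⟩⟩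

/-- The Cole-Hopf transform of a positive heat series is a classical solution of the Burgers
equation. -/
lemma IsNeumannEigensystem.burgers_of_heat (h : IsNeumannEigensystem V μ e)
    (hV : ContDiffOn ℝ 1 V UI) (hpos : ∀ x ∈ UI, 0 < V x) (hc : ∀ n, |c n| ≤ B)
    (hP : ∀ t, 0 < t → ∀ x ∈ UI, 0 < modeSum e (heatCoef μ c 0 t) x) {u₀ : L2UI}
    (hini : Tendsto (fun t => eLpNorm (fun x => -2 * (modeSum (fun n => dx (e n)) (heatCoef μ c 0 t) x
      / modeSum e (heatCoef μ c 0 t) x) - u₀ x) 2 volUI) (𝓝[>] 0) (𝓝 0)) :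
    IsBurgersSolution V u₀ fun t x => -2 * (modeSum (fun n => dx (e n)) (heatCoef μ c 0 t) x
      / modeSum e (heatCoef μ c 0 t) x) := by
  have hVc := hV.continuousOn
  obtain ⟨K, hK0, hVK, hK⟩ := h.exists_bound hVc hpos
  have hK1 : ∀ n, ∀ x ∈ UI, |e n x| ≤ K * (1 + μ n) := fun n x hx => (hK n x hx).1
  have hK2 : ∀ n, ∀ x ∈ UI, |dx (e n) x| ≤ K * (1 + μ n) := fun n x hx => (hK n x hx).2
  set P : ℕ → ℝ → ℝ → ℝ := fun k t x => modeSum e (heatCoef μ c k t) x with hPdef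
  set Q : ℕ → ℝ → ℝ → ℝ := fun k t x => modeSum (fun n => dx (e n)) (heatCoef μ c k t) x with hQdef
  have hPt : ∀ k t, 0 < t → ∀ x ∈ UI, HasDerivAt (fun s => P k s x) (P (k + 1) t x) t :=
    fun k t ht x hx => h.hasDerivAt_heat hVc hpos hc hK1 k ht hx
  have hQt : ∀ k t, 0 < t → ∀ x ∈ UI, HasDerivAt (fun s => Q k s x) (Q (k + 1) t x) t :=
    fun k t ht x hx => h.hasDerivAt_heat hVc hpos hc (g := fun n => dx (e n)) hK2 k ht hx
  have hPx : ∀ k t, 0 < t → ∀ x ∈ UI, HasDerivWithinAt (P k t) (Q k t x) UI x :=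
    fun k t ht x hx => h.hasDeriv_modeSum hVc hpos (h.summable_heat_one hVc hpos hc k ht) hx
  have hQx : ∀ k t, 0 < t → ∀ x ∈ UI,
      HasDerivWithinAt (Q k t) (V x * P k t x + P (k + 1) t x) UI x := fun k t ht x hx => by
    have := h.hasDeriv_modeSum_dx hVc hpos (h.summable_heat hVc hpos hc k 2 ht) hx
    rwa [heatCoef_succ] at this
  have hPc : ∀ k, ContinuousOn (fun p : ℝ × ℝ => P k p.1 p.2) (Ioi 0 ×ˢ UI) := fun k =>
    h.continuousOn_heat hVc hpos hc hK1 (fun n => (h.mode n).continuousOn) k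
  have hQc : ∀ k, ContinuousOn (fun p : ℝ × ℝ => Q k p.1 p.2) (Ioi 0 ×ˢ UI) := fun k =>
    h.continuousOn_heat hVc hpos hc (g := fun n => dx (e n)) hK2 (fun n => (h.mode n).continuousOn_dx) k
  have hPne : ∀ t, 0 < t → ∀ x ∈ UI, P 0 t x ≠ 0 := fun t ht x hx => (hP t ht x hx).ne'
  let u : ℝ → ℝ → ℝ := fun t x => -2 * (Q 0 t x / P 0 t x)
  let ut : ℝ → ℝ → ℝ := fun t x => -2 * ((Q 1 t x * P 0 t x - Q 0 t x * P 1 t x) / P 0 t x ^ 2)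
  -- The relation P_xx = VP + P_t eliminates the second space derivative of P. Differentiating once
  -- more then requires only V' and the mixed derivative Q 1, and the Burgers equation becomes an
  -- algebraic identity.
  let ux : ℝ → ℝ → ℝ := fun t x => -2 * V x - 2 * (P 1 t x / P 0 t x) + u t x ^ 2 / 2
  let uxx : ℝ → ℝ → ℝ := fun t x => -2 * dx V x
    - 2 * ((Q 1 t x * P 0 t x - P 1 t x * Q 0 t x) / P 0 t x ^ 2) + u t x * ux t x
  have hut : ∀ t, 0 < t → ∀ x ∈ UI, HasDerivAt (fun s => u s x) (ut t x) t := fun t ht x hx =>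
    ((hQt 0 t ht x hx).div (hPt 0 t ht x hx) (hPne t ht x hx)).const_mul (-2)
  have hux : ∀ t, 0 < t → ∀ x ∈ UI, HasDerivWithinAt (u t) (ux t x) UI x := fun t ht x hx => by
    have h1 := ((hQx 0 t ht x hx).div (hPx 0 t ht x hx) (hPne t ht x hx)).const_mul (-2)
    convert! h1 using 1
    have := hPne t ht x hx
    simp only [ux, u]
    field_simp
    ring
  have hVd : ∀ x ∈ UI, HasDerivWithinAt V (dx V x) UI x := fun x hx =>
    ContDiffOn_hasDerivWithinAt hV one_ne_zero hx
  have huxx : ∀ t, 0 < t → ∀ x ∈ UI, HasDerivWithinAt (ux t) (uxx t x) UI x := fun t ht x hx => by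
    have h1 := (((hVd x hx).const_mul (-2)).sub
      (((hPx 1 t ht x hx).div (hPx 0 t ht x hx) (hPne t ht x hx)).const_mul 2)).add
      (((hux t ht x hx).pow 2).div_const 2)
    convert! h1 using 1
    simp only [uxx]
    push_cast
    ring
  have huc : ContinuousOn (fun p : ℝ × ℝ => u p.1 p.2) (Ioi 0 ×ˢ UI) :=
    continuousOn_const.mul ((hQc 0).div (hPc 0) fun p hp => hPne p.1 hp.1 p.2 hp.2)
  have hP2 : ∀ p ∈ Ioi (0 : ℝ) ×ˢ UI, P 0 p.1 p.2 ^ 2 ≠ 0 := fun p hp =>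
    pow_ne_zero 2 (hPne p.1 hp.1 p.2 hp.2)
  have hutc : ContinuousOn (fun p : ℝ × ℝ => ut p.1 p.2) (Ioi 0 ×ˢ UI) :=
    continuousOn_const.mul ((((hQc 1).mul (hPc 0)).sub ((hQc 0).mul (hPc 1))).div ((hPc 0).pow 2) hP2)
  have hVc2 : ContinuousOn (fun p : ℝ × ℝ => V p.2) (Ioi 0 ×ˢ UI) :=
    hVc.comp continuousOn_snd fun p hp => hp.2
  have hV'c2 : ContinuousOn (fun p : ℝ × ℝ => dx V p.2) (Ioi 0 ×ˢ UI) :=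
    (contDiffOn_one_iff.1 hV).2.comp continuousOn_snd fun p hp => hp.2
  have huxc : ContinuousOn (fun p : ℝ × ℝ => ux p.1 p.2) (Ioi 0 ×ˢ UI) :=
    ((continuousOn_const.mul hVc2).sub (continuousOn_const.mul
      ((hPc 1).div (hPc 0) fun p hp => hPne p.1 hp.1 p.2 hp.2))).add ((huc.pow 2).div_const 2)
  have huxxc : ContinuousOn (fun p : ℝ × ℝ => uxx p.1 p.2) (Ioi 0 ×ˢ UI) :=
    ((continuousOn_const.mul hV'c2).sub (continuousOn_const.mul
      ((((hQc 1).mul (hPc 0)).sub ((hPc 1).mul (hQc 0))).div ((hPc 0).pow 2) hP2))).add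
      (huc.mul huxc)
  have hslice : ∀ {f : ℝ → ℝ → ℝ}, ContinuousOn (fun p : ℝ × ℝ => f p.1 p.2) (Ioi 0 ×ˢ UI) →
      ∀ t, 0 < t → ContinuousOn (f t) UI := fun hf t ht =>
    hf.comp (f := fun x => (t, x)) (by fun_prop) fun x hx => ⟨ht, hx⟩
  have hall := fun t ht => contDiffOn_two_of (hux t ht) (huxx t ht) (hslice huxxc t ht)
  refine ⟨fun t ht x hx => (hut t ht x hx).differentiableAt, fun t ht => (hall t ht).1, huc, ?_, ?_,
    ?_, fun t ht x hx => ?_, fun t ht => ?_, fun t ht => ?_, hini⟩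
  · exact hutc.congr fun p hp => (hut p.1 hp.1 p.2 hp.2).deriv
  · exact huxc.congr fun p hp => (hall p.1 hp.1).2.1 hp.2
  · exact huxxc.congr fun p hp => (hall p.1 hp.1).2.2 hp.2
  · have e1 : deriv (fun s => u s x) t = ut t x := (hut t ht x hx).deriv
    have e2 : dx (u t) x = ux t x := (hall t ht).2.1 hx
    have e3 : dx (dx (u t)) x = uxx t x := (hall t ht).2.2 hx
    change deriv (fun s => u s x) t + u t x * dx (u t) x = dx (dx (u t)) x + 2 * dx V x
    rw [e1, e2, e3]
    simp only [uxx, ut]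
    ring
  · have : Q 0 t 0 = 0 := by simp [hQdef, modeSum, h.neumann_zero]
    change -2 * (Q 0 t 0 / P 0 t 0) = 0
    rw [this, zero_div, mul_zero]
  · have : Q 0 t 1 = 0 := by simp [hQdef, modeSum, h.neumann_one]
    change -2 * (Q 0 t 1 / P 0 t 1) = 0
    rw [this, zero_div, mul_zero]

end ModeSum

/-! ### Expansion of `H¹` functions -/

/-- A continuous function as an element of `L²([0,1])`. -/
def toL2 (f : ℝ → ℝ) (hf : ContinuousOn f UI) : L2UI := (memLp_of_continuousOn hf 2).toLp f

lemma toL2_ae {f : ℝ → ℝ} (hf : ContinuousOn f UI) : toL2 f hf =ᵐ[volUI] f :=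
  (memLp_of_continuousOn hf 2).coeFn_toLp

lemma inner_toL2 {f : ℝ → ℝ} (hf : ContinuousOn f UI) (g : L2UI) :
    ⟪toL2 f hf, g⟫ = ∫ x in (0 : ℝ)..1, f x * g x := by
  rw [inner_L2UI_eq]
  exact integral_congr_ae_UI ((toL2_ae hf).mono fun x hx => by simp only [hx])

section Expansion

variable {V : ℝ → ℝ} {μ : ℕ → ℝ} {e : ℕ → ℝ → ℝ}

/-- Parseval's identity. -/
lemma IsNeumannEigensystem.hasSum_coeff_mul (h : IsNeumannEigensystem V μ e) {f g : ℝ → ℝ}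
    (hf : MemLp f 2 volUI) (hg : MemLp g 2 volUI) :
    HasSum (fun n => coeff e n f * coeff e n g) (∫ x in (0 : ℝ)..1, f x * g x) := by
  let v : ℕ → L2UI := fun n => (h.mode n).memLp.toLp (e n)
  have hv : Orthonormal ℝ v := by
    rw [orthonormal_iff_ite]
    intro i j
    rw [inner_toLp, h.orthonormal]
  have hspan : (Submodule.span ℝ (Set.range v))ᗮ = ⊥ := by
    rw [eq_bot_iff]
    intro k hk
    refine h.complete k fun n => ?_
    have h1 := (Submodule.mem_orthogonal' _ _).1 hk _ (Submodule.subset_span ⟨n, rfl⟩)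
    rw [inner_L2UI_eq] at h1
    refine Eq.trans ?_ h1
    exact integral_congr_ae_UI ((h.mode n).memLp.coeFn_toLp.mono fun x hx => by simp only [v, hx])
  have hb := (HilbertBasis.mkOfOrthogonalEqBot hv hspan).hasSum_inner_mul_inner (hf.toLp f)
    (hg.toLp g)
  rw [inner_toLp] at hb
  refine hb.congr_fun fun n => ?_
  rw [HilbertBasis.coe_mkOfOrthogonalEqBot, inner_toLp, inner_toLp, coeff, coeff]
  congr 1
  exact intervalIntegral.integral_congr fun x _ => mul_comm _ _

lemma IsNeumannEigensystem.abs_coeff_le (h : IsNeumannEigensystem V μ e) {f : ℝ → ℝ}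
    (hf : MemLp f 2 volUI) (n : ℕ) : |coeff e n f| ≤ l2norm f := by
  have h1 : l2norm (e n) = 1 := by
    rw [l2norm]; simp only [sq, h.orthonormal, if_pos, Real.sqrt_one]
  have := abs_integral_mul_le (h.mode n).memLp hf
  rwa [h1, one_mul] at this

/-- The derivative of the `n`-th eigenfunction in `L²([0,1])`. -/
def IsNeumannEigensystem.dxVec (h : IsNeumannEigensystem V μ e) (n : ℕ) : L2UI :=
  toL2 (dx (e n)) (h.mode n).continuousOn_dx

lemma IsNeumannEigensystem.norm_sum_dxVec_le (h : IsNeumannEigensystem V μ e)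
    (hV : ContinuousOn V UI) (hpos : ∀ x ∈ UI, 0 < V x) (a : ℕ → ℝ) (s : Finset ℕ) :
    ‖∑ n ∈ s, a n • h.dxVec n‖ ^ 2 ≤ ∑ n ∈ s, μ n * a n ^ 2 := by
  refine le_trans (le_of_eq ?_) (integral_sum_dx_sq_le h.mode hV hpos h.orthonormal s a)
  rw [norm_L2UI_eq, l2norm_sq]
  refine integral_congr_ae_UI ?_
  have h1 : ∀ᵐ x ∂volUI, ∀ n ∈ s, (a n • h.dxVec n : L2UI) x = a n * dx (e n) x := by
    rw [Finset.eventually_all]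
    intro n _
    filter_upwards [Lp.coeFn_smul (a n) (h.dxVec n), toL2_ae (h.mode n).continuousOn_dx]
      with x hx hx'
    rw [hx, Pi.smul_apply, smul_eq_mul, IsNeumannEigensystem.dxVec, hx']
  filter_upwards [Lp.coeFn_finsetSum s fun n => a n • h.dxVec n, h1] with x hx hx'
  rw [hx, Finset.sum_apply, Finset.sum_congr rfl hx']

/-- Cauchy's criterion in L²: the energy of a block of modes dominates the norm of the corresponding
block of derivatives. -/
lemma IsNeumannEigensystem.summable_dxVec (h : IsNeumannEigensystem V μ e)
    (hV : ContinuousOn V UI) (hpos : ∀ x ∈ UI, 0 < V x) {a : ℕ → ℝ}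
    (ha : Summable fun n => μ n * a n ^ 2) : Summable fun n => a n • h.dxVec n := by
  rw [summable_iff_vanishing_norm] at ha ⊢
  intro ε hε
  obtain ⟨s, hs⟩ := ha (ε ^ 2) (by positivity)
  refine ⟨s, fun t ht => lt_of_pow_lt_pow_left₀ 2 hε.le ?_⟩
  exact (h.norm_sum_dxVec_le hV hpos a t).trans_lt ((le_abs_self _).trans_lt (hs t ht))

lemma IsNeumannEigensystem.norm_tsum_dxVec_le (h : IsNeumannEigensystem V μ e)
    (hV : ContinuousOn V UI) (hpos : ∀ x ∈ UI, 0 < V x) {a : ℕ → ℝ}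
    (ha : Summable fun n => μ n * a n ^ 2) :
    ‖∑' n, a n • h.dxVec n‖ ^ 2 ≤ ∑' n, μ n * a n ^ 2 := by
  have h1 := (h.summable_dxVec hV hpos ha).hasSum
  have h2 : Tendsto (fun s : Finset ℕ => ‖∑ n ∈ s, a n • h.dxVec n‖ ^ 2) atTop
      (𝓝 (‖∑' n, a n • h.dxVec n‖ ^ 2)) := (Tendsto.norm h1).pow 2
  exact le_of_tendsto_of_tendsto' h2 ha.hasSum fun s => h.norm_sum_dxVec_le hV hpos a s

/-- Bessel's inequality in the energy norm. -/
lemma IsNeumannEigensystem.summable_energy (h : IsNeumannEigensystem V μ e)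
    (hV : ContinuousOn V UI) (hpos : ∀ x ∈ UI, 0 < V x) {f g : ℝ → ℝ} (hg : MemLp g 2 volUI)
    (hf : ∀ x ∈ UI, f x = f 0 + ∫ s in (0 : ℝ)..x, g s) :
    Summable fun n => μ n * coeff e n f ^ 2 := by
  have hμ := h.mu_pos hV hpos
  have hgi := MemLp_intervalIntegrable hg
  have hfc : ContinuousOn f UI := (continuousOn_const.add (continuousOn_primitive_UI hgi)).congr hf
  have hfm := memLp_of_continuousOn hfc 2
  have hVf : MemLp (fun x => V x * f x) 2 volUI := memLp_of_continuousOn (hV.mul hfc) 2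
  set c := fun n => coeff e n f with hc
  have hweak : ∀ n, ⟪hg.toLp g, h.dxVec n⟫ + coeff e n (fun x => V x * f x) = μ n * c n := fun n => by
    have := (h.mode n).weak_form hV hgi hf
    simp only [hc, coeff]
    rw [← this, real_inner_comm, IsNeumannEigensystem.dxVec, inner_toL2]
    congr 1
    · exact integral_congr_ae_UI (hg.coeFn_toLp.mono fun x hx => by simp only [hx])
    · exact intervalIntegral.integral_congr fun x _ => by ring
  refine summable_of_sum_le (c := ‖hg.toLp g‖ ^ 2
    + 2 * (l2norm (fun x => V x * f x) * l2norm f)) (fun n => mul_nonneg (hμ n).le (sq_nonneg _))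
    fun s => ?_
  -- As in Bessel's inequality, but the derivatives e_n' need not be orthogonal. The weak form
  -- replaces orthogonality at the cost of a potential term, which `h4` bounds uniformly in s by
  -- Cauchy-Schwarz and Parseval.
  have h1 : 0 ≤ ‖hg.toLp g - ∑ n ∈ s, c n • h.dxVec n‖ ^ 2 := sq_nonneg _
  rw [norm_sub_sq_real, inner_sum] at h1
  have h2 := h.norm_sum_dxVec_le hV hpos c s
  have h3 : ∑ n ∈ s, ⟪hg.toLp g, c n • h.dxVec n⟫
      = (∑ n ∈ s, μ n * c n ^ 2) - ∑ n ∈ s, c n * coeff e n (fun x => V x * f x) := by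
    rw [← Finset.sum_sub_distrib]
    refine Finset.sum_congr rfl fun n _ => ?_
    rw [inner_smul_right]
    linear_combination c n * hweak n
  have h4 : |∑ n ∈ s, c n * coeff e n (fun x => V x * f x)|
      ≤ l2norm (fun x => V x * f x) * l2norm f := by
    rw [mul_comm (l2norm _)]
    refine abs_le_of_sq_le_sq ?_ (mul_nonneg (l2norm_nonneg _) (l2norm_nonneg _))
    refine (Finset.sum_mul_sq_le_sq_mul_sq s _ _).trans ?_
    rw [mul_pow, l2norm_sq, l2norm_sq]
    have a1 := h.hasSum_coeff_mul hfm hfm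
    have a2 := h.hasSum_coeff_mul hVf hVf
    simp only [← sq] at a1 a2
    exact mul_le_mul (sum_le_hasSum s (fun n _ => sq_nonneg _) a1)
      (sum_le_hasSum s (fun n _ => sq_nonneg _) a2) (Finset.sum_nonneg fun n _ => sq_nonneg _)
      (intervalIntegral.integral_nonneg zero_le_one fun x _ => sq_nonneg _)
  have h5 := le_abs_self (∑ n ∈ s, c n * coeff e n (fun x => V x * f x))
  linarith

/-- The derivative of an `H¹` function is the sum of the differentiated series. -/
lemma IsNeumannEigensystem.tsum_dxVec_ae_eq (h : IsNeumannEigensystem V μ e)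
    (hV : ContinuousOn V UI) (hpos : ∀ x ∈ UI, 0 < V x) {f g : ℝ → ℝ} (hg : MemLp g 2 volUI)
    (hf : ∀ x ∈ UI, f x = f 0 + ∫ s in (0 : ℝ)..x, g s) :
    (∑' n, coeff e n f • h.dxVec n : L2UI) =ᵐ[volUI] g := by
  have hgi := MemLp_intervalIntegrable hg
  have hfc : ContinuousOn f UI := (continuousOn_const.add (continuousOn_primitive_UI hgi)).congr hf
  have hfm := memLp_of_continuousOn hfc 2
  have hs := h.summable_dxVec hV hpos (h.summable_energy hV hpos hg hf)
  set G : L2UI := ∑' n, coeff e n f • h.dxVec n with hG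
  have hGi := MemLp_intervalIntegrable (Lp.memLp G)
  have hDi : IntervalIntegrable (fun x => G x - g x) volume 0 1 := hGi.sub hgi
  -- The difference G - g is tested against p, the primitive of K minus its mean, which vanishes at
  -- both ends. If this pairing is zero, integration by parts makes K constant, hence zero because
  -- K(0) = 0.
  set K := fun x => ∫ s in (0 : ℝ)..x, (G s - g s) with hK
  have hKc : ContinuousOn K UI := continuousOn_primitive_UI hDi
  set m := ∫ x in (0 : ℝ)..1, K x with hm
  have hqc : ContinuousOn (fun x => K x - m) UI := hKc.sub continuousOn_const
  have hKi := ContinuousOn_intervalIntegrable_UI hKc zero_mem_UI one_mem_UI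
  set p := fun x => ∫ s in (0 : ℝ)..x, (K s - m) with hp
  have hpd : ∀ x ∈ UI, HasDerivWithinAt p (K x - m) UI x := fun x hx =>
    hasDerivWithinAt_primitive hqc hx
  have hpc : ContinuousOn p UI := fun x hx => (hpd x hx).continuousWithinAt
  have hp0 : p 0 = 0 := intervalIntegral.integral_same
  have hp1 : p 1 = 0 := by
    simp only [hp]
    rw [intervalIntegral.integral_sub hKi intervalIntegrable_const, ← hm]
    simp
  have hA := integral_mul_eq_sub_of_primitive hpd hqc hDi (f := K) fun x _ => by
    simp only [hK, intervalIntegral.integral_same, zero_add]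
  have hB := integral_mul_eq_sub_of_primitive hpd hqc hgi hf
  rw [hp0, hp1, zero_mul, zero_mul, sub_zero, zero_sub] at hA hB
  -- Each e_n' is paired with p by parts, and Parseval sums the results to the pairing of p' with f.
  -- By `hB` the function g gives the same value.
  have hC : ∫ x in (0 : ℝ)..1, p x * G x = -∫ x in (0 : ℝ)..1, (K x - m) * f x := by
    have h1 := (innerSL ℝ (toL2 p hpc)).hasSum hs.hasSum
    have h2 := (h.hasSum_coeff_mul (memLp_of_continuousOn hqc 2) hfm).neg
    rw [← hG, innerSL_apply_apply, inner_toL2] at h1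
    refine h1.unique (h2.congr_fun fun n => ?_)
    rw [innerSL_apply_apply, inner_smul_right, inner_toL2]
    have h3 : ∫ x in (0 : ℝ)..1, p x * h.dxVec n x = ∫ x in (0 : ℝ)..1, p x * dx (e n) x :=
      integral_congr_ae_UI ((toL2_ae (h.mode n).continuousOn_dx).mono fun x hx => by
        simp only [IsNeumannEigensystem.dxVec, hx])
    have h4 := integral_mul_eq_sub_of_primitive hpd hqc
      (ContinuousOn_intervalIntegrable_UI (h.mode n).continuousOn_dx zero_mem_UI one_mem_UI)
      (primitive_of_hasDeriv (h.mode n).hasDeriv (h.mode n).continuousOn_dx)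
    rw [h3, h4, hp0, hp1, coeff, coeff]
    have h5 : ∫ x in (0 : ℝ)..1, (K x - m) * e n x = ∫ x in (0 : ℝ)..1, e n x * (K x - m) :=
      intervalIntegral.integral_congr fun x _ => mul_comm _ _
    rw [h5]
    ring
  have hsplit : ∫ x in (0 : ℝ)..1, p x * (G x - g x)
      = (∫ x in (0 : ℝ)..1, p x * G x) - ∫ x in (0 : ℝ)..1, p x * g x := by
    rw [← intervalIntegral.integral_sub
      (hGi.continuousOn_mul (by rwa [uIcc_zero_one])) (hgi.continuousOn_mul (by rwa [uIcc_zero_one]))]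
    simp only [mul_sub]
  have hq0 : ∫ x in (0 : ℝ)..1, (K x - m) * (K x - m) = 0 := by
    have e1 : ∫ x in (0 : ℝ)..1, (K x - m) * (K x - m)
        = (∫ x in (0 : ℝ)..1, (K x - m) * K x) - ∫ x in (0 : ℝ)..1, (K x - m) * m := by
      have i1 : IntervalIntegrable (fun x => (K x - m) * K x) volume 0 1 :=
        ContinuousOn_intervalIntegrable_UI (hqc.mul hKc) zero_mem_UI one_mem_UI
      have i2 : IntervalIntegrable (fun x => (K x - m) * m) volume 0 1 :=
        ContinuousOn_intervalIntegrable_UI (hqc.mul continuousOn_const) zero_mem_UI one_mem_UI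
      rw [← intervalIntegral.integral_sub i1 i2]
      simp only [mul_sub]
    have e2 : ∫ x in (0 : ℝ)..1, (K x - m) * m = 0 := by
      rw [intervalIntegral.integral_mul_const]
      have : ∫ x in (0 : ℝ)..1, (K x - m) = 0 := hp1
      rw [this, zero_mul]
    rw [e1, e2]
    linarith
  have hKm := eqOn_zero_of_integral_eq_zero (hqc.mul hqc) (fun x _ => mul_self_nonneg _) hq0
  have hK0 : ∀ x ∈ UI, K x = m := fun x hx => sub_eq_zero.1 (mul_self_eq_zero.1 (hKm x hx))
  have hm0 : m = 0 := by
    rw [← hK0 0 zero_mem_UI]; exact intervalIntegral.integral_same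
  refine ae_eq_of_primitive_eq hGi hgi fun x hx => ?_
  have := hK0 x hx
  rw [hm0] at this
  simp only [hK] at this
  rw [intervalIntegral.integral_sub (intervalIntegrable_mono_UI hGi zero_mem_UI hx)
    (intervalIntegrable_mono_UI hgi zero_mem_UI hx)] at this
  linarith

lemma coeff_sub {n : ℕ} {f g : ℝ → ℝ} (he : ContinuousOn (e n) UI) (hf : ContinuousOn f UI)
    (hg : ContinuousOn g UI) : coeff e n (fun x => f x - g x) = coeff e n f - coeff e n g := by
  have i1 : IntervalIntegrable (fun x => e n x * f x) volume 0 1 :=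
    ContinuousOn_intervalIntegrable_UI (he.mul hf) zero_mem_UI one_mem_UI
  have i2 : IntervalIntegrable (fun x => e n x * g x) volume 0 1 :=
    ContinuousOn_intervalIntegrable_UI (he.mul hg) zero_mem_UI one_mem_UI
  simp only [coeff]
  rw [← intervalIntegral.integral_sub i1 i2]
  simp only [mul_sub]

/-- The heat semigroup is continuous at `t = 0`, in `H¹` and uniformly. -/
lemma IsNeumannEigensystem.heat_tendsto (h : IsNeumannEigensystem V μ e)
    (hV : ContinuousOn V UI) (hpos : ∀ x ∈ UI, 0 < V x) {v g : ℝ → ℝ} (hg : MemLp g 2 volUI)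
    (hv : ∀ x ∈ UI, v x = v 0 + ∫ s in (0 : ℝ)..x, g s) :
    ∃ E : ℝ → ℝ, Tendsto E (𝓝[>] 0) (𝓝 0) ∧ ∀ t, 0 < t →
      l2norm (fun x => modeSum (fun n => dx (e n)) (heatCoef μ (fun n => coeff e n v) 0 t) x - g x)
        ≤ E t ∧
      ∀ x ∈ UI, |modeSum e (heatCoef μ (fun n => coeff e n v) 0 t) x - v x| ≤ E t := by
  have hμ := h.mu_pos hV hpos
  have hgi := MemLp_intervalIntegrable hg
  have hvc : ContinuousOn v UI := (continuousOn_const.add (continuousOn_primitive_UI hgi)).congr hv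
  have hvm := memLp_of_continuousOn hvc 2
  set c := fun n => coeff e n v with hc
  have hcb : ∀ n, |c n| ≤ l2norm v := h.abs_coeff_le hvm
  -- Coefficients of P - v. They tend to 0 one by one and are dominated by c_n, whose energy is
  -- finite because v is in H¹.
  set a : ℝ → ℕ → ℝ := fun t n => c n * (Real.exp (-μ n * t) - 1) with ha
  have hS : Summable fun n => (1 + μ n) * c n ^ 2 := by
    have h1 := (h.hasSum_coeff_mul hvm hvm).summable
    refine (h1.add (h.summable_energy hV hpos hg hv)).congr fun n => ?_
    simp only [hc]; ring
  have hale : ∀ t, 0 < t → ∀ n, a t n ^ 2 ≤ c n ^ 2 := fun t ht n => by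
    have h1 := Real.exp_pos (-μ n * t)
    have h2 : Real.exp (-μ n * t) ≤ 1 := Real.exp_le_one_iff.2 (by nlinarith [hμ n])
    rw [ha, mul_pow]
    exact mul_le_of_le_one_right (sq_nonneg _) (by nlinarith)
  have hlim : Tendsto (fun t => ∑' n, (1 + μ n) * a t n ^ 2) (𝓝[>] 0) (𝓝 0) := by
    have h0 : 𝓝 (0 : ℝ) = 𝓝 (∑' _ : ℕ, (0 : ℝ)) := by rw [tsum_zero]
    refine h0 ▸ tendsto_tsum_of_dominated_convergence hS (fun n => ?_) ?_
    · have : Continuous fun t => (1 + μ n) * a t n ^ 2 := by simp only [ha]; fun_prop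
      have h0 := this.tendsto 0
      simp only [ha, mul_zero, Real.exp_zero, sub_self, ne_eq, OfNat.ofNat_ne_zero,
        not_false_eq_true, zero_pow] at h0
      exact h0.mono_left nhdsWithin_le_nhds
    · filter_upwards [self_mem_nhdsWithin] with t ht n
      rw [Real.norm_of_nonneg (mul_nonneg (by linarith [hμ n]) (sq_nonneg _))]
      exact mul_le_mul_of_nonneg_left (hale t ht n) (by linarith [hμ n])
  -- The factor √2 is the Sobolev constant for the uniform bound; the L² bound on the derivative
  -- absorbs it since √2 ≥ 1.
  refine ⟨fun t => √2 * √(∑' n, (1 + μ n) * a t n ^ 2), ?_, fun t ht => ?_⟩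
  · have := (hlim.sqrt).const_mul (√2)
    simpa using this
  have hb := h.summable_heat_one hV hpos hcb 0 ht
  set P := modeSum e (heatCoef μ c 0 t) with hP
  set Q := modeSum (fun n => dx (e n)) (heatCoef μ c 0 t) with hQ
  have hPc : ContinuousOn P UI := h.continuousOn_modeSum hV hpos hb
  have hQc : ContinuousOn Q UI := h.continuousOn_modeSum_dx hV hpos hb
  have hQm := memLp_of_continuousOn hQc 2
  have hQi := MemLp_intervalIntegrable hQm
  have hPQ : ∀ x ∈ UI, P x = P 0 + ∫ s in (0 : ℝ)..x, Q s :=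
    primitive_of_hasDeriv (fun x hx => h.hasDeriv_modeSum hV hpos hb hx) hQc
  have hdm : MemLp (fun x => Q x - g x) 2 volUI := hQm.sub hg
  have hd : ∀ x ∈ UI, P x - v x = P 0 - v 0 + ∫ s in (0 : ℝ)..x, (Q s - g s) := fun x hx => by
    rw [intervalIntegral.integral_sub (intervalIntegrable_mono_UI hQi zero_mem_UI hx)
      (intervalIntegrable_mono_UI hgi zero_mem_UI hx), hPQ x hx, hv x hx]
    ring
  have hco : ∀ n, coeff e n (fun x => P x - v x) = a t n := fun n => by
    rw [coeff_sub (h.mode n).continuousOn hPc hvc, h.coeff_modeSum hV hpos hb]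
    simp only [heatCoef, ha, hc]; ring
  have hfm : MemLp (fun x => P x - v x) 2 volUI := memLp_of_continuousOn (hPc.sub hvc) 2
  have hs1 : HasSum (fun n => a t n ^ 2) (l2norm (fun x => P x - v x) ^ 2) := by
    have := h.hasSum_coeff_mul hfm hfm
    simp only [hco, ← sq] at this
    rwa [l2norm_sq]
  have hs2 : Summable fun n => μ n * a t n ^ 2 := by
    have := h.summable_energy hV hpos hdm hd
    simpa only [hco] using this
  have hsum : ∑' n, (1 + μ n) * a t n ^ 2
      = l2norm (fun x => P x - v x) ^ 2 + ∑' n, μ n * a t n ^ 2 := by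
    rw [← hs1.tsum_eq, ← hs1.summable.tsum_add hs2]
    exact tsum_congr fun n => by ring
  have hgn : l2norm (fun x => Q x - g x) ^ 2 ≤ ∑' n, μ n * a t n ^ 2 := by
    have h1 := h.tsum_dxVec_ae_eq hV hpos hdm hd
    simp only [hco] at h1
    rw [← l2norm_congr_ae h1, ← norm_L2UI_eq]
    exact h.norm_tsum_dxVec_le hV hpos hs2
  have h2 : (1 : ℝ) ≤ √2 := Real.one_le_sqrt.2 one_le_two
  constructor
  · refine (Real.le_sqrt_of_sq_le (y := ∑' n, (1 + μ n) * a t n ^ 2) ?_).trans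
      (le_mul_of_one_le_left (Real.sqrt_nonneg _) h2)
    rw [hsum]
    exact hgn.trans (le_add_of_nonneg_left (sq_nonneg _))
  · intro x hx
    have h3 := isSobolevConstant_sqrt_two (fun x => P x - v x) (hdm.toLp _) (fun y hy => by
      rw [integral_congr_ae_UI' hdm.coeFn_toLp hy]; exact hd y hy) x hx
    refine h3.trans (mul_le_mul_of_nonneg_left (Real.sqrt_le_sqrt ?_) (Real.sqrt_nonneg _))
    rw [hsum, l2norm_sq]
    refine add_le_add le_rfl (le_trans (le_of_eq ?_) hgn)
    rw [l2norm_sq]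
    exact integral_congr_ae_UI (hdm.coeFn_toLp.mono fun y hy => by simp only [hy])

end Expansion

/-! ### The maximum principle -/

/-- Second derivative test at a minimum on `[0,1]`, end points included. -/
lemma second_deriv_nonneg_of_min {f f' : ℝ → ℝ} {d x : ℝ} (hx : x ∈ UI)
    (hf : ∀ y ∈ UI, HasDerivWithinAt f (f' y) UI y) (hf' : HasDerivWithinAt f' d UI x)
    (h0 : f' 0 = 0) (h1 : f' 1 = 0) (hmin : ∀ y ∈ UI, f x ≤ f y) : 0 ≤ d := by
  have hfx : f' x = 0 := by
    rcases eq_or_lt_of_le hx.1 with rfl | hx0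
    · exact h0
    rcases eq_or_lt_of_le hx.2 with rfl | hx1
    · exact h1
    have hn : UI ∈ 𝓝 x := Icc_mem_nhds hx0 hx1
    exact IsLocalMin.hasDerivAt_eq_zero (Filter.mem_of_superset hn hmin) ((hf x hx).hasDerivAt hn)
  by_contra! hd
  have hsl := hasDerivWithinAt_iff_tendsto_slope.1 hf'
  have hev := hsl.eventually (gt_mem_nhds (show d < d / 2 by linarith))
  rw [eventually_nhdsWithin_iff, Metric.eventually_nhds_iff] at hev
  obtain ⟨ε, hε, hev⟩ := hev
  obtain ⟨y, ⟨hyε, hyU⟩, hyx⟩ := accPt_iff_nhds.1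
    (uniqueDiffWithinAt_iff_accPt.1 (uniqueDiffOn_UI x hx)) _ (Metric.ball_mem_nhds x hε)
  -- If d < 0 then f'(z)/(z-x) < d/2 near x, so by the mean value theorem f - (d/4)(z-x)² does not
  -- increase from x to y. Then f(y) ≤ f(x) + (d/4)(y-x)² < f(x). Only slopes within [0,1] enter, so
  -- end points need no separate argument.
  have hk : ∀ z ∈ UI, HasDerivWithinAt (fun z => f z - d / 4 * (z - x) ^ 2)
      (f' z - d / 2 * (z - x)) UI z := fun z hz => by
    refine ((hf z hz).sub ((((hasDerivWithinAt_id z UI).sub_const x).pow 2).const_mul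
      (d / 4))).congr_deriv ?_
    simp; ring
  obtain ⟨z, hz, hzy⟩ := domain_mvt (fun z hz => (hk z hz).hasFDerivWithinAt) (convex_Icc 0 1) hx hyU
  simp only [sub_self, ne_eq, OfNat.ofNat_ne_zero, not_false_eq_true, zero_pow, mul_zero, sub_zero,
    ContinuousLinearMap.toSpanSingleton_apply, smul_eq_mul] at hzy
  obtain ⟨θ, ⟨hθ0, hθ1⟩, rfl⟩ := (segment_eq_image' ℝ x y ▸ hz :)
  have hzU : x + θ • (y - x) ∈ UI := (convex_Icc (0 : ℝ) 1).segment_subset hx hyU hz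
  have hle : (y - x) * (f' (x + θ • (y - x)) - d / 2 * (x + θ • (y - x) - x)) ≤ 0 := by
    rcases eq_or_lt_of_le hθ0 with rfl | hθ
    · simp [hfx]
    have hne : x + θ • (y - x) - x ≠ 0 := by
      rw [add_sub_cancel_left]
      exact smul_ne_zero hθ.ne' (sub_ne_zero.2 hyx)
    have hdist : dist (x + θ • (y - x)) x < ε := by
      rw [Real.dist_eq, add_sub_cancel_left, smul_eq_mul, abs_mul, abs_of_pos hθ]
      rw [Metric.mem_ball, Real.dist_eq] at hyε
      nlinarith [abs_nonneg (y - x)]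
    have h2 := hev hdist ⟨hzU, by simpa [sub_eq_zero] using hne⟩
    rw [slope_def_field, hfx, sub_zero] at h2
    have h3 : f' (x + θ • (y - x))
        = f' (x + θ • (y - x)) / (x + θ • (y - x) - x) * (x + θ • (y - x) - x) :=
      (div_mul_cancel₀ _ hne).symm
    rw [h3, ← sub_mul, add_sub_cancel_left, smul_eq_mul] at *
    have h4 : 0 ≤ θ * (y - x) ^ 2 := by positivity
    nlinarith
  have h5 : 0 < (y - x) ^ 2 := by
    have := sub_ne_zero.2 hyx
    positivity
  nlinarith [hmin y hyU]

/-- The time derivative is nonpositive where a minimum over the past is attained. -/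
lemma deriv_nonpos_of_min_past {f : ℝ → ℝ} {d s t : ℝ} (hst : s < t) (hf : HasDerivAt f d t)
    (hmin : ∀ r ∈ Icc s t, f t ≤ f r) : d ≤ 0 := by
  have h1 := hasDerivWithinAt_iff_tendsto_slope.1 (hf.hasDerivWithinAt (s := Iio t))
  rw [sdiff_singleton_eq_self (by simp)] at h1
  refine le_of_tendsto h1 ?_
  filter_upwards [Ico_mem_nhdsLT hst, self_mem_nhdsWithin] with r hr hr'
  rw [slope_def_field]
  exact div_nonpos_of_nonneg_of_nonpos (sub_nonneg.2 (hmin r ⟨hr.1, hr.2.le⟩))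
    (sub_nonpos.2 hr.2.le)

/-! ### The unnormalised Cole-Hopf transform -/

/-- `exp(-½ ∫₀ˣ u)`. -/
def hopf (u : ℝ → ℝ) (x : ℝ) : ℝ := Real.exp (-(1 / 2) * ∫ s in (0 : ℝ)..x, u s)

lemma hopf_pos (u : ℝ → ℝ) (x : ℝ) : 0 < hopf u x := Real.exp_pos _

lemma hopf_zero (u : ℝ → ℝ) : hopf u 0 = 1 := by simp [hopf]

lemma abs_log_hopf_le {u : ℝ → ℝ} (hu : MemLp u 2 volUI) {x : ℝ} (hx : x ∈ UI) :
    |-(1 / 2) * ∫ s in (0 : ℝ)..x, u s| ≤ 1 / 2 * l2norm u := by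
  rw [abs_mul, abs_neg, abs_of_pos one_half_pos]
  exact mul_le_mul_of_nonneg_left (abs_integral_le_l2norm hu zero_mem_UI hx) one_half_pos.le

lemma le_hopf {u : ℝ → ℝ} (hu : MemLp u 2 volUI) {x : ℝ} (hx : x ∈ UI) :
    Real.exp (-(1 / 2 * l2norm u)) ≤ hopf u x :=
  Real.exp_le_exp.2 (abs_le.1 (abs_log_hopf_le hu hx)).1

lemma hopf_le {u : ℝ → ℝ} (hu : MemLp u 2 volUI) {x : ℝ} (hx : x ∈ UI) :
    hopf u x ≤ Real.exp (1 / 2 * l2norm u) :=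
  Real.exp_le_exp.2 (abs_le.1 (abs_log_hopf_le hu hx)).2

lemma continuousOn_hopf {u : ℝ → ℝ} (hu : MemLp u 2 volUI) : ContinuousOn (hopf u) UI :=
  (continuousOn_const.mul (continuousOn_primitive_UI (MemLp_intervalIntegrable hu))).rexp

lemma memLp_mul_continuousOn {u f : ℝ → ℝ} (hu : MemLp u 2 volUI) (hf : ContinuousOn f UI) :
    MemLp (fun x => u x * f x) 2 volUI := by
  obtain ⟨M, hM⟩ := isCompact_Icc.exists_bound_of_continuousOn hf
  refine (hu.const_mul M).mono
    (hu.aestronglyMeasurable.mul (memLp_of_continuousOn hf 2).aestronglyMeasurable) ?_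
  refine ae_volUI_of_ae (Filter.Eventually.of_forall fun x hx => ?_)
  rw [norm_mul, norm_mul, mul_comm]
  exact mul_le_mul_of_nonneg_right ((hM x hx).trans (Real.le_norm_self _)) (norm_nonneg _)

/-- The transform of an L² function is in H¹, with weak derivative -½u·hopf u; this regularity is
what lets the initial data be attained in L². -/
lemma hopf_primitive {u : ℝ → ℝ} (hu : MemLp u 2 volUI) {x : ℝ} (hx : x ∈ UI) :
    hopf u x = hopf u 0 + ∫ s in (0 : ℝ)..x, -(1 / 2) * u s * hopf u s := by
  have h1 : hopf u = fun x => Real.exp (∫ s in (0 : ℝ)..x, -(1 / 2) * u s) := by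
    funext y; rw [intervalIntegral.integral_const_mul]; rfl
  rw [hopf_zero]
  simp only [h1]
  exact exp_primitive_eq ((MemLp_intervalIntegrable hu).const_mul _) hx

lemma coleHopfH_eq (u : L2UI) (x : ℝ) :
    coleHopfH u x = hopf u x / ∫ y in (0 : ℝ)..1, hopf u y := rfl

/-! ### Positivity of the heat flow and existence for the Burgers problem. -/

section Existence

variable {V : ℝ → ℝ} {μ : ℕ → ℝ} {e : ℕ → ℝ → ℝ} {c : ℕ → ℝ} {B : ℝ}

lemma IsNeumannEigensystem.modeSum_dx_zero (h : IsNeumannEigensystem V μ e) (b : ℕ → ℝ) :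
    modeSum (fun n => dx (e n)) b 0 = 0 := by
  simp [modeSum, h.neumann_zero]

lemma IsNeumannEigensystem.modeSum_dx_one (h : IsNeumannEigensystem V μ e) (b : ℕ → ℝ) :
    modeSum (fun n => dx (e n)) b 1 = 0 := by
  simp [modeSum, h.neumann_one]

/-- The heat flow preserves nonnegativity. -/
lemma IsNeumannEigensystem.heat_nonneg (h : IsNeumannEigensystem V μ e)
    (hV : ContinuousOn V UI) (hpos : ∀ x ∈ UI, 0 < V x) (hc : ∀ n, |c n| ≤ B) {s T : ℝ}
    (hs : 0 < s) (hsT : s ≤ T) (h0 : ∀ x ∈ UI, 0 ≤ modeSum e (heatCoef μ c 0 s) x) :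
    ∀ x ∈ UI, 0 ≤ modeSum e (heatCoef μ c 0 T) x := by
  obtain ⟨K, hK0, hVK, hK⟩ := h.exists_bound hV hpos
  have hcont := (h.continuousOn_heat hV hpos hc (fun n x hx => (hK n x hx).1)
    (fun n => (h.mode n).continuousOn) 0).mono
    (show Icc s T ×ˢ UI ⊆ Ioi 0 ×ˢ UI from prod_mono (fun r hr => hs.trans_le hr.1) le_rfl)
  obtain ⟨⟨t, x⟩, ⟨ht, hx⟩, hmin⟩ := (isCompact_Icc.prod isCompact_Icc).exists_isMinOn
    ⟨(s, 0), ⟨le_rfl, hsT⟩, zero_mem_UI⟩ hcont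
  have hmin' : ∀ r ∈ Icc s T, ∀ y ∈ UI,
      modeSum e (heatCoef μ c 0 t) x ≤ modeSum e (heatCoef μ c 0 r) y :=
    fun r hr y hy => hmin (show (r, y) ∈ Icc s T ×ˢ UI from ⟨hr, hy⟩)
  by_contra! hneg
  obtain ⟨y, hy, hneg⟩ := hneg
  have hlt := (hmin' T ⟨hsT, le_rfl⟩ y hy).trans_lt hneg
  -- A negative minimum cannot lie at the initial time, where the function is nonnegative.
  have hst : s < t := by
    refine lt_of_le_of_ne ht.1 ?_
    rintro rfl
    exact absurd (h0 x hx) (not_le.2 hlt)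
  have ht0 : 0 < t := hs.trans hst
  have hd1 := deriv_nonpos_of_min_past hst
    (h.hasDerivAt_heat hV hpos hc (fun n x hx => (hK n x hx).1) 0 ht0 hx)
    fun r hr => hmin' r ⟨hr.1, hr.2.trans ht.2⟩ x hx
  have hd2 := second_deriv_nonneg_of_min hx
    (fun y hy => h.hasDeriv_modeSum hV hpos (h.summable_heat_one hV hpos hc 0 ht0) hy)
    (h.hasDeriv_modeSum_dx hV hpos (h.summable_heat hV hpos hc 0 2 ht0) hx)
    (h.modeSum_dx_zero _) (h.modeSum_dx_one _) fun y hy => hmin' t ht y hy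
  rw [heatCoef_succ] at hd2
  -- At a negative minimum P_t ≤ 0 and 0 ≤ P_xx = VP + P_t, while VP < 0. Strict positivity of V
  -- makes a perturbation argument unnecessary.
  nlinarith [hpos x hx]

/-- The heat flow is positive for all positive times if it is bounded below for small times. -/
lemma IsNeumannEigensystem.heat_pos (h : IsNeumannEigensystem V μ e)
    (hV : ContinuousOn V UI) (hpos : ∀ x ∈ UI, 0 < V x) (hc : ∀ n, |c n| ≤ B) {δ : ℝ} (hδ : 0 < δ)
    (h0 : ∀ᶠ t in 𝓝[>] (0 : ℝ), ∀ x ∈ UI, δ ≤ modeSum e (heatCoef μ c 0 t) x) {t : ℝ}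
    (ht : 0 < t) {x : ℝ} (hx : x ∈ UI) : 0 < modeSum e (heatCoef μ c 0 t) x := by
  obtain ⟨K, hK0, hVK, hK⟩ := h.exists_bound hV hpos
  have hμ := h.mu_pos hV hpos
  obtain ⟨s, hs1, hs0, hst⟩ := (h0.and (Ioc_mem_nhdsGT ht)).exists
  have hK1 : 0 < K * (1 + μ 0) + 1 := by have := hμ 0; positivity
  -- The positive solution ηe^{-μ₀t}e₀ stays below δ at the starting time s, so nonnegativity of the
  -- difference gives a strict lower bound later. The added 1 keeps the denominator positive even if
  -- K = 0.
  set η := δ / (K * (1 + μ 0) + 1) with hη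
  have hη0 : 0 < η := div_pos hδ hK1
  set c' : ℕ → ℝ := fun n => c n - if n = 0 then η else 0 with hc'
  have hc'b : ∀ n, |c' n| ≤ B + η := fun n => by
    refine (abs_sub _ _).trans (add_le_add (hc n) ?_)
    split_ifs
    · rw [abs_of_pos hη0]
    · simpa using hη0.le
  have hsplit : ∀ r, 0 < r → ∀ y ∈ UI, modeSum e (heatCoef μ c' 0 r) y
      = modeSum e (heatCoef μ c 0 r) y - η * Real.exp (-μ 0 * r) * e 0 y := fun r hr y hy => by
    have h1 := h.hasSum_modeSum hV hpos (h.summable_heat_one hV hpos hc 0 hr) hy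
    have h2 : HasSum (fun n => (if n = 0 then η else 0) * Real.exp (-μ n * r) * e n y)
        (η * Real.exp (-μ 0 * r) * e 0 y) := by
      convert hasSum_ite_eq 0 (η * Real.exp (-μ 0 * r) * e 0 y) using 2 with n
      by_cases hn : n = 0
      · simp [hn]
      · simp [hn]
    refine ((h1.sub h2).congr_fun fun n => ?_).tsum_eq
    simp only [heatCoef, hc']
    ring
  have h3 := h.heat_nonneg hV hpos hc'b hs0 hst (fun y hy => ?_) x hx
  · rw [hsplit t ht x hx] at h3
    have := h.pos x hx
    have h4 : 0 < η * Real.exp (-μ 0 * t) * e 0 x := by positivity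
    linarith
  · rw [hsplit s hs0 y hy]
    have h5 := hs1 y hy
    have h6 := (le_abs_self _).trans (hK 0 y hy).1
    have h7 : Real.exp (-μ 0 * s) ≤ 1 := Real.exp_le_one_iff.2 (by nlinarith [hμ 0])
    have h8 : η * (K * (1 + μ 0) + 1) = δ := div_mul_cancel₀ _ hK1.ne'
    have h9 : η * Real.exp (-μ 0 * s) * e 0 y ≤ η * 1 * (K * (1 + μ 0) + 1) :=
      mul_le_mul (mul_le_mul_of_nonneg_left h7 hη0.le) (by linarith) (h.pos y hy).le (by positivity)
    linarith

/-- A quotient bound in `L²`. -/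
lemma l2norm_div_sub_div_le {P Q v g : ℝ → ℝ} (hP : ContinuousOn P UI) (hQ : ContinuousOn Q UI)
    (hv : ContinuousOn v UI) (hg : MemLp g 2 volUI) {δ E : ℝ} (hδ : 0 < δ) (hE : 0 ≤ E)
    (hPδ : ∀ x ∈ UI, δ ≤ P x) (hvδ : ∀ x ∈ UI, δ ≤ v x) (hPv : ∀ x ∈ UI, |P x - v x| ≤ E)
    (hQg : l2norm (fun x => Q x - g x) ≤ E) :
    MemLp (fun x => Q x / P x - g x / v x) 2 volUI ∧
      l2norm (fun x => Q x / P x - g x / v x) ≤ (1 / δ + l2norm g / δ ^ 2) * E := by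
  have hP0 : ∀ x ∈ UI, P x ≠ 0 := fun x hx => (hδ.trans_le (hPδ x hx)).ne'
  have hv0 : ∀ x ∈ UI, v x ≠ 0 := fun x hx => (hδ.trans_le (hvδ x hx)).ne'
  have hm : MemLp (fun x => Q x / P x - g x / v x) 2 volUI := by
    refine (memLp_of_continuousOn (hQ.div hP hP0) 2).sub ?_
    simp only [div_eq_mul_inv]
    exact memLp_mul_continuousOn hg (hv.inv₀ hv0)
  have hd : MemLp (fun x => Q x - g x) 2 volUI := (memLp_of_continuousOn hQ 2).sub hg
  have h1 : MemLp (fun x => 1 / δ * |Q x - g x|) 2 volUI := hd.abs.const_mul _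
  have h2 : MemLp (fun x => E / δ ^ 2 * |g x|) 2 volUI := hg.abs.const_mul _
  refine ⟨hm, (l2norm_le_of_abs_le hm (h1.add h2) ?_).trans ((l2norm_add_le h1 h2).trans ?_)⟩
  · refine ae_volUI_of_ae (Filter.Eventually.of_forall fun x hx => ?_)
    have hPx := hPδ x hx
    have hvx := hvδ x hx
    have e1 : Q x / P x - g x / v x = (Q x - g x) / P x + g x * (v x - P x) / (P x * v x) := by
      have := hP0 x hx
      have := hv0 x hx
      field_simp
      ring
    rw [e1, Pi.add_apply, abs_of_nonneg (a := 1 / δ * |Q x - g x| + _) (by positivity)]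
    refine (abs_add_le _ _).trans (add_le_add ?_ ?_)
    · rw [abs_div, abs_of_pos (hδ.trans_le hPx), one_div, mul_comm, ← div_eq_mul_inv]
      exact div_le_div_of_nonneg_left (abs_nonneg _) hδ hPx
    · rw [abs_div, abs_mul, abs_of_pos (mul_pos (hδ.trans_le hPx) (hδ.trans_le hvx)), abs_sub_comm,
        mul_comm, div_mul_eq_mul_div]
      exact div_le_div₀ (by positivity) (mul_le_mul_of_nonneg_right (hPv x hx) (abs_nonneg _))
        (by positivity) (by rw [sq]; exact mul_le_mul hPx hvx hδ.le (hδ.le.trans hPx))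
  · rw [l2norm_const_mul, l2norm_const_mul, l2norm_abs, l2norm_abs, abs_of_pos (by positivity),
      abs_of_nonneg (by positivity), add_mul]
    refine add_le_add (mul_le_mul_of_nonneg_left hQg (by positivity)) (le_of_eq ?_)
    ring

/-- The Burgers problem has a solution for all initial data in `L²`. -/
lemma IsNeumannEigensystem.exists_burgers (h : IsNeumannEigensystem V μ e)
    (hV : ContDiffOn ℝ 1 V UI) (hpos : ∀ x ∈ UI, 0 < V x) (u₀ : L2UI) :
    ∃ u, IsBurgersSolution V u₀ u := by
  have hu := Lp.memLp u₀
  have hv := continuousOn_hopf hu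
  have hg : MemLp (fun x => -(1 / 2) * u₀ x * hopf u₀ x) 2 volUI :=
    memLp_mul_continuousOn (hu.const_mul (-(1 / 2))) hv
  obtain ⟨E, hE, hEt⟩ := h.heat_tendsto hV.continuousOn hpos hg fun x hx => hopf_primitive hu hx
  have hc := h.abs_coeff_le (memLp_of_continuousOn hv 2)
  set c := fun n => coeff e n (hopf u₀) with hc'
  -- Half the lower bound of the transformed data, leaving room for the uniform error E(t) at small
  -- times.
  set δ := Real.exp (-(1 / 2 * l2norm u₀)) / 2 with hδ'
  have hδ : 0 < δ := by positivity
  have hvδ : ∀ x ∈ UI, δ ≤ hopf u₀ x := fun x hx =>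
    (half_le_self (Real.exp_pos _).le).trans (le_hopf hu hx)
  have hP : ∀ᶠ t in 𝓝[>] (0 : ℝ), ∀ x ∈ UI, δ ≤ modeSum e (heatCoef μ c 0 t) x := by
    filter_upwards [hE.eventually (gt_mem_nhds hδ), self_mem_nhdsWithin] with t h1 ht x hx
    have h2 := (abs_le.1 ((hEt t ht).2 x hx)).1
    have h3 := le_hopf hu hx
    linarith
  refine ⟨_, h.burgers_of_heat hV hpos hc
    (fun t ht x hx => h.heat_pos hV.continuousOn hpos hc hδ hP ht hx) ?_⟩
  have hlim : Tendsto (fun t => ENNReal.ofReal (2 * ((1 / δ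
      + l2norm (fun x => -(1 / 2) * u₀ x * hopf u₀ x) / δ ^ 2) * E t))) (𝓝[>] 0) (𝓝 0) := by
    have := ((hE.const_mul (1 / δ
      + l2norm (fun x => -(1 / 2) * u₀ x * hopf u₀ x) / δ ^ 2)).const_mul 2)
    simp only [mul_zero] at this
    have h0 := (ENNReal.continuous_ofReal.tendsto 0).comp this
    rwa [ENNReal.ofReal_zero] at h0
  refine tendsto_of_tendsto_of_tendsto_of_le_of_le' tendsto_const_nhds hlim
    (Filter.Eventually.of_forall fun _ => zero_le) ?_
  filter_upwards [hP, self_mem_nhdsWithin] with t h1 ht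
  have hb := h.summable_heat_one hV.continuousOn hpos hc 0 ht
  obtain ⟨h2, h3⟩ := hEt t ht
  obtain ⟨h4, h5⟩ := l2norm_div_sub_div_le (h.continuousOn_modeSum hV.continuousOn hpos hb)
    (h.continuousOn_modeSum_dx hV.continuousOn hpos hb) hv hg hδ ((l2norm_nonneg _).trans h2) h1
    hvδ h3 h2
  have h6 : (fun x => -2 * (modeSum (fun n => dx (e n)) (heatCoef μ c 0 t) x
      / modeSum e (heatCoef μ c 0 t) x) - u₀ x)
      = fun x => -2 * (modeSum (fun n => dx (e n)) (heatCoef μ c 0 t) x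
        / modeSum e (heatCoef μ c 0 t) x - -(1 / 2) * u₀ x * hopf u₀ x / hopf u₀ x) := by
    funext x
    rw [mul_div_cancel_right₀ _ (hopf_pos u₀ x).ne']
    ring
  rw [h6, eLpNorm_eq_l2norm (h4.const_mul (-2)), l2norm_const_mul]
  refine ENNReal.ofReal_le_ofReal ?_
  rw [abs_neg, abs_two]
  exact mul_le_mul_of_nonneg_left h5 two_pos.le

end Existence

/-! ### Every solution is given by the Cole-Hopf formula -/

lemma abs_exp_sub_one_le_exp_abs (y : ℝ) : |Real.exp y - 1| ≤ Real.exp |y| - 1 := by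
  rcases le_total 0 y with hy | hy
  · rw [abs_of_nonneg hy, abs_of_nonneg (sub_nonneg.2 (Real.one_le_exp hy))]
  · rw [abs_of_nonpos hy, abs_of_nonpos (sub_nonpos.2 (Real.exp_le_one_iff.2 hy))]
    have h1 := Real.exp_pos y
    have h2 : Real.exp y * Real.exp (-y) = 1 := by rw [← Real.exp_add]; simp
    nlinarith [sq_nonneg (Real.exp y - 1), Real.add_one_le_exp (-y), Real.add_one_le_exp y,
      Real.exp_pos (-y)]

/-- The quotient of two transforms is the transform of the difference u - w, whose logarithm is
controlled by its L² norm. Thus `hopf` is continuous from L² to the uniform norm. -/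
lemma abs_hopf_sub_le {u w : ℝ → ℝ} (hu : MemLp u 2 volUI) (hw : MemLp w 2 volUI) {x : ℝ}
    (hx : x ∈ UI) : |hopf u x - hopf w x|
      ≤ Real.exp (1 / 2 * l2norm w) * (Real.exp (1 / 2 * l2norm fun y => u y - w y) - 1) := by
  have h1 : hopf u x = hopf w x * Real.exp (-(1 / 2) * ∫ s in (0 : ℝ)..x, (u s - w s)) := by
    rw [intervalIntegral.integral_sub
      (intervalIntegrable_mono_UI (MemLp_intervalIntegrable hu) zero_mem_UI hx)
      (intervalIntegrable_mono_UI (MemLp_intervalIntegrable hw) zero_mem_UI hx), hopf, hopf,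
      ← Real.exp_add]
    ring_nf
  rw [h1, ← mul_sub_one, abs_mul, abs_of_pos (hopf_pos w x)]
  refine mul_le_mul (hopf_le hw hx) ((abs_exp_sub_one_le_exp_abs _).trans
    (sub_le_sub_right (Real.exp_le_exp.2 ?_) 1)) (abs_nonneg _) (Real.exp_pos _).le
  exact abs_log_hopf_le (hu.sub hw) hx

/-- Differentiation under the integral sign over `[0,x]`. -/
lemma hasDerivAt_integral_UI {F F' : ℝ → ℝ → ℝ} {t M x : ℝ} (ht : 0 < t) (hx : x ∈ UI)
    (hF : ∀ s, 0 < s → ContinuousOn (F s) UI) (hF' : ContinuousOn (F' t) UI)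
    (hM : ∀ᶠ s in 𝓝 t, ∀ y ∈ UI, |F' s y| ≤ M)
    (hd : ∀ s, 0 < s → ∀ y ∈ UI, HasDerivAt (fun r => F r y) (F' s y) s) :
    HasDerivAt (fun s => ∫ y in (0 : ℝ)..x, F s y) (∫ y in (0 : ℝ)..x, F' t y) t := by
  have hsub : uIoc 0 x ⊆ UI := uIoc_subset_uIcc.trans (uIcc_zero_subset hx)
  refine (intervalIntegral.hasDerivAt_integral_of_dominated_loc_of_deriv_le (bound := fun _ => M)
    (F := F) (F' := F') (hM.and (lt_mem_nhds ht)) ?_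
    (ContinuousOn_intervalIntegrable_UI (hF t ht) zero_mem_UI hx)
    ((hF'.mono hsub).aestronglyMeasurable measurableSet_uIoc) ?_ intervalIntegrable_const ?_).2
  · filter_upwards [lt_mem_nhds ht] with s hs
    exact ((hF s hs).mono hsub).aestronglyMeasurable measurableSet_uIoc
  · exact Filter.Eventually.of_forall fun y hy s hs => hs.1 y (hsub hy)
  · exact Filter.Eventually.of_forall fun y hy s hs => hd s hs.2 y (hsub hy)

lemma exists_local_bound {F : ℝ → ℝ → ℝ}
    (hF : ContinuousOn (fun p : ℝ × ℝ => F p.1 p.2) (Ioi 0 ×ˢ UI)) {t : ℝ} (ht : 0 < t) :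
    ∃ M, 0 ≤ M ∧ ∀ᶠ s in 𝓝 t, ∀ y ∈ UI, |F s y| ≤ M := by
  obtain ⟨M, hM⟩ := (isCompact_Icc.prod isCompact_Icc).exists_bound_of_continuousOn
    (hF.mono (show Icc (t / 2) (2 * t) ×ˢ UI ⊆ Ioi 0 ×ˢ UI from
      prod_mono (fun r hr => (half_pos ht).trans_le hr.1) le_rfl))
  refine ⟨|M|, abs_nonneg _, ?_⟩
  filter_upwards [Icc_mem_nhds (show t / 2 < t by linarith) (show t < 2 * t by linarith)]
    with s hs y hy
  exact (hM (s, y) ⟨hs, hy⟩).trans (le_abs_self M)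

lemma ContinuousOn_slice {F : ℝ → ℝ → ℝ}
    (hF : ContinuousOn (fun p : ℝ × ℝ => F p.1 p.2) (Ioi 0 ×ˢ UI)) {t : ℝ} (ht : 0 < t) :
    ContinuousOn (F t) UI :=
  hF.comp (f := fun x => (t, x)) (by fun_prop) fun _ hx => ⟨ht, hx⟩

section Uniqueness

variable {V : ℝ → ℝ} {μ : ℕ → ℝ} {e : ℕ → ℝ → ℝ} {u₀ : L2UI} {u : ℝ → ℝ → ℝ}

lemma IsBurgersSolution.continuousOn (hu : IsBurgersSolution V u₀ u) {t : ℝ} (ht : 0 < t) :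
    ContinuousOn (u t) UI := ContinuousOn_slice hu.cont ht

lemma IsBurgersSolution.hasDeriv (hu : IsBurgersSolution V u₀ u) {t : ℝ} (ht : 0 < t) :
    ∀ x ∈ UI, HasDerivWithinAt (u t) (dx (u t) x) UI x := fun _ hx =>
  ContDiffOn_hasDerivWithinAt (hu.contDiff_space t ht) two_ne_zero hx

lemma IsBurgersSolution.hasDeriv_dx (hu : IsBurgersSolution V u₀ u) {t : ℝ} (ht : 0 < t) :
    ∀ x ∈ UI, HasDerivWithinAt (dx (u t)) (dx (dx (u t)) x) UI x := fun _ hx =>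
  ContDiffOn_hasDerivWithinAt (contDiffOn_two_iff.1 (hu.contDiff_space t ht)).2 one_ne_zero hx

lemma IsBurgersSolution.hopf_hasDeriv (hu : IsBurgersSolution V u₀ u) {t : ℝ} (ht : 0 < t) :
    ∀ x ∈ UI, HasDerivWithinAt (hopf (u t)) (-(1 / 2) * u t x * hopf (u t) x) UI x := fun x hx => by
  refine (((hasDerivWithinAt_primitive (hu.continuousOn ht) hx).const_mul (-(1 / 2))).exp).congr_deriv
    ?_
  rw [hopf]; ring

lemma IsBurgersSolution.hopf_hasDeriv_dx (hu : IsBurgersSolution V u₀ u) {t : ℝ} (ht : 0 < t) :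
    ∀ x ∈ UI, HasDerivWithinAt (fun x => -(1 / 2) * u t x * hopf (u t) x)
      ((-(1 / 2) * dx (u t) x + 1 / 4 * u t x ^ 2) * hopf (u t) x) UI x := fun x hx => by
  refine (((hu.hasDeriv ht x hx).const_mul (-(1 / 2))).mul (hu.hopf_hasDeriv ht x hx)).congr_deriv ?_
  ring

/-- The time derivative of the primitive of the solution. -/
lemma IsBurgersSolution.integral_deriv (hu : IsBurgersSolution V u₀ u) (hV : ContDiffOn ℝ 1 V UI)
    {t : ℝ} (ht : 0 < t) {x : ℝ} (hx : x ∈ UI) :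
    ∫ y in (0 : ℝ)..x, deriv (fun s => u s y) t
      = dx (u t) x - dx (u t) 0 - 1 / 2 * u t x ^ 2 + 2 * V x - 2 * V 0 := by
  -- The equation in conservation form: u_t is the space derivative of u_x - ½u² + 2V.
  have hG : ∀ y ∈ UI, HasDerivWithinAt (fun y => dx (u t) y - 1 / 2 * u t y ^ 2 + 2 * V y)
      (deriv (fun s => u s y) t) UI y := fun y hy => by
    refine (((hu.hasDeriv_dx ht y hy).sub (((hu.hasDeriv ht y hy).pow 2).const_mul (1 / 2))).add
      ((ContDiffOn_hasDerivWithinAt hV one_ne_zero hy).const_mul 2)).congr_deriv ?_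
    have := hu.equation t ht y hy
    push_cast
    linarith
  rw [integral_eq_sub_of_hasDerivWithinAt hG
    (ContinuousOn_slice (F := fun t y => deriv (fun s => u s y) t) hu.cont_dt ht) hx,
    hu.boundary_zero t ht]
  ring

/-- Compared with `hopf_hasDeriv_dx`, this reads w_t = w_xx - Vw + (½u_x(t,0) + V(0))w: a linear
equation up to a factor depending on time alone. -/
lemma IsBurgersSolution.hopf_hasDerivAt (hu : IsBurgersSolution V u₀ u) (hV : ContDiffOn ℝ 1 V UI)
    {t : ℝ} (ht : 0 < t) {x : ℝ} (hx : x ∈ UI) :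
    HasDerivAt (fun s => hopf (u s) x)
      (-(1 / 2) * (dx (u t) x - dx (u t) 0 - 1 / 2 * u t x ^ 2 + 2 * V x - 2 * V 0)
        * hopf (u t) x) t := by
  obtain ⟨M, -, hM⟩ := exists_local_bound (F := fun t y => deriv (fun s => u s y) t) hu.cont_dt ht
  have h1 := hasDerivAt_integral_UI (F := u) (F' := fun t y => deriv (fun s => u s y) t) ht hx
    (fun s hs => hu.continuousOn hs)
    (ContinuousOn_slice (F := fun t y => deriv (fun s => u s y) t) hu.cont_dt ht) hM
    fun s hs y hy => (hu.diff_time s hs y hy).hasDerivAt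
  rw [hu.integral_deriv hV ht hx] at h1
  refine ((h1.const_mul (-(1 / 2))).exp).congr_deriv ?_
  rw [hopf]; ring

/-- The Fourier coefficients of the Cole-Hopf transform of a solution. -/
lemma IsBurgersSolution.coeff_hasDerivAt (hu : IsBurgersSolution V u₀ u)
    (h : IsNeumannEigensystem V μ e) (hV : ContDiffOn ℝ 1 V UI) (n : ℕ) {t : ℝ} (ht : 0 < t) :
    HasDerivAt (fun s => coeff e n (hopf (u s)))
      ((1 / 2 * dx (u t) 0 + V 0 - μ n) * coeff e n (hopf (u t))) t := by
  have hVc := hV.continuousOn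
  have hec := (h.mode n).continuousOn
  have huc : ∀ s, 0 < s → ContinuousOn (hopf (u s)) UI := fun s hs =>
    continuousOn_hopf (memLp_of_continuousOn (hu.continuousOn hs) 2)
  have hdc : ContinuousOn (dx (u t)) UI := ContinuousOn_slice (F := fun t => dx (u t)) hu.cont_dx ht
  obtain ⟨M₁, hM₁0, hM₁⟩ := exists_local_bound hu.cont ht
  obtain ⟨M₂, hM₂0, hM₂⟩ := exists_local_bound (F := fun t => dx (u t)) hu.cont_dx ht
  obtain ⟨M₃, hM₃⟩ := isCompact_Icc.exists_bound_of_continuousOn hVc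
  obtain ⟨M₄, hM₄⟩ := isCompact_Icc.exists_bound_of_continuousOn hec
  set W : ℝ → ℝ → ℝ := fun t x => -(1 / 2) *
    (dx (u t) x - dx (u t) 0 - 1 / 2 * u t x ^ 2 + 2 * V x - 2 * V 0) * hopf (u t) x with hW
  have hWc : ContinuousOn (W t) UI :=
    (continuousOn_const.mul ((((hdc.sub continuousOn_const).sub
      (continuousOn_const.mul ((hu.continuousOn ht).pow 2))).add
      (continuousOn_const.mul hVc)).sub continuousOn_const)).mul (huc t ht)
  have hM : ∀ᶠ s in 𝓝 t, ∀ y ∈ UI, |e n y * W s y|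
      ≤ M₄ * (1 / 2 * (M₂ + M₂ + 1 / 2 * M₁ ^ 2 + 2 * M₃ + 2 * M₃) * Real.exp (1 / 2 * M₁)) := by
    filter_upwards [hM₁, hM₂, lt_mem_nhds ht] with s h1 h2 hs y hy
    have b4 := hM₄ y hy
    have b0 := hM₃ 0 zero_mem_UI
    have b3 := hM₃ y hy
    rw [Real.norm_eq_abs] at b4 b3 b0
    have hm := memLp_of_continuousOn (hu.continuousOn hs) 2
    have b5 : hopf (u s) y ≤ Real.exp (1 / 2 * M₁) := (hopf_le hm hy).trans
      (Real.exp_le_exp.2 (mul_le_mul_of_nonneg_left (l2norm_le_of_bound hm hM₁0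
        (ae_volUI_of_ae (Filter.Eventually.of_forall h1))) one_half_pos.le))
    have b6 : |dx (u s) y - dx (u s) 0 - 1 / 2 * u s y ^ 2 + 2 * V y - 2 * V 0|
        ≤ M₂ + M₂ + 1 / 2 * M₁ ^ 2 + 2 * M₃ + 2 * M₃ := by
      have c1 := abs_le.1 (h2 y hy)
      have c2 := abs_le.1 (h2 0 zero_mem_UI)
      have c3 := abs_le.1 b3
      have c4 := abs_le.1 b0
      have c5 : u s y ^ 2 ≤ M₁ ^ 2 := sq_le_sq.2 ((h1 y hy).trans (le_abs_self _))
      have c6 := sq_nonneg (u s y)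
      rw [abs_le]
      constructor <;> linarith
    rw [abs_mul]
    refine mul_le_mul b4 ?_ (abs_nonneg _) ((abs_nonneg _).trans b4)
    simp only [hW]
    rw [abs_mul, abs_mul, abs_neg, abs_of_pos one_half_pos, abs_of_pos (hopf_pos _ _)]
    exact mul_le_mul (mul_le_mul_of_nonneg_left b6 one_half_pos.le) b5 (hopf_pos _ _).le
      (mul_nonneg one_half_pos.le ((abs_nonneg _).trans b6))
  have hder := hasDerivAt_integral_UI (F := fun s y => e n y * hopf (u s) y)
    (F' := fun s y => e n y * W s y) ht one_mem_UI (fun s hs => hec.mul (huc s hs)) (hec.mul hWc) hM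
    fun s hs y hy => (hu.hopf_hasDerivAt hV hs hy).const_mul (e n y)
  refine hder.congr_deriv ?_
  have hw1c : ContinuousOn (fun x => -(1 / 2) * u t x * hopf (u t) x) UI :=
    (continuousOn_const.mul (hu.continuousOn ht)).mul (huc t ht)
  have hw2c : ContinuousOn (fun x => (-(1 / 2) * dx (u t) x + 1 / 4 * u t x ^ 2) * hopf (u t) x) UI :=
    ((continuousOn_const.mul hdc).add (continuousOn_const.mul ((hu.continuousOn ht).pow 2))).mul
      (huc t ht)
  have hI : ∀ {k : ℝ → ℝ}, ContinuousOn k UI → IntervalIntegrable k volume 0 1 := fun hk =>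
    ContinuousOn_intervalIntegrable_UI hk zero_mem_UI one_mem_UI
  -- Two integrations by parts move w_xx onto e_n. The boundary terms vanish because u = 0 at both
  -- ends means w_x = 0 there.
  have hwf := (h.mode n).weak_form hVc (hI hw1c) (primitive_of_hasDeriv (hu.hopf_hasDeriv ht) hw1c)
  have hip := integral_mul_eq_sub_of_primitive (h.mode n).hasDeriv (h.mode n).continuousOn_dx
    (hI hw2c) (primitive_of_hasDeriv (hu.hopf_hasDeriv_dx ht) hw2c)
  rw [hu.boundary_zero t ht, hu.boundary_one t ht] at hip
  have hsplit : ∫ y in (0 : ℝ)..1, e n y * W t y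
      = (∫ y in (0 : ℝ)..1, e n y * ((-(1 / 2) * dx (u t) y + 1 / 4 * u t y ^ 2) * hopf (u t) y))
        - (∫ y in (0 : ℝ)..1, V y * (e n y * hopf (u t) y))
        + (1 / 2 * dx (u t) 0 + V 0) * ∫ y in (0 : ℝ)..1, e n y * hopf (u t) y := by
    have i1 : IntervalIntegrable (fun y => e n y *
        ((-(1 / 2) * dx (u t) y + 1 / 4 * u t y ^ 2) * hopf (u t) y)) volume 0 1 := hI (hec.mul hw2c)
    have i2 : IntervalIntegrable (fun y => V y * (e n y * hopf (u t) y)) volume 0 1 :=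
      hI (hVc.mul (hec.mul (huc t ht)))
    have i3 : IntervalIntegrable (fun y => (1 / 2 * dx (u t) 0 + V 0) * (e n y * hopf (u t) y))
        volume 0 1 := (hI (hec.mul (huc t ht))).const_mul _
    rw [← intervalIntegral.integral_const_mul, ← intervalIntegral.integral_sub i1 i2,
      ← intervalIntegral.integral_add (i1.sub i2) i3]
    refine intervalIntegral.integral_congr fun y _ => ?_
    simp only [hW]
    ring
  rw [hsplit, hip, coeff]
  linear_combination -hwf

lemma IsBurgersSolution.l2norm_tendsto (hu : IsBurgersSolution V u₀ u) :
    Tendsto (fun t => l2norm fun x => u t x - u₀ x) (𝓝[>] 0) (𝓝 0) := by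
  have h1 := (ENNReal.tendsto_toReal ENNReal.zero_ne_top).comp hu.initial
  rw [ENNReal.toReal_zero] at h1
  refine h1.congr' ?_
  filter_upwards [self_mem_nhdsWithin] with t ht
  have hm : MemLp (fun x => u t x - u₀ x) 2 volUI :=
    (memLp_of_continuousOn (hu.continuousOn ht) 2).sub (Lp.memLp u₀)
  rw [Function.comp_apply, eLpNorm_eq_l2norm hm, ENNReal.toReal_ofReal (l2norm_nonneg _)]

lemma IsBurgersSolution.coeff_tendsto (hu : IsBurgersSolution V u₀ u)
    (h : IsNeumannEigensystem V μ e) (n : ℕ) :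
    Tendsto (fun t => coeff e n (hopf (u t))) (𝓝[>] 0) (𝓝 (coeff e n (hopf u₀))) := by
  have hw := Lp.memLp u₀
  rw [tendsto_iff_dist_tendsto_zero]
  have hlim : Tendsto (fun t => Real.exp (1 / 2 * l2norm u₀)
      * (Real.exp (1 / 2 * l2norm fun y => u t y - u₀ y) - 1)) (𝓝[>] 0) (𝓝 0) := by
    have := (((hu.l2norm_tendsto.const_mul (1 / 2)).rexp).sub_const 1).const_mul
      (Real.exp (1 / 2 * l2norm u₀))
    simpa using this
  refine squeeze_zero' (Filter.Eventually.of_forall fun _ => dist_nonneg) ?_ hlim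
  filter_upwards [self_mem_nhdsWithin] with t ht
  have hm := memLp_of_continuousOn (hu.continuousOn ht) 2
  have hc1 := continuousOn_hopf hm
  have hc2 := continuousOn_hopf hw
  have hdm : MemLp (fun x => hopf (u t) x - hopf u₀ x) 2 volUI :=
    memLp_of_continuousOn (hc1.sub hc2) 2
  rw [Real.dist_eq, ← coeff_sub (h.mode n).continuousOn hc1 hc2]
  refine (h.abs_coeff_le hdm n).trans (l2norm_le_of_bound hdm ?_ (ae_volUI_of_ae
    (Filter.Eventually.of_forall fun x hx => abs_hopf_sub_le hm hw hx)))
  exact (abs_nonneg _).trans (abs_hopf_sub_le hm hw zero_mem_UI)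

lemma IsNeumannEigensystem.coeff_zero_pos (h : IsNeumannEigensystem V μ e) {f : ℝ → ℝ}
    (hf : ContinuousOn f UI) (hpos : ∀ x ∈ UI, 0 < f x) : 0 < coeff e 0 f := by
  refine intervalIntegral.intervalIntegral_pos_of_pos_on
    (ContinuousOn_intervalIntegrable_UI ((h.mode 0).continuousOn.mul hf) zero_mem_UI one_mem_UI)
    (fun x hx => ?_) zero_lt_one
  have hx' : x ∈ UI := Ioo_subset_Icc_self hx
  exact mul_pos (h.pos x hx') (hpos x hx')

/-- The unknown scalar ½u_x(t,0) + V(0) is the same for all n and cancels in the quotient. The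
quotient times e^{(μ_n-μ_0)s} is therefore constant, and its value is read off as s → 0. -/
lemma IsBurgersSolution.coeff_ratio (hu : IsBurgersSolution V u₀ u)
    (h : IsNeumannEigensystem V μ e) (hV : ContDiffOn ℝ 1 V UI) (n : ℕ) {t : ℝ} (ht : 0 < t) :
    coeff e n (hopf (u t)) / coeff e 0 (hopf (u t))
      = Real.exp (-(μ n - μ 0) * t) * (coeff e n (hopf u₀) / coeff e 0 (hopf u₀)) := by
  have hc0 : ∀ s, 0 < s → coeff e 0 (hopf (u s)) ≠ 0 := fun s hs =>
    (h.coeff_zero_pos (continuousOn_hopf (memLp_of_continuousOn (hu.continuousOn hs) 2))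
      fun x _ => hopf_pos _ x).ne'
  have hc00 : coeff e 0 (hopf u₀) ≠ 0 :=
    (h.coeff_zero_pos (continuousOn_hopf (Lp.memLp u₀)) fun x _ => hopf_pos _ x).ne'
  set r : ℝ → ℝ := fun s => Real.exp ((μ n - μ 0) * s)
    * (coeff e n (hopf (u s)) / coeff e 0 (hopf (u s))) with hr
  have hd : ∀ s, 0 < s → HasDerivAt r 0 s := fun s hs => by
    refine ((((hasDerivAt_id s).const_mul (μ n - μ 0)).exp).mul ((hu.coeff_hasDerivAt h hV n hs).div
      (hu.coeff_hasDerivAt h hV 0 hs) (hc0 s hs))).congr_deriv ?_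
    have := hc0 s hs
    simp only [Pi.div_apply, id_eq]
    field_simp
    ring
  have hconst : ∀ s ∈ Ioi (0 : ℝ), r s = r t := fun s hs =>
    isOpen_Ioi.is_const_of_deriv_eq_zero isPreconnected_Ioi
      (fun y hy => (hd y hy).differentiableAt.differentiableWithinAt) (fun y hy => (hd y hy).deriv)
      hs ht
  have hlim : Tendsto r (𝓝[>] 0) (𝓝 (coeff e n (hopf u₀) / coeff e 0 (hopf u₀))) := by
    have h1 : Tendsto (fun s => Real.exp ((μ n - μ 0) * s)) (𝓝[>] 0) (𝓝 1) := by
      have : Continuous fun s => Real.exp ((μ n - μ 0) * s) := by fun_prop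
      simpa using (this.tendsto 0).mono_left (nhdsWithin_le_nhds (s := Ioi 0))
    simpa using h1.mul ((hu.coeff_tendsto h n).div (hu.coeff_tendsto h 0) hc00)
  have hrt : r t = coeff e n (hopf u₀) / coeff e 0 (hopf u₀) :=
    tendsto_nhds_unique (tendsto_const_nhds.congr' (by
      filter_upwards [self_mem_nhdsWithin] with s hs
      exact (hconst s hs).symm)) hlim
  rw [← hrt, hr]
  simp only
  rw [← mul_assoc, ← Real.exp_add, ← add_mul, neg_add_cancel, zero_mul, Real.exp_zero, one_mul]

/-- The Cole-Hopf formula for the solution. -/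
lemma IsBurgersSolution.eq_heat (hu : IsBurgersSolution V u₀ u) (h : IsNeumannEigensystem V μ e)
    (hV : ContDiffOn ℝ 1 V UI) (hpos : ∀ x ∈ UI, 0 < V x) {t : ℝ} (ht : 0 < t) :
    ∃ κ, 0 < κ ∧
      (∀ x ∈ UI, hopf (u t) x = κ * modeSum e (heatCoef μ (fun n => coeff e n (hopf u₀)) 0 t) x) ∧
      ∀ x ∈ UI, u t x = -2 *
        (modeSum (fun n => dx (e n)) (heatCoef μ (fun n => coeff e n (hopf u₀)) 0 t) x
          / modeSum e (heatCoef μ (fun n => coeff e n (hopf u₀)) 0 t) x) := by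
  have hVc := hV.continuousOn
  have hc := h.abs_coeff_le (memLp_of_continuousOn (continuousOn_hopf (Lp.memLp u₀)) 2)
  set c := fun n => coeff e n (hopf u₀) with hcdef
  have hb := h.summable_heat_one hVc hpos hc 0 ht
  have hwc := continuousOn_hopf (memLp_of_continuousOn (hu.continuousOn ht) 2)
  have hc0t := h.coeff_zero_pos hwc fun x _ => hopf_pos _ x
  have hc0 := h.coeff_zero_pos (continuousOn_hopf (Lp.memLp u₀)) fun x _ => hopf_pos _ x
  -- The factor that matches the coefficients of index 0; the ratios then match all the others.
  set κ := coeff e 0 (hopf (u t)) * Real.exp (μ 0 * t) / coeff e 0 (hopf u₀) with hκ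
  have hκ0 : 0 < κ := by positivity
  have hP := h.continuousOn_modeSum hVc hpos hb
  have heq : EqOn (hopf (u t)) (fun x => κ * modeSum e (heatCoef μ c 0 t) x) UI := by
    refine h.eqOn_of_coeff_eq hwc (continuousOn_const.mul hP) fun n => ?_
    have h1 := hu.coeff_ratio h hV n ht
    have h2 : coeff e n (fun x => κ * modeSum e (heatCoef μ c 0 t) x)
        = κ * coeff e n (modeSum e (heatCoef μ c 0 t)) := by
      simp only [coeff]
      rw [← intervalIntegral.integral_const_mul]
      exact intervalIntegral.integral_congr fun x _ => by ring
    rw [h2, h.coeff_modeSum hVc hpos hb]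
    rw [div_eq_iff hc0t.ne'] at h1
    have h3 : Real.exp (-(μ n - μ 0) * t) = Real.exp (-μ n * t) * Real.exp (μ 0 * t) := by
      rw [← Real.exp_add]; ring_nf
    rw [h1, h3, hκ]
    simp only [heatCoef]
    ring
  refine ⟨κ, hκ0, heq, fun x hx => ?_⟩
  -- Differentiating hopf(u t) = κP in x recovers u, and κ drops out of the quotient.
  have h1 := hu.hopf_hasDeriv ht x hx
  have h2 := ((h.hasDeriv_modeSum hVc hpos hb hx).const_mul κ).congr heq (heq hx)
  have h3 := (uniqueDiffOn_UI x hx).eq_deriv _ h1 h2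
  have h4 := heq hx
  have h5 := hopf_pos (u t) x
  simp only at h4
  have h6 : modeSum e (heatCoef μ c 0 t) x ≠ 0 := fun h0 => by
    rw [h4, h0, mul_zero] at h5; exact lt_irrefl _ h5
  rw [h4] at h3
  rw [← mul_div_assoc, eq_div_iff h6]
  have h7 : κ * (-(1 / 2) * u t x * modeSum e (heatCoef μ c 0 t) x)
      = κ * modeSum (fun n => dx (e n)) (heatCoef μ c 0 t) x := by linear_combination h3
  have h8 := mul_left_cancel₀ hκ0.ne' h7
  linarith

end Uniqueness

/-! ### The Koopman series -/

lemma abs_tsum_le {f : ℕ → ℝ} (hf : Summable fun n => |f n|) : |∑' n, f n| ≤ ∑' n, |f n| := by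
  have h1 : Summable fun n => ‖f n‖ := by simpa only [Real.norm_eq_abs] using hf
  simpa only [Real.norm_eq_abs] using norm_tsum_le_tsum_norm h1

/-- The power of an absolutely convergent series as a series over multi-indices. -/
lemma hasSum_prod_pow {ι : Type*} {y : ι → ℝ} (hy : Summable fun n => |y n|) (m : ℕ) :
    Summable (fun q : Fin m → ι => |∏ i, y (q i)|) ∧
      HasSum (fun q : Fin m → ι => ∏ i, y (q i)) ((∑' n, y n) ^ m) := by
  induction m with
  | zero =>
    refine ⟨(hasSum_unique _).summable, ?_⟩
    simp
  | succ m ih =>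
    obtain ⟨ih1, ih2⟩ := ih
    have hs : Summable fun p : ι × (Fin m → ι) => |y p.1 * ∏ i, y (p.2 i)| :=
      Summable.mul_norm (f := y) (g := fun q : Fin m → ι => ∏ i, y (q i)) hy ih1
    have h1 : HasSum (fun p : ι × (Fin m → ι) => y p.1 * ∏ i, y (p.2 i))
        ((∑' n, y n) * (∑' n, y n) ^ m) :=
      HasSum.mul (f := y) (g := fun q : Fin m → ι => ∏ i, y (q i)) hy.of_abs.hasSum ih2 hs.of_abs
    have key : (fun q : Fin (m + 1) → ι => ∏ i, y (q i)) ∘ (Fin.consEquiv fun _ => ι)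
        = fun p : ι × (Fin m → ι) => y p.1 * ∏ i, y (p.2 i) := by
      funext p
      simp [Fin.prod_univ_succ, Fin.consEquiv]
    constructor
    · rw [← (Fin.consEquiv fun _ => ι).summable_iff]
      refine hs.congr fun p => ?_
      rw [← congrFun key p]
      rfl
    · rw [← (Fin.consEquiv fun _ => ι).hasSum_iff, key, pow_succ']
      exact h1

section Koopman

variable {V : ℝ → ℝ} {μ : ℕ → ℝ} {e : ℕ → ℝ → ℝ} {u₀ : L2UI}

/-- The term splits into a factor depending on q₀ only and a product over i of the same function of
q_i, so the inner sum will be a power. The sign (-1)^{m+1} is divided between the -2 in front and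
(-1)^m. -/
lemma koopmanTerm_multiIndex {t x : ℝ} {m : ℕ} (q₀ : ℕ) (q : Fin m → ℕ+) {ρ b : ℕ → ℝ}
    (hρ : ∀ n, coeff e n (coleHopfH u₀) / coeff e 0 (coleHopfH u₀) = ρ n)
    (hb : ∀ n, b n = Real.exp (-(μ n - μ 0) * t) * ρ n) :
    koopmanTerm μ e u₀ t x (multiIndex q₀ q)
      = -2 * (b q₀ * dx (e q₀) x) / e 0 x * ((-1) ^ m * ∏ i, b (q i) * e (q i) x / e 0 x) := by
  have h1 : Real.exp (-lam μ (multiIndex q₀ q) * t)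
      = Real.exp (-(μ q₀ - μ 0) * t) * ∏ i, Real.exp (-(μ (q i) - μ 0) * t) := by
    rw [← Real.exp_sum, ← Real.exp_add, lam, Fin.sum_univ_succ]
    simp only [multiIndex, Fin.cons_zero, Fin.cons_succ]
    rw [← Finset.sum_mul, Finset.sum_neg_distrib]
    ring_nf
  have h2 : ∏ i, b (q i) * e (q i) x / e 0 x = (∏ i, Real.exp (-(μ (q i) - μ 0) * t)) *
      (∏ i, ρ (q i)) * ∏ i, e (q i) x / e 0 x := by
    rw [← Finset.prod_mul_distrib, ← Finset.prod_mul_distrib]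
    exact Finset.prod_congr rfl fun i _ => by rw [hb]; ring
  rw [koopmanTerm, h1, h2, phi, mode, Fin.prod_univ_succ, hb q₀]
  simp only [hρ, multiIndex, Fin.cons_zero, Fin.cons_succ]
  ring

/-- Summation of the iterated series. -/
lemma hasKoopmanSum_of {t x : ℝ} {ρ b : ℕ → ℝ} {P Q : ℝ}
    (hρ : ∀ n, coeff e n (coleHopfH u₀) / coeff e 0 (coleHopfH u₀) = ρ n) (hρ0 : ρ 0 = 1)
    (hb : ∀ n, b n = Real.exp (-(μ n - μ 0) * t) * ρ n) (he0 : e 0 x ≠ 0)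
    (hP : HasSum (fun n => b n * e n x) P) (hQ : HasSum (fun n => b n * dx (e n) x) Q)
    (hR : ∑' n : ℕ, |b (n + 1) * e (n + 1) x / e 0 x| < 1) :
    HasKoopmanSum μ e u₀ t x (-2 * (Q / P)) := by
  have hb0 : b 0 = 1 := by rw [hb, hρ0]; simp
  have hs : Summable fun n : ℕ => |b (n + 1) * e (n + 1) x / e 0 x| :=
    (((summable_nat_add_iff 1).2 hP.summable).div_const _).abs
  have hs' : Summable fun n : ℕ+ => |b n * e n x / e 0 x| :=
    (summable_pnat_iff_summable_succ (f := fun n : ℕ => |b n * e n x / e 0 x|)).2 hs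
  set R := ∑' n : ℕ+, b n * e n x / e 0 x with hRdef
  have hR1 : R = ∑' n : ℕ, b (n + 1) * e (n + 1) x / e 0 x :=
    tsum_pnat_eq_tsum_succ (f := fun n : ℕ => b n * e n x / e 0 x)
  have hRlt : |R| < 1 := by
    rw [hR1]
    exact (abs_tsum_le hs).trans_lt hR
  -- Separating the mode n = 0, whose normalised coefficient is 1; what remains is the ratio, up to
  -- sign, of the geometric series.
  have hPR : P = e 0 x * (1 + R) := by
    have h1 := (hP.div_const (e 0 x)).tsum_eq
    rw [(hP.div_const (e 0 x)).summable.tsum_eq_zero_add, ← hR1, hb0, one_mul, div_self he0] at h1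
    rw [h1, mul_div_cancel₀ _ he0]
  have hne : 1 + R ≠ 0 := by linarith [(abs_lt.1 hRlt).1]
  refine ⟨fun q₀ m => -2 * (b q₀ * dx (e q₀) x) / e 0 x * ((-1) ^ m * R ^ m),
    fun q₀ => -2 * (b q₀ * dx (e q₀) x) / e 0 x * (1 + R)⁻¹, fun q₀ m => ?_, fun q₀ => ?_, ?_⟩
  · simp only [koopmanTerm_multiIndex q₀ _ hρ hb]
    have h1 := (hasSum_prod_pow hs' m).2
    exact (h1.mul_left ((-1) ^ m)).mul_left (-2 * (b q₀ * dx (e q₀) x) / e 0 x)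
  · have h1 := hasSum_geometric_of_abs_lt_one (r := -R) (by rwa [abs_neg])
    rw [sub_neg_eq_add] at h1
    simpa only [← mul_pow, neg_one_mul] using h1.mul_left _
  · have h1 := ((hQ.mul_left (-2)).div_const (e 0 x)).mul_right (1 + R)⁻¹
    have h2 : -2 * (Q / P) = -2 * Q / e 0 x * (1 + R)⁻¹ := by
      rw [hPR]
      field_simp
    rw [h2]
    exact h1

/-! ### Lower bounds through m₀ and the estimate of the modes n ≥ 1. -/

lemma IsNeumannEigensystem.m0_le (h : IsNeumannEigensystem V μ e) {x : ℝ} (hx : x ∈ UI) :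
    m0 e ≤ e 0 x :=
  csInf_le ⟨0, by rintro _ ⟨y, hy, rfl⟩; exact (h.pos y hy).le⟩ ⟨x, hx, rfl⟩

lemma IsNeumannEigensystem.m0_pos (h : IsNeumannEigensystem V μ e) : 0 < m0 e := by
  obtain ⟨x, hx, hxe, -⟩ := isCompact_Icc.exists_sInf_image_eq_and_le
    (nonempty_Icc.2 zero_le_one) (h.mode 0).continuousOn
  rw [m0, hxe]
  exact h.pos x hx

lemma integral_hopf_pos {w : ℝ → ℝ} (hw : MemLp w 2 volUI) : 0 < ∫ y in (0 : ℝ)..1, hopf w y :=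
  intervalIntegral.intervalIntegral_pos_of_pos
    (ContinuousOn_intervalIntegrable_UI (continuousOn_hopf hw) zero_mem_UI one_mem_UI)
    (hopf_pos w) zero_lt_one

lemma continuousOn_coleHopfH (u₀ : L2UI) : ContinuousOn (coleHopfH u₀) UI :=
  (continuousOn_hopf (Lp.memLp u₀)).div_const _

lemma coeff_coleHopfH (u₀ : L2UI) (n : ℕ) :
    coeff e n (coleHopfH u₀) = coeff e n (hopf u₀) / ∫ y in (0 : ℝ)..1, hopf u₀ y := by
  simp only [coeff, coleHopfH_eq, ← mul_div_assoc, intervalIntegral.integral_div]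

lemma integral_coleHopfH (u₀ : L2UI) : ∫ x in (0 : ℝ)..1, coleHopfH u₀ x = 1 := by
  simp only [coleHopfH_eq, intervalIntegral.integral_div]
  exact div_self (integral_hopf_pos (Lp.memLp u₀)).ne'

lemma coleHopfH_pos (u₀ : L2UI) (x : ℝ) : 0 < coleHopfH u₀ x :=
  div_pos (hopf_pos _ _) (integral_hopf_pos (Lp.memLp u₀))

/-- H(u₀) is a probability density, so its pairing with e₀ is an average of e₀. -/
lemma IsNeumannEigensystem.m0_le_coeff (h : IsNeumannEigensystem V μ e) (u₀ : L2UI) :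
    m0 e ≤ coeff e 0 (coleHopfH u₀) := by
  have hc := continuousOn_coleHopfH u₀
  have h1 : ∫ x in (0 : ℝ)..1, m0 e * coleHopfH u₀ x ≤ coeff e 0 (coleHopfH u₀) := by
    refine intervalIntegral.integral_mono_on zero_le_one
      (ContinuousOn_intervalIntegrable_UI (continuousOn_const.mul hc) zero_mem_UI one_mem_UI)
      (ContinuousOn_intervalIntegrable_UI ((h.mode 0).continuousOn.mul hc) zero_mem_UI one_mem_UI)
      fun x hx => mul_le_mul_of_nonneg_right (h.m0_le hx) (coleHopfH_pos u₀ x).le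
  rwa [intervalIntegral.integral_const_mul, integral_coleHopfH, mul_one] at h1

lemma IsNeumannEigensystem.coeff_sub_mul (h : IsNeumannEigensystem V μ e) {f : ℝ → ℝ}
    (hf : ContinuousOn f UI) (k : ℝ) (n : ℕ) :
    coeff e n (fun x => f x - k * e 0 x) = coeff e n f - if n = 0 then k else 0 := by
  have hk : ContinuousOn (fun x => k * e 0 x) UI :=
    continuousOn_const.mul (h.mode 0).continuousOn
  rw [coeff_sub (h.mode n).continuousOn hf hk]
  congr 1
  have h1 : ∀ x, e n x * (k * e 0 x) = k * (e n x * e 0 x) := fun x => by ring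
  simp only [coeff, h1, intervalIntegral.integral_const_mul, h.orthonormal]
  split_ifs <;> simp

/-- The orthogonal projection is the closest multiple of `e₀`. -/
lemma IsNeumannEigensystem.l2norm_sub_proj_le (h : IsNeumannEigensystem V μ e) {f : ℝ → ℝ}
    (hf : ContinuousOn f UI) (k : ℝ) :
    l2norm (fun x => f x - coeff e 0 f * e 0 x) ≤ l2norm fun x => f x - k * e 0 x := by
  have hm : ∀ k, MemLp (fun x => f x - k * e 0 x) 2 volUI := fun k =>
    memLp_of_continuousOn (hf.sub (continuousOn_const.mul (h.mode 0).continuousOn)) 2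
  refine le_of_sq_le_sq ?_ (l2norm_nonneg _)
  have h1 := h.hasSum_coeff_mul (hm (coeff e 0 f)) (hm (coeff e 0 f))
  have h2 := h.hasSum_coeff_mul (hm k) (hm k)
  simp only [← sq, h.coeff_sub_mul hf] at h1 h2
  rw [l2norm_sq, l2norm_sq]
  refine hasSum_le (fun n => ?_) h1 h2
  by_cases hn : n = 0
  · simp only [hn, if_true, sub_self, ne_eq, OfNat.ofNat_ne_zero, not_false_eq_true, zero_pow]
    exact sq_nonneg _
  · simp [hn]

/-- The Cauchy-Schwarz estimate behind the definition of `h₁`. -/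
lemma IsNeumannEigensystem.tsum_abs_le (h : IsNeumannEigensystem V μ e)
    (hV : ContinuousOn V UI) (hpos : ∀ x ∈ UI, 0 < V x) {C₁ : ℝ} (hC : IsSobolevConstant C₁)
    {f : ℝ → ℝ} (hf : ContinuousOn f UI) {t : ℝ} (ht : 0 < t) {x : ℝ} (hx : x ∈ UI) :
    ∑' n : ℕ, |Real.exp (-(μ (n + 1) - μ 0) * t) * coeff e (n + 1) f * e (n + 1) x|
      ≤ l2norm (fun x => f x - coeff e 0 f * e 0 x) * h1 C₁ μ t := by
  have hC0 : 0 ≤ C₁ := zero_le_one.trans hC.one_le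
  have hμ := h.mu_pos hV hpos
  have hm : MemLp (fun x => f x - coeff e 0 f * e 0 x) 2 volUI :=
    memLp_of_continuousOn (hf.sub (continuousOn_const.mul (h.mode 0).continuousOn)) 2
  have h1' := h.hasSum_coeff_mul hm hm
  simp only [← sq, h.coeff_sub_mul hf] at h1'
  have hS := h.summable_h1Term hV hpos ht
  refine Real.tsum_le_of_sum_le (fun n => abs_nonneg _) fun s => ?_
  have hterm : ∀ n : ℕ, |Real.exp (-(μ (n + 1) - μ 0) * t) * coeff e (n + 1) f * e (n + 1) x|
      ≤ C₁ * (|coeff e (n + 1) f| * √(h1Term μ t n)) := fun n => by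
    have e1 : √(h1Term μ t n) = √(1 + μ (n + 1)) * Real.exp (-(μ (n + 1) - μ 0) * t) := by
      rw [h1Term, Real.sqrt_mul (by linarith [hμ (n + 1)])]
      congr 1
      rw [Real.sqrt_eq_iff_mul_self_eq (Real.exp_pos _).le (Real.exp_pos _).le, ← Real.exp_add]
      ring_nf
    have e2 := abs_mode_le h.mode hV hpos h.orthonormal hC (n + 1) hx
    rw [abs_mul, abs_mul, abs_of_pos (Real.exp_pos _), e1]
    calc _ ≤ Real.exp (-(μ (n + 1) - μ 0) * t) * |coeff e (n + 1) f| * (C₁ * √(1 + μ (n + 1))) :=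
          mul_le_mul_of_nonneg_left e2 (by positivity)
      _ = _ := by ring
  refine (Finset.sum_le_sum fun n _ => hterm n).trans ?_
  rw [← Finset.mul_sum, h1, mul_left_comm]
  refine mul_le_mul_of_nonneg_left ?_ hC0
  refine (Real.sum_mul_le_sqrt_mul_sqrt s _ _).trans ?_
  refine mul_le_mul ?_ (Real.sqrt_le_sqrt ?_) (Real.sqrt_nonneg _) (l2norm_nonneg _)
  · refine Real.sqrt_le_sqrt ?_
    rw [← h1'.tsum_eq, h1'.summable.tsum_eq_zero_add]
    have e3 := ((summable_nat_add_iff 1).2 h1'.summable).sum_le_tsum s fun n _ => sq_nonneg _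
    refine le_trans (le_of_eq ?_) (e3.trans (le_add_of_nonneg_left (sq_nonneg _)))
    exact Finset.sum_congr rfl fun n _ => by simp
  · refine le_trans (le_of_eq (Finset.sum_congr rfl fun n _ => ?_))
      (hS.sum_le_tsum s fun n _ => (h1Term_pos hμ t n).le)
    exact Real.sq_sqrt (h1Term_pos hμ t n).le

/-- The Koopman decomposition under the smallness condition. -/
lemma IsBurgersSolution.hasKoopmanSum {u : ℝ → ℝ → ℝ} (hu : IsBurgersSolution V u₀ u)
    (h : IsNeumannEigensystem V μ e) (hV : ContDiffOn ℝ 1 V UI) (hpos : ∀ x ∈ UI, 0 < V x) {C₁ : ℝ}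
    (hC : IsSobolevConstant C₁) {t : ℝ} (ht : 0 < t)
    (hlt : l2norm (fun x => coleHopfH u₀ x - coeff e 0 (coleHopfH u₀) * e 0 x) /
      (coeff e 0 (coleHopfH u₀) * m0 e) * h1 C₁ μ t < 1) {x : ℝ} (hx : x ∈ UI) :
    HasKoopmanSum μ e u₀ t x (u t x) := by
  have hVc := hV.continuousOn
  have hc := h.abs_coeff_le (memLp_of_continuousOn (continuousOn_hopf (Lp.memLp u₀)) 2)
  have hb := h.summable_heat_one hVc hpos hc 0 ht
  have hN := integral_hopf_pos (Lp.memLp u₀)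
  have hc0 := h.coeff_zero_pos (continuousOn_hopf (Lp.memLp u₀)) fun x _ => hopf_pos _ x
  have hH0 := h.m0_pos.trans_le (h.m0_le_coeff u₀)
  -- Normalises the mode n = 0 of P to coefficient 1. It multiplies numerator and denominator alike,
  -- so u is unchanged.
  set κ := Real.exp (μ 0 * t) / coeff e 0 (hopf u₀) with hκ
  have hκ0 : κ ≠ 0 := by positivity
  obtain ⟨-, -, -, hux⟩ := hu.eq_heat h hV hpos ht
  have hbn : ∀ n, κ * heatCoef μ (fun n => coeff e n (hopf u₀)) 0 t n
      = Real.exp (-(μ n - μ 0) * t) * (coeff e n (coleHopfH u₀) / coeff e 0 (coleHopfH u₀)) :=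
    fun n => by
      have h3 : Real.exp (-(μ n - μ 0) * t) = Real.exp (-μ n * t) * Real.exp (μ 0 * t) := by
        rw [← Real.exp_add]; ring_nf
      rw [h3, coeff_coleHopfH, coeff_coleHopfH, div_div_div_cancel_right₀ hN.ne', hκ, heatCoef]
      ring
  have hP := (h.hasSum_modeSum hVc hpos hb hx).mul_left κ
  have hQ := (h.hasSum_modeSum_dx hVc hpos hb hx).mul_left κ
  simp only [← mul_assoc] at hP hQ
  have h1 := hasKoopmanSum_of (u₀ := u₀) (μ := μ) (fun n => rfl) (div_self hH0.ne') hbn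
    (h.pos x hx).ne' hP hQ ?_
  · rw [mul_div_mul_left _ _ hκ0] at h1
    rwa [hux x hx]
  -- The remaining goal is the smallness of the modes n ≥ 1: the common denominator c₀e₀(x) is
  -- bounded below by c₀m₀.
  · have h2 : ∀ n, |κ * heatCoef μ (fun n => coeff e n (hopf u₀)) 0 t (n + 1) * e (n + 1) x / e 0 x|
        = |Real.exp (-(μ (n + 1) - μ 0) * t) * coeff e (n + 1) (coleHopfH u₀) * e (n + 1) x|
          / (coeff e 0 (coleHopfH u₀) * e 0 x) := fun n => by
      have h3 := mul_pos hH0 (h.pos x hx)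
      have h4 := h.pos x hx
      rw [hbn, eq_div_iff h3.ne']
      conv_lhs => rw [← abs_of_pos h3]
      rw [← abs_mul]
      congr 1
      field_simp
    simp only [h2]
    rw [tsum_div_const]
    refine lt_of_le_of_lt ?_ hlt
    rw [div_mul_eq_mul_div]
    have h3 := h.tsum_abs_le hVc hpos hC (continuousOn_coleHopfH u₀) ht hx
    exact div_le_div₀ ((tsum_nonneg fun n => abs_nonneg _).trans h3) h3 (mul_pos hH0 h.m0_pos)
      (mul_le_mul_of_nonneg_left (h.m0_le hx) hH0.le)

end Koopman

section Sink

variable {V : ℝ → ℝ} {μ : ℕ → ℝ} {e : ℕ → ℝ → ℝ}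

/-! ### The smallness condition -/

/-- The numerator is the distance to the line spanned by e₀, on which f̃₀ lies; the denominator is
bounded below by c₀(H(u₀)) ≥ m₀. -/
lemma IsNeumannEigensystem.smallness_le (h : IsNeumannEigensystem V μ e) (u₀ : L2UI) {a : ℝ}
    (ha : 0 ≤ a) :
    l2norm (fun x => coleHopfH u₀ x - coeff e 0 (coleHopfH u₀) * e 0 x) /
      (coeff e 0 (coleHopfH u₀) * m0 e) * a ≤ distToSink e u₀ / m0 e ^ 2 * a := by
  have hm := h.m0_pos
  refine mul_le_mul_of_nonneg_right (div_le_div₀ (l2norm_nonneg _) ?_ (by positivity) ?_) ha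
  · refine (h.l2norm_sub_proj_le (continuousOn_coleHopfH u₀) (1 / ∫ y in (0 : ℝ)..1, e 0 y)).trans
      (le_of_eq ?_)
    rw [distToSink]
    congr 1
    funext x
    rw [fTilde]
    ring
  · rw [sq]
    exact mul_le_mul_of_nonneg_right (h.m0_le_coeff u₀) hm.le

/-- Strictness comes from h₁(t) < h₁(θ), so a weak inequality at θ is enough. This covers θ =
τ_B(u₀), where equality holds, as well as Ω_B(θ). -/
lemma IsNeumannEigensystem.smallness_of_lt (h : IsNeumannEigensystem V μ e)
    (hV : ContinuousOn V UI) (hpos : ∀ x ∈ UI, 0 < V x) {C₁ : ℝ} (hC : IsSobolevConstant C₁)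
    {u₀ : L2UI} {θ t : ℝ} (hθ : 0 < θ) (hθt : θ < t)
    (hd : distToSink e u₀ ≤ m0 e ^ 2 / h1 C₁ μ θ) :
    l2norm (fun x => coleHopfH u₀ x - coeff e 0 (coleHopfH u₀) * e 0 x) /
      (coeff e 0 (coleHopfH u₀) * m0 e) * h1 C₁ μ t < 1 := by
  have hC0 := zero_lt_one.trans_le hC.one_le
  have hm := h.m0_pos
  have h1t : 0 < h1 C₁ μ t := (h.h1_bijOn hV hpos hC0).mapsTo (hθ.trans hθt)
  have h1θ : 0 < h1 C₁ μ θ := (h.h1_bijOn hV hpos hC0).mapsTo hθ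
  have hlt := h.h1_strictAnti hV hpos hC0 hθ (hθ.trans hθt) hθt
  refine (h.smallness_le u₀ h1t.le).trans_lt ?_
  rw [le_div_iff₀ h1θ] at hd
  rw [div_mul_eq_mul_div, div_lt_one (by positivity)]
  -- At distance 0 multiplying by the distance destroys strictness, so that case is settled by m₀ >
  -- 0.
  rcases eq_or_lt_of_le (l2norm_nonneg fun x => coleHopfH u₀ x - fTilde e x) with h0 | h0
  · rw [distToSink, ← h0, zero_mul]; positivity
  · exact (mul_lt_mul_of_pos_left hlt h0).trans_le hd

lemma IsNeumannEigensystem.smallness_of_tauB_lt (h : IsNeumannEigensystem V μ e)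
    (hV : ContinuousOn V UI) (hpos : ∀ x ∈ UI, 0 < V x) {C₁ : ℝ} (hC : IsSobolevConstant C₁)
    {u₀ : L2UI} {t : ℝ} (ht : tauB C₁ μ e u₀ < t) :
    0 < t ∧ l2norm (fun x => coleHopfH u₀ x - coeff e 0 (coleHopfH u₀) * e 0 x) /
      (coeff e 0 (coleHopfH u₀) * m0 e) * h1 C₁ μ t < 1 := by
  have hC0 := zero_lt_one.trans_le hC.one_le
  have hbij := h.h1_bijOn hV hpos hC0
  have hm := h.m0_pos
  rw [tauB] at ht
  split_ifs at ht with h0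
  · refine ⟨ht, (h.smallness_le u₀ (hbij.mapsTo ht).le).trans_lt ?_⟩
    rw [h0, zero_div, zero_mul]
    exact one_pos
  · have hd : 0 < distToSink e u₀ := lt_of_le_of_ne (l2norm_nonneg _) (Ne.symm h0)
    have hmem : m0 e ^ 2 / distToSink e u₀ ∈ h1 C₁ μ '' Ioi 0 := hbij.surjOn (by
      rw [mem_Ioi]; positivity)
    have hτ := Function.invFunOn_mem hmem
    have hτe := Function.invFunOn_eq hmem
    refine ⟨lt_trans hτ ht, h.smallness_of_lt hV hpos hC hτ ht ?_⟩
    rw [hτe, div_div_cancel₀ (by positivity)]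

/-! ### The sink -/

lemma IsNeumannEigensystem.integral_pos (h : IsNeumannEigensystem V μ e) :
    0 < ∫ y in (0 : ℝ)..1, e 0 y :=
  intervalIntegral.intervalIntegral_pos_of_pos_on
    (ContinuousOn_intervalIntegrable_UI (h.mode 0).continuousOn zero_mem_UI one_mem_UI)
    (fun x hx => h.pos x (Ioo_subset_Icc_self hx)) zero_lt_one

lemma IsNeumannEigensystem.sink_eq (h : IsNeumannEigensystem V μ e) {x : ℝ} (hx : x ∈ UI) :
    sink e x = -2 * (dx (e 0) x / e 0 x) := by
  have hI := h.integral_pos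
  have hd : HasDerivWithinAt (fTilde e) (dx (e 0) x / ∫ y in (0 : ℝ)..1, e 0 y) UI x :=
    ((h.mode 0).hasDeriv x hx).div_const _
  rw [sink, coleHopfC, dx_eq hd hx, fTilde,
    div_div_div_cancel_right₀ hI.ne']

lemma IsNeumannEigensystem.continuousOn_sink (h : IsNeumannEigensystem V μ e) :
    ContinuousOn (sink e) UI :=
  (continuousOn_const.mul ((h.mode 0).continuousOn_dx.div (h.mode 0).continuousOn
    fun x hx => (h.pos x hx).ne')).congr fun _ hx => h.sink_eq hx

/-- The sink as an element of `L²([0,1])`. -/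
def IsNeumannEigensystem.sinkL2 (h : IsNeumannEigensystem V μ e) : L2UI :=
  toL2 (sink e) h.continuousOn_sink

/-- The sink is the derivative of -2 log e₀. -/
lemma IsNeumannEigensystem.hopf_sinkL2 (h : IsNeumannEigensystem V μ e) {x : ℝ} (hx : x ∈ UI) :
    hopf h.sinkL2 x = e 0 x / e 0 0 := by
  have h0 := h.pos 0 zero_mem_UI
  have hlog : ∀ y ∈ UI, HasDerivWithinAt (fun y => -2 * Real.log (e 0 y)) (sink e y) UI y :=
    fun y hy => by
      rw [h.sink_eq hy]
      exact (((h.mode 0).hasDeriv y hy).log (h.pos y hy).ne').const_mul (-2)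
  rw [hopf, IsNeumannEigensystem.sinkL2, integral_congr_ae_UI' (toL2_ae _) hx,
    integral_eq_sub_of_hasDerivWithinAt hlog h.continuousOn_sink hx]
  have h2 : -(1 / 2) * (-2 * Real.log (e 0 x) - -2 * Real.log (e 0 0))
      = Real.log (e 0 x) - Real.log (e 0 0) := by ring
  rw [h2, Real.exp_sub, Real.exp_log (h.pos x hx), Real.exp_log h0]

lemma IsNeumannEigensystem.coleHopfH_sinkL2 (h : IsNeumannEigensystem V μ e) {x : ℝ} (hx : x ∈ UI) :
    coleHopfH h.sinkL2 x = fTilde e x := by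
  rw [coleHopfH_eq, h.hopf_sinkL2 hx, integral_congr_UI fun y hy => h.hopf_sinkL2 hy,
    intervalIntegral.integral_div, div_div_div_cancel_right₀ (h.pos 0 zero_mem_UI).ne', fTilde]

end Sink

/-! ### Continuity of the normalised transform and the neighbourhood of the sink. -/

lemma l2norm_sub_eq_norm (u s : L2UI) : l2norm (fun y => u y - s y) = ‖u - s‖ := by
  rw [norm_L2UI_eq]
  exact l2norm_congr_ae (Lp.coeFn_sub u s).symm

lemma le_integral_hopf (u : L2UI) :
    Real.exp (-(1 / 2 * ‖u‖)) ≤ ∫ y in (0 : ℝ)..1, hopf u y := by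
  have h1 : ∫ _ in (0 : ℝ)..1, Real.exp (-(1 / 2 * ‖u‖)) ≤ ∫ y in (0 : ℝ)..1, hopf u y :=
    intervalIntegral.integral_mono_on zero_le_one intervalIntegrable_const
      (ContinuousOn_intervalIntegrable_UI (continuousOn_hopf (Lp.memLp u)) zero_mem_UI one_mem_UI)
      fun x hx => by rw [norm_L2UI_eq]; exact le_hopf (Lp.memLp u) hx
  simpa using h1

/-- The normalised Cole-Hopf transform is continuous from `L²` to the bounded functions. -/
lemma abs_coleHopfH_sub_le (u s : L2UI) {x : ℝ} (hx : x ∈ UI) :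
    |coleHopfH u x - coleHopfH s x| ≤
      2 * Real.exp (1 / 2 * ‖s‖) * (Real.exp (1 / 2 * ‖s‖) * (Real.exp (1 / 2 * ‖u - s‖) - 1))
        / (Real.exp (-(1 / 2 * ‖u‖)) * Real.exp (-(1 / 2 * ‖s‖))) := by
  have hu := Lp.memLp u
  have hs := Lp.memLp s
  set η := Real.exp (1 / 2 * ‖s‖) * (Real.exp (1 / 2 * ‖u - s‖) - 1) with hη
  set N := ∫ y in (0 : ℝ)..1, hopf u y with hN
  set S := ∫ y in (0 : ℝ)..1, hopf s y with hS
  have hN0 : 0 < N := integral_hopf_pos hu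
  have hS0 : 0 < S := integral_hopf_pos hs
  have hd : ∀ y ∈ UI, |hopf u y - hopf s y| ≤ η := fun y hy => by
    have := abs_hopf_sub_le hu hs hy
    rwa [l2norm_sub_eq_norm, ← norm_L2UI_eq] at this
  have hη0 : 0 ≤ η := (abs_nonneg _).trans (hd 0 zero_mem_UI)
  have hsM : ∀ y ∈ UI, hopf s y ≤ Real.exp (1 / 2 * ‖s‖) := fun y hy => by
    rw [norm_L2UI_eq]; exact hopf_le hs hy
  have hui := ContinuousOn_intervalIntegrable_UI (continuousOn_hopf hu) zero_mem_UI one_mem_UI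
  have hsi := ContinuousOn_intervalIntegrable_UI (continuousOn_hopf hs) zero_mem_UI one_mem_UI
  have hSM : S ≤ Real.exp (1 / 2 * ‖s‖) := by
    have := intervalIntegral.integral_mono_on zero_le_one hsi intervalIntegrable_const hsM
    simpa using this
  have hNS : |S - N| ≤ η := by
    rw [abs_sub_comm, hN, hS, ← intervalIntegral.integral_sub hui hsi]
    have := intervalIntegral.norm_integral_le_of_norm_le_const (a := 0) (b := 1) (C := η)
      (f := fun y => hopf u y - hopf s y) fun y hy => by
        rw [uIoc_of_le zero_le_one] at hy
        exact hd y (Ioc_subset_Icc_self hy)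
    simpa using this
  -- The difference of quotients is split into the error of the numerators and the error of the
  -- normalising integrals, each at most η times the bound on `hopf s`.
  have e1 : coleHopfH u x - coleHopfH s x
      = ((hopf u x - hopf s x) * S + hopf s x * (S - N)) / (N * S) := by
    rw [coleHopfH_eq, coleHopfH_eq, ← hN, ← hS]
    field_simp
    ring
  rw [e1, abs_div, abs_of_pos (mul_pos hN0 hS0)]
  refine div_le_div₀ (by positivity) ?_ (by positivity)
    (mul_le_mul (le_integral_hopf u) (le_integral_hopf s) (Real.exp_pos _).le hN0.le)
  refine (abs_add_le _ _).trans ?_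
  rw [abs_mul, abs_mul, abs_of_pos hS0, abs_of_pos (hopf_pos _ _)]
  have a1 := mul_le_mul (hd x hx) hSM hS0.le hη0
  have a2 := mul_le_mul (hsM x hx) hNS (abs_nonneg _) (Real.exp_pos _).le
  linarith

/-- The explicit bound on ‖H(u) - H(s)‖ is a continuous function of u that vanishes at the sink, and
H(s) = f̃₀. -/
lemma IsNeumannEigensystem.OmegaB_mem_nhds {V : ℝ → ℝ} {μ : ℕ → ℝ} {e : ℕ → ℝ → ℝ}
    (h : IsNeumannEigensystem V μ e) (hV : ContinuousOn V UI) (hpos : ∀ x ∈ UI, 0 < V x) {C₁ : ℝ}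
    (hC : IsSobolevConstant C₁) {θ : ℝ} (hθ : 0 < θ) : OmegaB C₁ μ e θ ∈ 𝓝 h.sinkL2 := by
  set s := h.sinkL2 with hs
  have h1θ : 0 < h1 C₁ μ θ :=
    (h.h1_bijOn hV hpos (zero_lt_one.trans_le hC.one_le)).mapsTo hθ
  have hm := h.m0_pos
  let f : L2UI → ℝ := fun u => 2 * Real.exp (1 / 2 * ‖s‖)
    * (Real.exp (1 / 2 * ‖s‖) * (Real.exp (1 / 2 * ‖u - s‖) - 1))
      / (Real.exp (-(1 / 2 * ‖u‖)) * Real.exp (-(1 / 2 * ‖s‖)))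
  have hf : Continuous f := by
    refine Continuous.div (by fun_prop) (by fun_prop) fun u => ?_
    positivity
  have hf0 : f s = 0 := by simp [f]
  have hev := (hf.tendsto s).eventually (gt_mem_nhds (show f s < m0 e ^ 2 / h1 C₁ μ θ by
    rw [hf0]; positivity))
  filter_upwards [hev] with u hu
  refine lt_of_le_of_lt ?_ hu
  have hb : ∀ x ∈ UI, |coleHopfH u x - fTilde e x| ≤ f u := fun x hx => by
    rw [← h.coleHopfH_sinkL2 hx]
    exact abs_coleHopfH_sub_le u s hx
  have hfc : ContinuousOn (fTilde e) UI := (h.mode 0).continuousOn.div_const _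
  exact l2norm_le_of_bound (memLp_of_continuousOn ((continuousOn_coleHopfH u).sub hfc) 2)
    ((abs_nonneg _).trans (hb 0 zero_mem_UI)) (ae_volUI_of_ae (Filter.Eventually.of_forall hb))

end KoopmanBurgers

end

theorem mainTheorem2 (V : ℝ → ℝ) (hV : ContDiffOn ℝ 1 V UI) (hVpos : ∀ x ∈ UI, 0 < V x) :
    -- the Burgers flow, the spectral data and the Sobolev constant are there
    (∀ u₀ : L2UI, (∃ u, IsBurgersSolution V u₀ u) ∧
      ∀ u w, IsBurgersSolution V u₀ u → IsBurgersSolution V u₀ w →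
        ∀ t, 0 < t → ∀ x ∈ UI, u t x = w t x) ∧
    (∃ μ e, IsNeumannEigensystem V μ e) ∧
    (∃ C₁, IsSobolevConstant C₁) ∧
    ∀ (μ : ℕ → ℝ) (e : ℕ → ℝ → ℝ), IsNeumannEigensystem V μ e →
    ∀ C₁ : ℝ, IsSobolevConstant C₁ →
      -- `h₁` is a decreasing continuous bijection of `(0,∞)`, so that `h₁⁻¹` makes sense
      ((∀ t, 0 < t → Summable (h1Term μ t)) ∧
        StrictAntiOn (h1 C₁ μ) (Ioi 0) ∧ ContinuousOn (h1 C₁ μ) (Ioi 0) ∧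
        BijOn (h1 C₁ μ) (Ioi 0) (Ioi 0)) ∧
      -- the decomposition for `t > τ_B(u₀)`
      (∀ (u₀ : L2UI) (u : ℝ → ℝ → ℝ), IsBurgersSolution V u₀ u →
        ∀ t, tauB C₁ μ e u₀ < t →
          l2norm (fun x => coleHopfH u₀ x - coeff e 0 (coleHopfH u₀) * e 0 x) /
              (coeff e 0 (coleHopfH u₀) * m0 e) * h1 C₁ μ t < 1 ∧
          ∀ x ∈ UI, HasKoopmanSum μ e u₀ t x (u t x)) ∧
      -- the decomposition for `t > θ₀` on the neighbourhood `Ω_B(θ₀)` of the sink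
      (∀ θ₀, 0 < θ₀ →
        (∃ s : L2UI, s =ᵐ[volUI] sink e ∧ OmegaB C₁ μ e θ₀ ∈ 𝓝 s) ∧
        ∀ u₀ ∈ OmegaB C₁ μ e θ₀, ∀ u : ℝ → ℝ → ℝ, IsBurgersSolution V u₀ u →
          ∀ t, θ₀ < t → ∀ x ∈ UI, HasKoopmanSum μ e u₀ t x (u t x)) := by
  have hVc := hV.continuousOn
  obtain ⟨μ₀, e₀, h₀⟩ := exists_eigensystem hVc hVpos
  refine ⟨fun u₀ => ⟨h₀.exists_burgers hV hVpos u₀, fun u w hu hw t ht x hx => ?_⟩, ⟨μ₀, e₀, h₀⟩,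
    ⟨_, isSobolevConstant_sqrt_two⟩, fun μ e h C₁ hC => ⟨⟨fun t ht => h.summable_h1Term hVc hVpos ht,
      h.h1_strictAnti hVc hVpos (zero_lt_one.trans_le hC.one_le), h.h1_continuousOn hVc hVpos C₁,
      h.h1_bijOn hVc hVpos (zero_lt_one.trans_le hC.one_le)⟩, fun u₀ u hu t ht => ?_,
      fun θ₀ hθ₀ => ⟨⟨h.sinkL2, toL2_ae h.continuousOn_sink, h.OmegaB_mem_nhds hVc hVpos hC hθ₀⟩,
        fun u₀ hu₀ u hu t ht x hx => ?_⟩⟩⟩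
  -- Both solutions equal the same quotient of series, which depends only on the data u₀.
  · obtain ⟨-, -, -, h1⟩ := hu.eq_heat h₀ hV hVpos ht
    obtain ⟨-, -, -, h2⟩ := hw.eq_heat h₀ hV hVpos ht
    rw [h1 x hx, h2 x hx]
  · obtain ⟨ht0, hlt⟩ := h.smallness_of_tauB_lt hVc hVpos hC ht
    exact ⟨hlt, fun x hx => hu.hasKoopmanSum h hV hVpos hC ht0 hlt hx⟩
  · exact hu.hasKoopmanSum h hV hVpos hC (hθ₀.trans ht)
      (h.smallness_of_lt hVc hVpos hC hθ₀ ht (le_of_lt hu₀)) hx
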